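/- Let $n\ge 2$, let $U\subseteq\mathbb R^n\times\mathbb R^m$ be open, let $h:U\to\mathbb R^n$ be of class $C^4$ with $h(0,p)=0$ for all $p$ with $(0,p)\in U$, and let $(0,p^*)\in U$, $v\in\mathbb R^m$. Put $B=D_xh(0,p^*)$, $f(x)=h(x,p^*)$ and $F(x_0,x)=\bigl(0,\,h(x,p^*+x_0v)\bigr)$. For a vector field $g$ let $L_g(\sigma)(x)=D\sigma(x)g(x)$ be the Lie derivative, and let $L_B$ be the Lie derivative of the linear vector field $x\mapsto Bx$, acting on the space $S_k$ of homogeneous polynomials of degree $k$ in $x_1,\dots,x_n$. *Normal form on an invariant manifold (NFIM).* Given linear coordinates $x=Sy$ on $\mathbb R^n$ and $\alpha,\beta\in\mathbb R$, we say that the system $\dot x=h(x,p^*+\varepsilon v)$ has an NFIM with coefficients $\alpha,\beta$ in the coordinates $S$ if, for some $\omega\ne0$, $S^{-1}BS$ is block diagonal with blocks $\begin{pmatrix}0&-\omega\\ \omega&0\end{pmatrix}$ and $M$, where all eigenvalues of $M$ have negative real part, and there is a smooth near-identity transformation $\Phi(x_0,y)=(x_0,\,y+\text{h.o.t.})$ near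 $0$ taking the system $\dot x_0=0$, $\dot y=S^{-1}h(Sy,p^*+x_0v)$ to a system which, up to terms of degree greater than three in $(x_0,y)$, has the form $$\dot x_0=0,$$ $$\dot y_1=-\omega y_2+x_0(\alpha y_1-\mu y_2)+(y_1^2+y_2^2)(\beta y_1-\gamma y_2)+x_0^2(\rho y_1-\sigma y_2),$$ $$\dot y_2=\omega y_1+x_0(\alpha y_2+\mu y_1)+(y_1^2+y_2^2)(\beta y_2+\gamma y_1)+x_0^2(\rho y_2+\sigma y_1)$$ for some real $\mu,\gamma,\rho,\sigma$, with $y_3=\dots=y_n=0$ invariant. A *Hopf bifurcation with $\alpha\ne0$ and $\beta\ne0$ in the NFIM* emanates from $p^*$ (for the system $\dot x=h(x,p^*+\varepsilon v)$, at $\varepsilon=0$) if there are linear coordinates $S$ and $\alpha\neq0$, $\beta\ne0$ such that the system has an NFIM with coefficients $\alpha,\beta$ in the coordinates $S$. **Proposition.** A Hopf bifurcation with $\alpha\ne0$ and $\beta\ne0$ in the NFIM emanates from $p^*$ if and only if the following three conditions hold. (i) $L_B|_{S_1}$ is injective, $\dim\ker(L_B|_{S_2})=1$, and the characteristic polynomial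 of $B$ factors as $a(\tau)(\tau^2+b)$ with $b>0$ and $a$ monic satisfying the Hurwitz–Routh conditions, i.e. all its Hurwitz determinants $\Delta_1,\dots,\Delta_{n-2}$ are positive. Let then $\psi$ be a positive semidefinite quadratic form of rank two spanning $\ker(L_B|_{S_2})$. (ii) There are $\beta\neq0$ and a smooth function $\widehat\psi=\psi+o(\|x\|^2)$ near $0\in\mathbb R^n$ with $L_f(\widehat\psi)=2\beta\psi^2+o(\|x\|^4)$. (iii) There are $\alpha\ne0$ and a smooth function $\widehat\theta=\psi+o(\|(x_0,x)\|^2)$ near $0\in\mathbb R\times\mathbb R^n$ with $L_F(\widehat\theta)=2\alpha x_0\psi+o(\|(x_0,x)\|^3)$. Moreover the coefficients are the same: for every polynomial $\psi$ in $x_1,\dots,x_n$ and all $\alpha,\beta\in\mathbb R$, the system has an NFIM with coefficients $\alpha,\beta$ in some linear coordinates $S$ with $\psi(Sy)=y_1^2+y_2^2$ if and only if the conditions of (i) hold, $\psi$ is a positive semidefinite quadratic form of rank two spanning $\ker(L_B|_{S_2})$, and there are $\widehat\psi$, $\widehat\theta$ as in (ii) and (iii) for these $\alpha,\beta$. -/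

import Mathlib

open scoped Topology
open Asymptotics Filter

/-- The Lie derivative `L_g(σ)(x) = Dσ(x) g(x)` of a function `σ` along a vector field `g`. -/
noncomputable def lieDeriv {E : Type*} [NormedAddCommGroup E] [NormedSpace ℝ E]
    (g : E → E) (σ : E → ℝ) (x : E) : ℝ :=
  fderiv ℝ σ x (g x)

/-- `f` is of class `C^∞` on some open neighborhood of `x`. -/
def SmoothNear {E G : Type*} [NormedAddCommGroup E] [NormedSpace ℝ E]
    [NormedAddCommGroup G] [NormedSpace ℝ G] (f : E → G) (x : E) : Prop :=
  ∃ W : Set E, IsOpen W ∧ x ∈ W ∧ ContDiffOn ℝ (⊤ : ℕ∞) f W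

/-- The linearization `B(p) = Dh(0, p)` (derivative with respect to `x`), as a matrix. -/
noncomputable def linearization {n m : ℕ}
    (h : (Fin n → ℝ) × (Fin m → ℝ) → (Fin n → ℝ)) (p : Fin m → ℝ) :
    Matrix (Fin n) (Fin n) ℝ :=
  LinearMap.toMatrix' (fderiv ℝ (fun x : Fin n → ℝ => h (x, p)) 0).toLinearMap

/-- The vector field `F_v(x₀, x) = (0, h(x, p* + x₀ v))`. -/
def suspension {E : Type*} {m : ℕ} (h : E × (Fin m → ℝ) → E) (pstar v : Fin m → ℝ) :
    ℝ × E → ℝ × E :=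
  fun z => (0, h (z.2, pstar + z.1 • v))

/-! ### Linear Lie derivatives on polynomials, and the spectral conditions -/

/-- The Lie derivative `L_B` of the linear vector field `x ↦ B x`, acting on polynomials: the
derivation with `L_B(x_i) = (B x)_i`. -/
noncomputable def lieLinear {n : ℕ} (B : Matrix (Fin n) (Fin n) ℝ) :
    MvPolynomial (Fin n) ℝ →ₗ[ℝ] MvPolynomial (Fin n) ℝ :=
  (MvPolynomial.mkDerivation ℝ
    (fun i => ∑ j, MvPolynomial.C (B i j) * MvPolynomial.X j)).toLinearMap

/-- The restriction of `L_B` to the space `S_k` of homogeneous polynomials of degree `k`. -/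
noncomputable def lieLinearOn {n : ℕ} (B : Matrix (Fin n) (Fin n) ℝ) (k : ℕ) :
    MvPolynomial.homogeneousSubmodule (Fin n) ℝ k →ₗ[ℝ] MvPolynomial (Fin n) ℝ :=
  (lieLinear B).domRestrict (MvPolynomial.homogeneousSubmodule (Fin n) ℝ k)

/-- The coefficient `c_k` in `a = c₀ τ^N + c₁ τ^(N-1) + ⋯ + c_N`, `N = deg a`, with `c_k = 0`
for `k > N`. -/
noncomputable def descCoeff (a : Polynomial ℝ) (k : ℕ) : ℝ :=
  if k ≤ a.natDegree then a.coeff (a.natDegree - k) else 0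

/-- The Hurwitz determinant `Δ_k = det (c_{2i-j})_{1 ≤ i, j ≤ k}` (`c_l = 0` for `l < 0`); below,
the indices `i`, `j` start at `0`. -/
noncomputable def hurwitzDet (a : Polynomial ℝ) (k : ℕ) : ℝ :=
  Matrix.det (Matrix.of fun i j : Fin k =>
    if (j : ℕ) ≤ 2 * (i : ℕ) + 1 then descCoeff a (2 * (i : ℕ) + 1 - (j : ℕ)) else 0)

/-- The Hurwitz-Routh conditions for a monic real polynomial: all its Hurwitz determinants are
positive. -/
def HurwitzRouth (a : Polynomial ℝ) : Prop :=
  ∀ k : ℕ, 1 ≤ k → k ≤ a.natDegree → 0 < hurwitzDet a k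

/-- The spectral conditions: `L_B` is injective on `S_1` and has one-dimensional kernel on `S_2`,
and the characteristic polynomial of `B` factors as `a(τ) (τ² + b)` with `b > 0` and `a` monic
satisfying the Hurwitz-Routh conditions. -/
def SpectralConditions {n : ℕ} (B : Matrix (Fin n) (Fin n) ℝ) : Prop :=
  Function.Injective (lieLinearOn B 1) ∧
  Module.finrank ℝ (LinearMap.ker (lieLinearOn B 2)) = 1 ∧
  ∃ (a : Polynomial ℝ) (b : ℝ), a.Monic ∧
    B.charpoly = a * (Polynomial.X ^ 2 + Polynomial.C b) ∧ 0 < b ∧ HurwitzRouth a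

/-- The Hessian matrix of a quadratic form, i.e. twice its symmetric coefficient matrix. -/
noncomputable def hessianMatrix {n : ℕ} (ψ : MvPolynomial (Fin n) ℝ) :
    Matrix (Fin n) (Fin n) ℝ :=
  Matrix.of fun i j => MvPolynomial.coeff 0 (MvPolynomial.pderiv i (MvPolynomial.pderiv j ψ))

/-- `ψ` is a positive semidefinite quadratic form of rank two which spans the kernel of `L_B`
on `S_2`. -/
def IsKernelForm {n : ℕ} (B : Matrix (Fin n) (Fin n) ℝ) (ψ : MvPolynomial (Fin n) ℝ) : Prop :=
  (∃ hψ : ψ ∈ MvPolynomial.homogeneousSubmodule (Fin n) ℝ 2,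
    Submodule.span ℝ {(⟨ψ, hψ⟩ : MvPolynomial.homogeneousSubmodule (Fin n) ℝ 2)} =
      LinearMap.ker (lieLinearOn B 2)) ∧
  (∀ x : Fin n → ℝ, 0 ≤ MvPolynomial.eval x ψ) ∧
  (hessianMatrix ψ).rank = 2

/-! ### The two Lie derivative conditions -/

/-- There is a smooth `ψ̂ = ψ + h.o.t.` with `L_f(ψ̂) = 2 β ψ² + h.o.t.` -/
def BetaCondition {n : ℕ} (f : (Fin n → ℝ) → (Fin n → ℝ)) (ψ : MvPolynomial (Fin n) ℝ)
    (β : ℝ) : Prop :=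
  ∃ ψhat : (Fin n → ℝ) → ℝ, SmoothNear ψhat 0 ∧
    (fun x => ψhat x - MvPolynomial.eval x ψ) =o[𝓝 0] (fun x => ‖x‖ ^ 2) ∧
    (fun x => lieDeriv f ψhat x - 2 * β * (MvPolynomial.eval x ψ) ^ 2)
      =o[𝓝 0] (fun x => ‖x‖ ^ 4)

/-- There is a smooth `θ̂ = ψ + h.o.t.` with `L_F(θ̂) = 2 α x₀ ψ + h.o.t.`, where higher order is
understood with respect to `(x₀, x)`. -/
def AlphaCondition {n : ℕ} (F : ℝ × (Fin n → ℝ) → ℝ × (Fin n → ℝ))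
    (ψ : MvPolynomial (Fin n) ℝ) (α : ℝ) : Prop :=
  ∃ θhat : ℝ × (Fin n → ℝ) → ℝ, SmoothNear θhat 0 ∧
    (fun z => θhat z - MvPolynomial.eval z.2 ψ) =o[𝓝 0] (fun z => ‖z‖ ^ 2) ∧
    (fun z => lieDeriv F θhat z - 2 * α * z.1 * MvPolynomial.eval z.2 ψ)
      =o[𝓝 0] (fun z => ‖z‖ ^ 3)

/-! ### Normal form on an invariant manifold -/

/-- Coordinates on `ℝ^n`, `n ≥ 2`, with the first two set apart from the remaining `n - 2`. -/
abbrev SplitSpace (n : ℕ) : Type := Fin 2 ⊕ Fin (n - 2) → ℝ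

/-- The first coordinate. -/
def crd1 {n : ℕ} (y : SplitSpace n) : ℝ := y (Sum.inl 0)

/-- The second coordinate. -/
def crd2 {n : ℕ} (y : SplitSpace n) : ℝ := y (Sum.inl 1)

/-- The vector field `X` on `ℝ × ℝ^n`, with coordinates `(x₀, x)`, is in normal form on an
invariant manifold up to degree three: `ẋ₀ = 0`, up to terms of degree greater than three in
`(x₀, x)`
* `ẋ₁ = -ω x₂ + x₀ (α x₁ - μ x₂) + (x₁² + x₂²) (β x₁ - γ x₂) + x₀² (ρ x₁ - σ x₂)`,
* `ẋ₂ =  ω x₁ + x₀ (α x₂ + μ x₁) + (x₁² + x₂²) (β x₂ + γ x₁) + x₀² (ρ x₂ + σ x₁)`,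
and, up to terms of degree greater than three, `x₃ = ⋯ = x_n = 0` is invariant. -/
structure IsNFIM {n : ℕ} (X : ℝ × SplitSpace n → ℝ × SplitSpace n)
    (ω α β μ γ ρ σ : ℝ) : Prop where
  comp_zero : ∀ᶠ z in 𝓝 0, (X z).1 = 0
  comp_one : (fun z : ℝ × SplitSpace n => crd1 (X z).2 -
      (-ω * crd2 z.2 + z.1 * (α * crd1 z.2 - μ * crd2 z.2)
        + (crd1 z.2 ^ 2 + crd2 z.2 ^ 2) * (β * crd1 z.2 - γ * crd2 z.2)
        + z.1 ^ 2 * (ρ * crd1 z.2 - σ * crd2 z.2))) =o[𝓝 0] (fun z => ‖z‖ ^ 3)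
  comp_two : (fun z : ℝ × SplitSpace n => crd2 (X z).2 -
      (ω * crd1 z.2 + z.1 * (α * crd2 z.2 + μ * crd1 z.2)
        + (crd1 z.2 ^ 2 + crd2 z.2 ^ 2) * (β * crd2 z.2 + γ * crd1 z.2)
        + z.1 ^ 2 * (ρ * crd2 z.2 + σ * crd1 z.2))) =o[𝓝 0] (fun z => ‖z‖ ^ 3)
  invariant : ∀ j : Fin (n - 2), (fun z : ℝ × SplitSpace n => (X z).2 (Sum.inr j))
      =o[𝓝[{z | ∀ i : Fin (n - 2), z.2 (Sum.inr i) = 0}] 0] (fun z => ‖z‖ ^ 3)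

/-- A smooth near-identity transformation `(x₀, x) ↦ (x₀, x + h.o.t.)` near `0`. -/
structure IsNearIdentity {E : Type*} [NormedAddCommGroup E] [NormedSpace ℝ E]
    (Φ : ℝ × E → ℝ × E) : Prop where
  smooth : SmoothNear Φ 0
  fst_eq : ∀ z, (Φ z).1 = z.1
  near_id : (fun z => Φ z - z) =o[𝓝 0] (fun z => ‖z‖)

/-- In the linear coordinates `y` given by `x = S y`, the matrix of `Dh(0, p*)` is block diagonal
with first block `(0, -ω; ω, 0)`, `ω ≠ 0`, and second block with all (complex) eigenvalues of
negative real part. -/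
def IsAdapted {n m : ℕ} (h : (Fin n → ℝ) × (Fin m → ℝ) → (Fin n → ℝ)) (pstar : Fin m → ℝ)
    (S : SplitSpace n ≃L[ℝ] (Fin n → ℝ)) (ω : ℝ) : Prop :=
  ω ≠ 0 ∧ ∃ M : Matrix (Fin (n - 2)) (Fin (n - 2)) ℝ,
    (∀ z ∈ M.charpoly.aroots ℂ, z.re < 0) ∧
    LinearMap.toMatrix' (S.symm.toLinearMap ∘ₗ Matrix.toLin' (linearization h pstar) ∘ₗ
      S.toLinearMap) = Matrix.fromBlocks !![0, -ω; ω, 0] 0 0 M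

/-- The system `ẋ₀ = 0`, `ẋ = h(x, p* + x₀ v)` satisfies the eigenvalue conditions for a Hopf
bifurcation at `x₀ = 0`, with adapted linear coordinates `S`, and in these coordinates a smooth
near-identity transformation `Φ` takes its vector field `F` to a vector field
`DΦ(z)⁻¹ F(Φ(z))` which is in normal form on an invariant manifold up to degree three, with
coefficients `α` and `β`. -/
def HasHopfNFIM {n m : ℕ} (h : (Fin n → ℝ) × (Fin m → ℝ) → (Fin n → ℝ))
    (pstar v : Fin m → ℝ) (S : SplitSpace n ≃L[ℝ] (Fin n → ℝ)) (α β : ℝ) : Prop :=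
  ∃ ω : ℝ, IsAdapted h pstar S ω ∧
    ∃ Φ : ℝ × SplitSpace n → ℝ × SplitSpace n, IsNearIdentity Φ ∧
      ∃ μ γ ρ σ : ℝ,
        IsNFIM (VectorField.pullback ℝ Φ
          (suspension (fun q : SplitSpace n × (Fin m → ℝ) => S.symm (h (S q.1, q.2))) pstar v))
          ω α β μ γ ρ σ

/-- A Hopf bifurcation of `ẋ = h(x, p* + ε v)` emanates from `p*` at `ε = 0`, with nonzero
coefficients `α` and `β` in the normal form on an invariant manifold. -/
def HopfBifurcation {n m : ℕ} (h : (Fin n → ℝ) × (Fin m → ℝ) → (Fin n → ℝ))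
    (pstar v : Fin m → ℝ) : Prop :=
  ∃ (S : SplitSpace n ≃L[ℝ] (Fin n → ℝ)) (α β : ℝ), α ≠ 0 ∧ β ≠ 0 ∧
    HasHopfNFIM h pstar v S α β

/-! The function y₁² + y₂² links the normal form to the two Lie derivative conditions. For a vector
field in normal form the coefficients ω, μ, γ, σ only rotate and drop out of its Lie derivative,
which is 2αx₀(y₁² + y₂²) + 2β(y₁² + y₂²)² + 2ρx₀²(y₁² + y₂²) up to o(‖z‖⁴)
(`IsNFIM.lieDeriv_circleFn`). Transported to the original coordinates, this function agrees with ψ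
to second order. Its Lie derivative up to third order gives (iii), and its restriction to x₀ = 0
gives (ii).

The spectral conditions are the linear part of the statement. The Hurwitz–Routh criterion
`hurwitzRouth_iff` turns the determinants into stability of a. If B is block diagonal in the
coordinates S, an invariant quadratic form has Hessian H with HB + BᵀH = 0. The blocks of this
Sylvester equation leave only multiples of y₁² + y₂² (`invariant_form_of_blocks`). Conversely,
`exists_adapted_coordinates` builds S from ψ: the kernel of its Hessian carries the stable block,
and a vector e with B²e = -be, together with Be, spans the center plane.

For the converse of the nonlinear part, the conditions (ii) and (iii) are not used to construct a
normal form. Every C³ field with the right linear part, vanishing at 0 and with ẋ₀ = 0, has one with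
some coefficients α', β' (`exists_isNFIM_pullback`). The homological equation is solved in degrees
two and three over ℂ, where products of generalized eigenvectors of degree one span the homogeneous
polynomials, and only x₀ζ, x₀²ζ and ζ²ζ̄ with ζ = y₁ + iy₂ resist.

It remains to show that (ii) and (iii) determine the coefficients. If θ̂ is as in (iii) and T is the
transformation, then δ = θ̂∘T - (y₁² + y₂²) is o(‖z‖²), and its Lie derivative is 2(α - α')x₀(y₁² +
y₂²) + o(‖z‖³). By Rolle's theorem the angular derivative of δ vanishes somewhere on each small
circle around the x₀-axis in the center space. At such points the rest of the field contributes only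
o(r³), so α = α' (`IsNFIM.eq_zero_of_lieDeriv`). The same argument on x₀ = 0, one order higher,
gives β = β'. -/

/-! ### The Hurwitz–Routh criterion -/

/-- The determinant of the `k × k` Hurwitz matrix of the coefficient sequence `c`. -/
noncomputable def seqHurwitzDet (c : ℕ → ℝ) (k : ℕ) : ℝ :=
  Matrix.det (Matrix.of fun i j : Fin k =>
    if (j : ℕ) ≤ 2 * (i : ℕ) + 1 then c (2 * (i : ℕ) + 1 - (j : ℕ)) else 0)

lemma hurwitzDet_eq_seqHurwitzDet (a : Polynomial ℝ) (k : ℕ) :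
    hurwitzDet a k = seqHurwitzDet (descCoeff a) k := rfl

/-- One step of the Routh scheme, on Hurwitz determinants. -/
lemma seqHurwitzDet_succ (c b : ℕ → ℝ) (κ : ℝ) (h0 : c 0 = κ * c 1)
    (heven : ∀ k, Even k → b k = c (k + 1))
    (hodd : ∀ k, ¬ Even k → b k = c (k + 1) - κ * c (k + 2)) (k : ℕ) :
    seqHurwitzDet c (k + 1) = c 1 * seqHurwitzDet b k := by
  unfold seqHurwitzDet
  -- Column operations: from each column of odd index (counted from 0) subtract κ times its
  -- predecessor. Since `c 0 = κ * c 1`, the first row becomes (c 1, 0, …, 0), and the complementary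
  -- minor is the Hurwitz matrix of b.
  rw [Matrix.det_eq_of_forall_col_eq_smul_add_pred (n := k)
    (B := Matrix.of (fun i j => Fin.cases (c (2 * (i : ℕ) + 1))
      (fun j' : Fin k => (if (j' : ℕ) ≤ 2 * (i : ℕ) then c (2 * (i : ℕ) - j') else 0) -
        (if Even (j' : ℕ) then κ else 0) *
          (if (j' : ℕ) ≤ 2 * (i : ℕ) + 1 then c (2 * (i : ℕ) + 1 - j') else 0)) j))
    (fun j => if Even (j : ℕ) then κ else 0)]
  · rw [Matrix.det_succ_row_zero, Fin.sum_univ_succ, Finset.sum_eq_zero, add_zero]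
    · simp only [Fin.val_zero, pow_zero, one_mul, Matrix.of_apply, Fin.cases_zero, mul_zero, zero_add]
      congr 2
      ext i j
      simp only [Matrix.submatrix_apply, Matrix.of_apply, Fin.succAbove_zero, Fin.cases_succ,
        Fin.val_succ]
      by_cases hj : (j : ℕ) ≤ 2 * i + 1
      · obtain ⟨l, hl⟩ := Nat.exists_eq_add_of_le hj
        have e1 : 2 * (i : ℕ) + 1 - j = l := by omega
        have e2 : 2 * ((i : ℕ) + 1) - j = l + 1 := by omega
        have e3 : 2 * ((i : ℕ) + 1) + 1 - j = l + 2 := by omega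
        have c2 : (j : ℕ) ≤ 2 * (i + 1) := by omega
        have c3 : (j : ℕ) ≤ 2 * (i + 1) + 1 := by omega
        simp only [hj, c2, c3, if_true, e1, e2, e3]
        by_cases hl2 : Even l
        · have c4 : ¬ Even (j : ℕ) := by rw [Nat.even_iff] at hl2 ⊢; omega
          rw [heven l hl2, if_neg c4]; ring
        · have c4 : Even (j : ℕ) := by rw [Nat.even_iff] at hl2 ⊢; omega
          rw [hodd l hl2, if_pos c4]
      · rw [if_neg hj]
        -- Just outside the range of b the entry is c 0 - κ c 1, which has to vanish as well.
        by_cases hj2 : (j : ℕ) = 2 * i + 2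
        · have c2 : (j : ℕ) ≤ 2 * (i + 1) := by omega
          have c3 : (j : ℕ) ≤ 2 * (i + 1) + 1 := by omega
          have c4 : Even (j : ℕ) := by rw [Nat.even_iff]; omega
          simp only [c2, c3, c4, if_true, show 2 * ((i : ℕ) + 1) - j = 0 by omega,
            show 2 * ((i : ℕ) + 1) + 1 - j = 1 by omega, h0]
          ring
        · have c2 : ¬ (j : ℕ) ≤ 2 * (i + 1) := by omega
          rw [if_neg c2]
          by_cases hj3 : (j : ℕ) = 2 * i + 3
          · have c4 : ¬ Even (j : ℕ) := by rw [Nat.even_iff]; omega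
            rw [if_neg c4]; ring
          · have c3 : ¬ (j : ℕ) ≤ 2 * (i + 1) + 1 := by omega
            rw [if_neg c3]; ring
    · intro j _
      simp only [Matrix.of_apply, Fin.cases_succ, Fin.val_zero]
      by_cases hj : (j : ℕ) = 0
      · simp [hj, h0]
      · by_cases hj1 : (j : ℕ) = 1
        · simp [hj1]
        · have c3 : ¬ (j : ℕ) ≤ 1 := by omega
          simp [hj, c3]
  · intro i; simp
  · intro i j
    simp only [Matrix.of_apply, Fin.cases_succ, Fin.val_succ, Fin.val_castSucc]
    rw [sub_add_cancel]
    by_cases hj : (j : ℕ) ≤ 2 * i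
    · rw [if_pos hj, if_pos (by omega)]; congr 1; omega
    · rw [if_neg hj, if_neg (by omega)]

/-- All complex roots have negative real part. -/
def IsStablePoly (a : Polynomial ℝ) : Prop := ∀ z : ℂ, Polynomial.aeval z a = 0 → z.re < 0

/-- The polynomial `(-1)^N a(-τ)`, where `N` is the degree of `a`. -/
noncomputable def reflPoly (a : Polynomial ℝ) : Polynomial ℝ :=
  Polynomial.C ((-1) ^ a.natDegree) * a.comp (Polynomial.C (-1) * Polynomial.X)

lemma aeval_reflPoly (a : Polynomial ℝ) (z : ℂ) :
    Polynomial.aeval z (reflPoly a) = (-1) ^ a.natDegree * Polynomial.aeval (-z) a := by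
  simp [reflPoly, Polynomial.aeval_comp]

lemma coeff_reflPoly (a : Polynomial ℝ) (i : ℕ) :
    (reflPoly a).coeff i = (-1) ^ (a.natDegree + i) * a.coeff i := by
  simp only [reflPoly, Polynomial.coeff_C_mul, Polynomial.comp_C_mul_X_coeff]; ring

/-- The terms of `a` of degrees `N - 1, N - 3, …`, where `N` is the degree of `a`. -/
noncomputable def oddTerms (a : Polynomial ℝ) : Polynomial ℝ :=
  Polynomial.C (1 / 2) * (a - reflPoly a)

lemma coeff_oddTerms_of_even (a : Polynomial ℝ) {i : ℕ} (hi : Even (a.natDegree + i)) :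
    (oddTerms a).coeff i = 0 := by
  simp [oddTerms, coeff_reflPoly, hi.neg_one_pow]

lemma coeff_oddTerms_of_odd (a : Polynomial ℝ) {i : ℕ} (hi : ¬ Even (a.natDegree + i)) :
    (oddTerms a).coeff i = a.coeff i := by
  rw [Nat.not_even_iff_odd] at hi
  simp only [oddTerms, coeff_reflPoly, hi.neg_one_pow, Polynomial.coeff_C_mul, Polynomial.coeff_sub]
  ring

/-- One step of the Routh scheme. -/
noncomputable def routhStep (a : Polynomial ℝ) : Polynomial ℝ :=
  a - Polynomial.C (descCoeff a 0 / descCoeff a 1) * (Polynomial.X * oddTerms a)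

lemma descCoeff_zero (a : Polynomial ℝ) : descCoeff a 0 = a.leadingCoeff := by
  simp [descCoeff]

section routhStep
variable {a : Polynomial ℝ} (hN : 1 ≤ a.natDegree) (h1 : descCoeff a 1 ≠ 0)

lemma coeff_routhStep_succ (a : Polynomial ℝ) (i : ℕ) :
    (routhStep a).coeff (i + 1) =
      a.coeff (i + 1) - descCoeff a 0 / descCoeff a 1 * (oddTerms a).coeff i := by
  simp [routhStep, Polynomial.coeff_X_mul]

lemma coeff_routhStep_zero (a : Polynomial ℝ) : (routhStep a).coeff 0 = a.coeff 0 := by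
  simp [routhStep]

-- The factor c₀/c₁ is chosen to cancel the leading term. The coefficient of degree N - 1 survives
-- unchanged because `oddTerms a` has no term of degree N - 2.
include hN h1 in
lemma natDegree_routhStep : (routhStep a).natDegree = a.natDegree - 1 ∧
    (routhStep a).leadingCoeff = descCoeff a 1 := by
  have hc1 : descCoeff a 1 = a.coeff (a.natDegree - 1) := by simp [descCoeff, hN]
  have key : (routhStep a).coeff (a.natDegree - 1) = descCoeff a 1 := by
    rcases h : a.natDegree - 1 with _ | i
    · rw [coeff_routhStep_zero, hc1, h]
    · rw [coeff_routhStep_succ, coeff_oddTerms_of_even, hc1, h]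
      · ring
      · rw [show a.natDegree = i + 2 by omega, Nat.even_iff]; omega
  have hdeg : (routhStep a).natDegree = a.natDegree - 1 := by
    refine Polynomial.natDegree_eq_of_le_of_coeff_ne_zero ?_ (by rw [key]; exact h1)
    rw [Polynomial.natDegree_le_iff_coeff_eq_zero]
    intro i hi
    obtain ⟨i, rfl⟩ : ∃ j, i = j + 1 := ⟨i - 1, by omega⟩
    rw [coeff_routhStep_succ]
    rcases eq_or_ne (i + 1) a.natDegree with h | h
    · rw [coeff_oddTerms_of_odd _ (by rw [Nat.even_iff]; omega), descCoeff_zero,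
        Polynomial.leadingCoeff, h, hc1, ← h, Nat.add_sub_cancel, div_mul_cancel₀, sub_self]
      rwa [hc1, ← h, Nat.add_sub_cancel] at h1
    · rw [Polynomial.coeff_eq_zero_of_natDegree_lt (by omega)]
      by_cases he : Even (a.natDegree + i)
      · rw [coeff_oddTerms_of_even _ he]; ring
      · have : i ≠ a.natDegree := fun h => he ⟨_, by rw [h]⟩
        rw [coeff_oddTerms_of_odd _ he, Polynomial.coeff_eq_zero_of_natDegree_lt (by omega)]; ring
  exact ⟨hdeg, by rw [Polynomial.leadingCoeff, hdeg, key]⟩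

-- Subtracting (c₀/c₁) X · `oddTerms a` alters only coefficients whose degree has the parity of N.
-- In the descending numbering of `routhStep a` these are the ones of odd index, as
-- `seqHurwitzDet_succ` requires.
include hN h1 in
lemma hurwitzDet_routhStep (k : ℕ) :
    hurwitzDet a (k + 1) = descCoeff a 1 * hurwitzDet (routhStep a) k := by
  obtain ⟨hdeg, -⟩ := natDegree_routhStep hN h1
  simp only [hurwitzDet_eq_seqHurwitzDet]
  refine seqHurwitzDet_succ _ _ (descCoeff a 0 / descCoeff a 1) (by field_simp) ?_ ?_ k
  · intro k hk
    simp only [descCoeff, hdeg]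
    by_cases hkN : k + 1 ≤ a.natDegree
    · rw [if_pos hkN, if_pos (by omega), show a.natDegree - (k + 1) = a.natDegree - 1 - k by omega]
      rcases h : a.natDegree - 1 - k with _ | i
      · rw [coeff_routhStep_zero]
      · rw [coeff_routhStep_succ, coeff_oddTerms_of_even]
        · ring
        · rw [show a.natDegree = i + k + 2 by omega]; rw [Nat.even_iff] at hk ⊢; omega
    · rw [if_neg hkN, if_neg (by omega)]
  · intro k hk
    by_cases hkN : k + 1 ≤ a.natDegree
    · rw [descCoeff, hdeg, if_pos (by omega)]
      rcases h : a.natDegree - 1 - k with _ | i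
      · rw [coeff_routhStep_zero, descCoeff, descCoeff.eq_def a (k + 2), if_pos hkN,
          if_neg (by omega), show a.natDegree - (k + 1) = 0 by omega]; ring
      · rw [coeff_routhStep_succ, coeff_oddTerms_of_odd, descCoeff.eq_def a (k + 1), if_pos hkN,
          descCoeff.eq_def a (k + 2), if_pos (by omega), show a.natDegree - (k + 1) = i + 1 by omega,
          show a.natDegree - (k + 2) = i by omega]
        rw [Nat.even_iff] at hk ⊢; omega
    · rw [descCoeff, hdeg, if_neg (by omega), descCoeff.eq_def a (k + 1), if_neg (by omega),
        descCoeff.eq_def a (k + 2), if_neg (by omega)]; ring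

end routhStep

/-- A quantitative comparison of `∏ (τ - λ)` and `∏ (τ + conj λ)` in the right half plane. -/
lemma prod_reflection_ineq (s : Multiset ℂ) (hs : ∀ l ∈ s, l.re < 0) (τ : ℂ) (hτ : 0 ≤ τ.re) :
    0 ≤ (s.map fun l => -2 * l.re).sum ∧
    Complex.normSq (s.map fun l => τ + starRingEnd ℂ l).prod ≤
      Complex.normSq (s.map fun l => τ - l).prod ∧
    2 * τ.re * Complex.normSq ((s.map fun l => τ - l).prod -
        (s.map fun l => τ + starRingEnd ℂ l).prod) ≤
      (s.map fun l => -2 * l.re).sum * (Complex.normSq (s.map fun l => τ - l).prod -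
        Complex.normSq (s.map fun l => τ + starRingEnd ℂ l).prod) ∧
    ((s.map fun l => -2 * l.re).sum = 0 → (s.map fun l => τ - l).prod =
        (s.map fun l => τ + starRingEnd ℂ l).prod) := by
  induction s using Multiset.induction_on with
  | empty => simp
  | cons l s ih =>
    obtain ⟨i1, i2, i3, i4⟩ := ih fun x hx => hs x (Multiset.mem_cons_of_mem hx)
    have hl := hs l (Multiset.mem_cons_self l s)
    simp only [Multiset.map_cons, Multiset.prod_cons, Multiset.sum_cons]
    generalize (s.map fun l => -2 * l.re).sum = w at *
    generalize (s.map fun l => τ - l).prod = P at *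
    generalize (s.map fun l => τ + starRingEnd ℂ l).prod = Q at *
    have hu : Complex.normSq (τ - l) - Complex.normSq (τ + starRingEnd ℂ l) =
        2 * τ.re * (-2 * l.re) := by
      simp only [Complex.normSq_apply, Complex.sub_re, Complex.sub_im, Complex.add_re,
        Complex.add_im, Complex.conj_re, Complex.conj_im]; ring
    have hu0 : 0 ≤ Complex.normSq (τ + starRingEnd ℂ l) := Complex.normSq_nonneg _
    have hQ0 : 0 ≤ Complex.normSq Q := Complex.normSq_nonneg _
    have ht : 0 ≤ 2 * τ.re * (-2 * l.re) := by nlinarith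
    refine ⟨by linarith, ?_, ?_, fun h => by linarith⟩
    · simp only [Complex.normSq_mul]
      have : Complex.normSq (τ + starRingEnd ℂ l) ≤ Complex.normSq (τ - l) := by linarith
      exact mul_le_mul this i2 hQ0 (Complex.normSq_nonneg _)
    · set u := τ - l with hu_def
      set v : ℝ := -2 * l.re with hv
      have hv0 : 0 < v := by rw [hv]; linarith
      -- With v = -2 Re l one has τ + conj l = u - v, so the new difference of products splits into
      -- u times the old one and v Q.
      have e : u * P - (τ + starRingEnd ℂ l) * Q = u * (P - Q) + (v : ℂ) * Q := by
        have : (τ + starRingEnd ℂ l) = u - v := by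
          apply Complex.ext <;> simp [hu_def, hv] <;> ring
        rw [this]; ring
      rw [e]
      simp only [Complex.normSq_mul]
      set d := P - Q
      have hexp : (v + w) * (Complex.normSq u * Complex.normSq P -
          Complex.normSq (τ + starRingEnd ℂ l) * Complex.normSq Q) =
          (v + w) * (Complex.normSq u * (Complex.normSq P - Complex.normSq Q)
            + 2 * τ.re * v * Complex.normSq Q) := by rw [← hu]; ring
      rw [hexp]
      -- If w = 0 the old products agree and the claim is an equality. If w > 0, the inequality is
      -- multiplied by w v, and the cross term is controlled by |v u d - w v Q|² ≥ 0.
      rcases i1.eq_or_lt with hw | hw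
      · have hd : d = 0 := by rw [sub_eq_zero]; exact i4 hw.symm
        have hPQ : P = Q := sub_eq_zero.1 hd
        simp only [hd, mul_zero, zero_add, Complex.normSq_mul,
          Complex.normSq_ofReal, ← hw, add_zero, hPQ, sub_self]
        apply le_of_eq; ring
      · have hmain : w * v * Complex.normSq (u * d + v * Q) ≤
            (v + w) * (v * (Complex.normSq u * Complex.normSq d) + w * v ^ 2 * Complex.normSq Q) := by
          have : (v + w) * (v * (Complex.normSq u * Complex.normSq d) + w * v ^ 2 * Complex.normSq Q)
              - w * v * Complex.normSq (u * d + v * Q) =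
              Complex.normSq (v * (u * d) - w * (v * Q)) := by
            simp only [Complex.normSq_sub, Complex.normSq_add,
              Complex.normSq_ofReal, map_mul, Complex.conj_ofReal]
            have : ((v : ℂ) * (u * d) * ((w : ℂ) * ((v : ℂ) * starRingEnd ℂ Q))).re =
               v * w * (u * d * ((v : ℂ) * starRingEnd ℂ Q)).re := by
              have : (v : ℂ) * (u * d) * ((w : ℂ) * ((v : ℂ) * starRingEnd ℂ Q)) =
                ((v * w : ℝ) : ℂ) * (u * d * ((v : ℂ) * starRingEnd ℂ Q)) := by push_cast; ring
              rw [this, Complex.re_ofReal_mul]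
            rw [this]; ring
          have h0 := Complex.normSq_nonneg (v * (u * d) - w * (v * Q))
          linarith
        have hwv : 0 < w * v := mul_pos hw hv0
        have hnu : 0 ≤ Complex.normSq u := Complex.normSq_nonneg _
        have i5 := mul_le_mul_of_nonneg_left i3 (mul_nonneg hv0.le hnu)
        have i6 := mul_le_mul_of_nonneg_left hmain (by linarith : 0 ≤ 2 * τ.re)
        refine le_of_mul_le_mul_left ?_ hwv
        have i7 := mul_le_mul_of_nonneg_left i5 (by linarith : 0 ≤ v + w)
        nlinarith

/-- The zeros of `reflPoly a` are the reflections -conj λ of the zeros λ of a in the imaginary axis,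
so `prod_reflection_ineq` compares the two polynomials. By Vieta, 2c₁/c₀ is the sum of the numbers
-2 Re λ. -/
lemma isStablePoly_ineq {a : Polynomial ℝ} (ha : IsStablePoly a) (h0 : 0 < a.leadingCoeff)
    (τ : ℂ) (hτ : 0 ≤ τ.re) :
    (1 ≤ a.natDegree → 0 < descCoeff a 1) ∧
    Complex.normSq (Polynomial.aeval τ (reflPoly a)) ≤ Complex.normSq (Polynomial.aeval τ a) ∧
    2 * τ.re * Complex.normSq (Polynomial.aeval τ a - Polynomial.aeval τ (reflPoly a)) * a.leadingCoeff
     ≤ (2 * descCoeff a 1) * (Complex.normSq (Polynomial.aeval τ a) -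
        Complex.normSq (Polynomial.aeval τ (reflPoly a))) := by
  set q : Polynomial ℂ := a.map (algebraMap ℝ ℂ) with hq
  have hq0 : a ≠ 0 := by rintro rfl; simp at h0
  have hsp : q.Splits := IsAlgClosed.splits q
  have hev : ∀ z : ℂ, Polynomial.aeval z a =
      a.leadingCoeff * (q.roots.map fun l => z - l).prod := by
    intro z
    rw [← Polynomial.eval_map_algebraMap, ← hq, hsp.eval_eq_prod_roots]
    simp [hq]
  have hroots : ∀ l ∈ q.roots, l.re < 0 := by
    intro l hl
    refine ha l ?_
    rw [← Polynomial.eval_map_algebraMap]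
    exact (Polynomial.mem_roots'.1 hl).2
  have hcard : q.roots.card = a.natDegree := by
    rw [← hsp.natDegree_eq_card_roots, hq, Polynomial.natDegree_map]
  have hrefl : Polynomial.aeval τ (reflPoly a) =
      a.leadingCoeff * (q.roots.map fun l => τ + starRingEnd ℂ l).prod := by
    have h1 : Polynomial.aeval (-τ) a = starRingEnd ℂ (Polynomial.aeval (-starRingEnd ℂ τ) a) := by
      rw [← Polynomial.aeval_conj]; simp
    rw [aeval_reflPoly, h1, hev, map_mul, map_multiset_prod, Multiset.map_map, Complex.conj_ofReal]
    have : (q.roots.map ((starRingEnd ℂ) ∘ fun l => -(starRingEnd ℂ) τ - l)) =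
        q.roots.map (fun l => (-1) * (τ + starRingEnd ℂ l)) := by
      refine Multiset.map_congr rfl fun l _ => ?_
      simp; ring
    rw [this, Multiset.prod_map_mul, Multiset.map_const', Multiset.prod_replicate, hcard]
    have : ((-1 : ℂ) ^ a.natDegree) * (-1) ^ a.natDegree = 1 := by
      rw [← mul_pow]; simp
    linear_combination (a.leadingCoeff * (q.roots.map fun l => τ + starRingEnd ℂ l).prod) * this
  have hsum : (1 ≤ a.natDegree → 2 * descCoeff a 1 =
      a.leadingCoeff * (q.roots.map fun l => -2 * l.re).sum) := by
    intro hN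
    have h2 := hsp.nextCoeff_eq_neg_sum_roots_mul_leadingCoeff
    have h3 : q.nextCoeff = (descCoeff a 1 : ℂ) := by
      rw [Polynomial.nextCoeff, if_neg (by rw [hq, Polynomial.natDegree_map]; omega), hq,
        Polynomial.natDegree_map, descCoeff, if_pos hN, Polynomial.coeff_map]; rfl
    have h4 : (q.roots.map fun l : ℂ => -2 * l.re).sum = -2 * q.roots.sum.re := by
      rw [Multiset.sum_map_mul_left, ← Complex.coe_reAddGroupHom, map_multiset_sum]
    rw [h3, hq, Polynomial.leadingCoeff_map, ← hq] at h2
    have h5 := congrArg Complex.re h2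
    simp only [Complex.ofReal_re, Complex.coe_algebraMap, neg_mul, Complex.neg_re,
      Complex.re_ofReal_mul] at h5
    rw [h4, h5]; ring
  obtain ⟨i1, i2, i3, i4⟩ := prod_reflection_ineq q.roots hroots τ hτ
  refine ⟨?_, ?_, ?_⟩
  · intro hN
    have : 0 < (q.roots.map fun l => -2 * l.re).sum := by
      have hne : q.roots ≠ 0 := by rw [← Multiset.card_pos]; omega
      obtain ⟨l, hl⟩ := Multiset.exists_mem_of_ne_zero hne
      obtain ⟨t, ht⟩ := Multiset.exists_cons_of_mem hl
      have j1 := (prod_reflection_ineq t (fun x hx => hroots x (ht ▸ Multiset.mem_cons_of_mem hx)) τ hτ).1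
      rw [ht, Multiset.map_cons, Multiset.sum_cons]
      linarith [hroots l hl]
    have h7 := mul_pos h0 this
    rw [← hsum hN] at h7
    linarith
  · rw [hrefl, hev, Complex.normSq_mul, Complex.normSq_mul]
    exact mul_le_mul_of_nonneg_left i2 (Complex.normSq_nonneg _)
  · rw [hrefl, hev, ← mul_sub, Complex.normSq_mul, Complex.normSq_mul, Complex.normSq_mul,
      Complex.normSq_ofReal]
    by_cases hN : 1 ≤ a.natDegree
    · rw [hsum hN]
      nlinarith [mul_le_mul_of_nonneg_left i3 (by positivity : 0 ≤ a.leadingCoeff ^ 3)]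
    · have : q.roots = 0 := by rw [← Multiset.card_eq_zero]; omega
      simp [this]

lemma aeval_routhStep (a : Polynomial ℝ) (τ : ℂ) :
    Polynomial.aeval τ (routhStep a) = Polynomial.aeval τ a -
      ((descCoeff a 0 / descCoeff a 1 : ℝ) : ℂ) *
        (τ * ((Polynomial.aeval τ a - Polynomial.aeval τ (reflPoly a)) / 2)) := by
  simp only [routhStep, oddTerms, map_sub, map_mul, Polynomial.aeval_C, Polynomial.aeval_X,
    Complex.coe_algebraMap]
  push_cast
  ring

lemma reflPoly_reflPoly_aeval (a : Polynomial ℝ) (τ : ℂ) :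
    Polynomial.aeval (-τ) (reflPoly a) = (-1) ^ a.natDegree * Polynomial.aeval τ a := by
  rw [aeval_reflPoly, neg_neg]

/-- In both directions a zero τ of one polynomial with Re τ ≥ 0 is inserted into the reflection
inequality for the other one, which is stable. With P = a(τ), Q the value of the reflection of a,
and κ = c₀/c₁, the inequality forces (P - Q)/2 = 0 in one direction and Q = 0 in the other. Then the
stable polynomial vanishes at τ too. -/
lemma isStablePoly_routhStep {a : Polynomial ℝ} (hN : 1 ≤ a.natDegree)
    (h0 : 0 < a.leadingCoeff) (h1 : 0 < descCoeff a 1) :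
    IsStablePoly a ↔ IsStablePoly (routhStep a) := by
  set κ := descCoeff a 0 / descCoeff a 1 with hκ
  have hκ0 : 0 < κ := div_pos (by rwa [descCoeff_zero]) h1
  constructor
  · intro ha τ hτ
    by_contra! hre
    obtain ⟨-, -, i⟩ := isStablePoly_ineq ha h0 τ hre
    rw [aeval_routhStep, ← hκ] at hτ
    have hne : Polynomial.aeval τ a ≠ 0 := fun h => absurd (ha τ h) (by linarith)
    generalize Polynomial.aeval τ a = P at *
    generalize Polynomial.aeval τ (reflPoly a) = Q at *
    have hc : a.leadingCoeff = κ * descCoeff a 1 := by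
      rw [hκ, ← descCoeff_zero]; field_simp
    rw [hc] at i
    -- The factor Re τ in this bound exactly compensates the positive part of 4(κ Re τ - 1)|D|²
    -- below, leaving -4|D|² ≥ 0. The plain inequality |Q| ≤ |P| would not suffice.
    have i' : τ.re * Complex.normSq (P - Q) * κ ≤ Complex.normSq P - Complex.normSq Q := by
      refine le_of_mul_le_mul_left ?_ (by linarith : 0 < 2 * descCoeff a 1)
      linarith
    obtain ⟨D, hD⟩ : ∃ D, D = (P - Q) / 2 := ⟨_, rfl⟩
    have hP : P = κ * (τ * D) := by rw [hD]; linear_combination hτ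
    have hQ : Q = P - 2 * D := by rw [hD]; ring
    have e : Complex.normSq P - Complex.normSq Q =
        4 * (κ * τ.re - 1) * Complex.normSq D := by
      rw [hQ, hP]
      simp only [Complex.normSq_apply, Complex.sub_re, Complex.sub_im, Complex.ofReal_re,
        Complex.ofReal_im, Complex.mul_re, Complex.mul_im, Complex.re_ofNat, Complex.im_ofNat]
      ring
    have e2 : Complex.normSq (P - Q) = 4 * Complex.normSq D := by
      rw [hQ]; simp [Complex.normSq_mul]; norm_num
    rw [e, e2] at i'
    have : Complex.normSq D = 0 := le_antisymm (by linarith) (Complex.normSq_nonneg _)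
    rw [Complex.normSq_eq_zero] at this
    rw [this] at hP
    exact hne (by simpa using hP)
  · intro hb τ hτ
    by_contra! hre
    obtain ⟨hdeg, hlead⟩ := natDegree_routhStep hN h1.ne'
    obtain ⟨-, i, -⟩ := isStablePoly_ineq hb (by rwa [hlead]) τ hre
    have hne : Polynomial.aeval τ (routhStep a) ≠ 0 := fun h => absurd (hb τ h) (by linarith)
    have hpow : (-1 : ℂ) ^ a.natDegree * (-1) ^ a.natDegree = 1 := by rw [← mul_pow]; simp
    have hpow' : (-1 : ℂ) ^ (a.natDegree - 1) = - (-1) ^ a.natDegree := by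
      conv_rhs => rw [show a.natDegree = (a.natDegree - 1) + 1 by omega, pow_succ]
      ring
    rw [aeval_reflPoly, aeval_routhStep, hdeg, aeval_routhStep, reflPoly_reflPoly_aeval,
      hpow', ← hκ, hτ] at i
    rw [aeval_routhStep, ← hκ, hτ] at hne
    rw [aeval_reflPoly] at i hne
    obtain ⟨Q, hQ⟩ : ∃ Q, Q = (-1 : ℂ) ^ a.natDegree * (Polynomial.aeval (-τ)) a := ⟨_, rfl⟩
    have hmul : -(-1 : ℂ) ^ a.natDegree * ((Polynomial.aeval (-τ)) a - κ * (-τ *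
        (((Polynomial.aeval (-τ)) a - (-1) ^ a.natDegree * 0) / 2))) = -(Q + κ * (τ * (Q / 2))) := by
      rw [hQ]; ring
    rw [hmul, ← hQ, Complex.normSq_neg] at i
    rw [← hQ] at hne
    have e1 : Complex.normSq (Q + κ * (τ * (Q / 2))) = Complex.normSq (1 + κ * τ / 2) *
        Complex.normSq Q := by rw [← Complex.normSq_mul]; congr 1; ring
    have e2 : Complex.normSq (0 - κ * (τ * ((0 - Q) / 2))) = Complex.normSq (κ * τ / 2) *
        Complex.normSq Q := by rw [← Complex.normSq_mul]; congr 1; ring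
    have e3 : Complex.normSq (1 + κ * τ / 2) = Complex.normSq (κ * τ / 2) + 1 + κ * τ.re := by
      have : (κ * τ / 2 : ℂ) = ((κ / 2 : ℝ) : ℂ) * τ := by push_cast; ring
      rw [this]
      simp only [Complex.normSq_apply, Complex.add_re, Complex.add_im, Complex.one_re,
        Complex.one_im, Complex.re_ofReal_mul, Complex.im_ofReal_mul]
      ring
    rw [e1, e2, e3] at i
    have hQ0 : Complex.normSq Q = 0 := by
      have := Complex.normSq_nonneg Q
      nlinarith [mul_nonneg (mul_nonneg hκ0.le hre) this]
    rw [Complex.normSq_eq_zero] at hQ0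
    exact hne (by rw [hQ0]; simp)

/-- The Hurwitz-Routh criterion. -/
lemma hurwitzRouth_iff_of_leadingCoeff_pos (N : ℕ) : ∀ a : Polynomial ℝ, a.natDegree = N →
    0 < a.leadingCoeff → (HurwitzRouth a ↔ IsStablePoly a) := by
  -- The induction needs positive leading coefficients instead of monic polynomials, because the
  -- leading coefficient of `routhStep a` is c₁.
  induction N with
  | zero =>
    intro a hN h0
    constructor
    · intro _ z hz
      rw [Polynomial.eq_C_of_natDegree_eq_zero hN] at hz h0
      simp at hz h0
      exact absurd hz h0.ne'
    · intro _ k h1 h2; omega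
  | succ N ih =>
    intro a hN h0
    have hH1 : hurwitzDet a 1 = descCoeff a 1 := by
      simp [hurwitzDet, Matrix.det_unique]
    by_cases h1 : 0 < descCoeff a 1
    · obtain ⟨hdeg, hlead⟩ := natDegree_routhStep (by omega) h1.ne'
      rw [isStablePoly_routhStep (by omega) h0 h1, ← ih _ (by omega) (by rwa [hlead])]
      constructor
      · intro H k hk1 hk2
        have := H (k + 1) (by omega) (by omega)
        rw [hurwitzDet_routhStep (by omega) h1.ne'] at this
        exact pos_of_mul_pos_right this h1.le
      · intro H k hk1 hk2
        obtain ⟨k, rfl⟩ : ∃ j, k = j + 1 := ⟨k - 1, by omega⟩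
        rw [hurwitzDet_routhStep (by omega) h1.ne']
        rcases Nat.eq_zero_or_pos k with rfl | hk
        · simpa [hurwitzDet] using h1
        · exact mul_pos h1 (H k hk (by omega))
    -- If c₁ ≤ 0 both sides fail: Δ₁ = c₁, and stability forces c₁ > 0.
    · constructor
      · intro H; exact absurd (hH1 ▸ H 1 le_rfl (by omega)) h1
      · intro H; exact absurd ((isStablePoly_ineq H h0 0 (by simp)).1 (by omega)) h1

lemma hurwitzRouth_iff {a : Polynomial ℝ} (ha : a.Monic) : HurwitzRouth a ↔ IsStablePoly a :=
  hurwitzRouth_iff_of_leadingCoeff_pos _ a rfl (by rw [ha.leadingCoeff]; exact one_pos)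

/-! ### Sylvester equations and invariant quadratic forms -/

open Matrix in
lemma symm_matrix_eq_zero {ι : Type*} [Fintype ι] [DecidableEq ι] {D : Matrix ι ι ℝ}
    (hD : Dᵀ = D) (h : ∀ x : ι → ℝ, x ⬝ᵥ D *ᵥ x = 0) : D = 0 := by
  have key : ∀ x y : ι → ℝ, x ⬝ᵥ D *ᵥ y = 0 := by
    intro x y
    have h1 := h (x + y)
    have h2 : y ⬝ᵥ D *ᵥ x = x ⬝ᵥ D *ᵥ y := by
      rw [dotProduct_mulVec, ← mulVec_transpose, hD, dotProduct_comm]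
    simp only [mulVec_add, dotProduct_add, add_dotProduct, h, h2] at h1
    linarith
  ext i j
  have := key (Pi.single i 1) (Pi.single j 1)
  simpa using this

/-- A solution of a Sylvester equation whose coefficient matrices have no common eigenvalue
vanishes. -/
lemma sylvester_aeval {p q : Type*} [Fintype p] [Fintype q] [DecidableEq p] [DecidableEq q]
    {X : Matrix p q ℝ} {M : Matrix q q ℝ} {N : Matrix p p ℝ} (h : X * M = N * X)
    (r : Polynomial ℝ) : X * Polynomial.aeval M r = Polynomial.aeval N r * X := by
  induction r using Polynomial.induction_on' with
  | add r s hr hs => simp only [map_add, Matrix.mul_add, Matrix.add_mul, hr, hs]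
  | monomial k c =>
    have hk : X * M ^ k = N ^ k * X := by
      induction k with
      | zero => simp
      | succ k ih => rw [pow_succ, ← Matrix.mul_assoc, ih, Matrix.mul_assoc, h, pow_succ,
          Matrix.mul_assoc]
    simp only [Polynomial.aeval_monomial, Algebra.algebraMap_eq_smul_one, smul_mul_assoc, one_mul,
      Matrix.mul_smul, Matrix.smul_mul, hk]

/-- From X M = N X follows X r(M) = r(N) X = 0, and r(M) is invertible: a Bézout identity for r and
the characteristic polynomial of M, evaluated at M, loses its second term by Cayley–Hamilton. -/
lemma sylvester_eq_zero {p q : Type*} [Fintype p] [Fintype q] [DecidableEq p] [DecidableEq q]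
    {X : Matrix p q ℝ} {M : Matrix q q ℝ} {N : Matrix p p ℝ} (h : X * M = N * X)
    {r : Polynomial ℝ} (hr : Polynomial.aeval N r = 0)
    (hc : ∀ z : ℂ, Polynomial.aeval z r = 0 → Polynomial.aeval z M.charpoly ≠ 0) : X = 0 := by
  have hco : IsCoprime r M.charpoly := by
    refine (Polynomial.isCoprime_iff_aeval_ne_zero_of_isAlgClosed ℝ ℂ _ _).2 fun z => ?_
    by_cases hz : Polynomial.aeval z r = 0
    · exact Or.inr (hc z hz)
    · exact Or.inl hz
  obtain ⟨u, v, huv⟩ := hco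
  have h1 := congrArg (Polynomial.aeval M) huv
  rw [map_add, map_mul, map_mul, Matrix.aeval_self_charpoly, mul_zero, add_zero, map_one,
    ← map_mul, mul_comm, map_mul] at h1
  calc X = X * (Polynomial.aeval M r * Polynomial.aeval M u) := by rw [h1, Matrix.mul_one]
    _ = 0 := by rw [← Matrix.mul_assoc, sylvester_aeval h, hr, Matrix.zero_mul, Matrix.zero_mul]

lemma mkDerivation_eq_sum_pderiv {R σ : Type*} [CommRing R] [Fintype σ] [DecidableEq σ]
    (f : σ → MvPolynomial σ R) (q : MvPolynomial σ R) :
    MvPolynomial.mkDerivation R f q = ∑ i, MvPolynomial.pderiv i q * f i := by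
  induction q using MvPolynomial.induction_on with
  | C a => simp
  | add p q hp hq => simp only [map_add, hp, hq, add_mul, Finset.sum_add_distrib]
  | mul_X p i hp =>
    simp only [Derivation.leibniz, MvPolynomial.mkDerivation_X, hp, smul_eq_mul, add_mul,
      Finset.sum_add_distrib, Finset.mul_sum]
    congr 1
    · rw [Finset.sum_eq_single i]
      · simp
      · intro b _ hb
        simp [MvPolynomial.pderiv_X, hb.symm]
      · simp
    · exact Finset.sum_congr rfl fun j _ => by ring

section quadratic
variable {n : ℕ}

lemma eval_homogeneous_one {p : MvPolynomial (Fin n) ℝ} (hp : p.IsHomogeneous 1)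
    (x : Fin n → ℝ) :
    MvPolynomial.eval x p = ∑ j, MvPolynomial.coeff 0 (MvPolynomial.pderiv j p) * x j := by
  have h := congrArg (MvPolynomial.eval x) hp.sum_X_mul_pderiv
  rw [one_smul] at h
  rw [← h, map_sum]
  refine Finset.sum_congr rfl fun j _ => ?_
  have h0 : (MvPolynomial.pderiv j p).IsHomogeneous 0 := hp.pderiv
  rw [map_mul, MvPolynomial.eval_X, mul_comm]
  congr 1
  rw [← MvPolynomial.totalDegree_zero_iff_isHomogeneous,
    MvPolynomial.totalDegree_eq_zero_iff_eq_C] at h0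
  conv_lhs => rw [h0]
  simp

lemma hessianMatrix_transpose (q : MvPolynomial (Fin n) ℝ) :
    (hessianMatrix q).transpose = hessianMatrix q := by
  ext i j
  simp only [hessianMatrix, Matrix.transpose_apply, Matrix.of_apply, MvPolynomial.coeff_pderiv]
  rw [zero_add, zero_add, add_comm]
  by_cases h : i = j
  · subst h; rfl
  · have h' : j ≠ i := fun e => h e.symm
    simp [h]

open Matrix in
lemma eval_pderiv_eq_hessianMatrix {q : MvPolynomial (Fin n) ℝ} (hq : q.IsHomogeneous 2)
    (i : Fin n) (x : Fin n → ℝ) :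
    MvPolynomial.eval x (MvPolynomial.pderiv i q) = (hessianMatrix q *ᵥ x) i := by
  rw [eval_homogeneous_one hq.pderiv, ← hessianMatrix_transpose]
  rfl

open Matrix in
lemma eval_eq_hessianMatrix {q : MvPolynomial (Fin n) ℝ} (hq : q.IsHomogeneous 2)
    (x : Fin n → ℝ) :
    2 * MvPolynomial.eval x q = x ⬝ᵥ hessianMatrix q *ᵥ x := by
  have h := congrArg (MvPolynomial.eval x) hq.sum_X_mul_pderiv
  rw [map_sum, nsmul_eq_mul, map_mul] at h
  simp only [Nat.cast_ofNat, map_ofNat, map_mul, MvPolynomial.eval_X,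
    eval_pderiv_eq_hessianMatrix hq] at h
  exact h.symm

open Matrix in
lemma eval_lieLinear (B : Matrix (Fin n) (Fin n) ℝ) (q : MvPolynomial (Fin n) ℝ) (x : Fin n → ℝ) :
    MvPolynomial.eval x (lieLinear B q) =
      ∑ i, MvPolynomial.eval x (MvPolynomial.pderiv i q) * (B *ᵥ x) i := by
  change MvPolynomial.eval x (MvPolynomial.mkDerivation ℝ _ q) = _
  rw [mkDerivation_eq_sum_pderiv, map_sum]
  refine Finset.sum_congr rfl fun i _ => ?_
  simp [Matrix.mulVec, dotProduct]

open Matrix in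
/-- The kernel of `L_B` on quadratic forms, in terms of the Hessian matrix. -/
lemma lieLinear_eq_zero_iff (B : Matrix (Fin n) (Fin n) ℝ) {q : MvPolynomial (Fin n) ℝ}
    (hq : q.IsHomogeneous 2) :
    lieLinear B q = 0 ↔ hessianMatrix q * B + Bᵀ * hessianMatrix q = 0 := by
  set H := hessianMatrix q with hH
  have hT : Hᵀ = H := hessianMatrix_transpose q
  have hev : ∀ x, MvPolynomial.eval x (lieLinear B q) = x ⬝ᵥ (H * B) *ᵥ x := by
    intro x
    rw [eval_lieLinear]
    simp only [eval_pderiv_eq_hessianMatrix hq]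
    change (H *ᵥ x) ⬝ᵥ (B *ᵥ x) = _
    rw [← hT, mulVec_transpose, ← dotProduct_mulVec, mulVec_mulVec, hT]
  have hev2 : ∀ x, 2 * MvPolynomial.eval x (lieLinear B q) = x ⬝ᵥ (H * B + Bᵀ * H) *ᵥ x := by
    intro x
    have : x ⬝ᵥ (Bᵀ * H) *ᵥ x = x ⬝ᵥ (H * B) *ᵥ x := by
      have : (Bᵀ * H) = (H * B)ᵀ := by rw [transpose_mul, hT]
      rw [this, dotProduct_mulVec, vecMul_transpose, dotProduct_comm]
    rw [add_mulVec, dotProduct_add, this, hev]; ring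
  constructor
  · intro h
    refine symm_matrix_eq_zero ?_ fun x => ?_
    · rw [transpose_add, transpose_mul, transpose_mul, hT, transpose_transpose, add_comm]
    · rw [← hev2, h]; simp
  · intro h
    refine MvPolynomial.funext fun x => ?_
    have := hev2 x
    rw [h, zero_mulVec, dotProduct_zero] at this
    simpa using this

end quadratic

lemma rotation_charpoly (ω : ℝ) : (!![0, -ω; ω, 0] : Matrix (Fin 2) (Fin 2) ℝ).charpoly =
    Polynomial.X ^ 2 + Polynomial.C (ω ^ 2) := by
  rw [Matrix.charpoly_fin_two]
  simp [Matrix.trace_fin_two, Matrix.det_fin_two, sq]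

lemma isStablePoly_iff_aroots {a : Polynomial ℝ} (ha : a.Monic) :
    IsStablePoly a ↔ ∀ z ∈ a.aroots ℂ, z.re < 0 := by
  simp only [Polynomial.mem_aroots, IsStablePoly]
  exact ⟨fun h z hz => h z hz.2, fun h z hz => h z ⟨ha.ne_zero, hz⟩⟩

lemma re_eq_zero_of_sq_add_eq_zero {z : ℂ} {b : ℝ} (hb : 0 < b) (h : z ^ 2 + b = 0) :
    z.re = 0 := by
  have h1 := congrArg Complex.re h
  have h2 := congrArg Complex.im h
  simp [sq] at h1 h2
  rcases mul_eq_zero.1 (by linarith : z.re * z.im = 0) with h | h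
  · exact h
  · rw [h] at h1; nlinarith [sq_nonneg z.re]

open Matrix in
/-- An invariant symmetric matrix of a block diagonal matrix with blocks a rotation and a stable
matrix. -/
lemma invariant_form_of_blocks {r : ℕ} {ω : ℝ} (hω : ω ≠ 0) {M : Matrix (Fin r) (Fin r) ℝ}
    (hM : IsStablePoly M.charpoly) {H : Matrix (Fin 2 ⊕ Fin r) (Fin 2 ⊕ Fin r) ℝ} (hH : Hᵀ = H)
    (h : H * fromBlocks !![0, -ω; ω, 0] 0 0 M + (fromBlocks !![0, -ω; ω, 0] 0 0 M)ᵀ * H = 0) :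
    ∃ c : ℝ, H = fromBlocks (c • 1) 0 0 0 := by
  set J : Matrix (Fin 2) (Fin 2) ℝ := !![0, -ω; ω, 0] with hJ
  have hω2 : 0 < ω ^ 2 := by positivity
  rw [← fromBlocks_toBlocks H] at h hH ⊢
  rw [fromBlocks_transpose, fromBlocks_multiply, fromBlocks_multiply, fromBlocks_add,
    ← fromBlocks_zero, fromBlocks_inj] at h
  rw [fromBlocks_transpose, fromBlocks_inj] at hH
  obtain ⟨h11, h12, h21, h22⟩ := h
  obtain ⟨s11, s12, s21, s22⟩ := hH
  simp only [Matrix.mul_zero, Matrix.zero_mul, add_zero, zero_add, transpose_zero] at h11 h12 h21 h22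
  -- Since -Jᵀ = J, this block intertwines J and M, whose spectra are separated by the imaginary
  -- axis: that of J lies on it, that of M to its left.
  have e12 : H.toBlocks₁₂ = 0 := by
    refine sylvester_eq_zero (M := M) (N := -Jᵀ) (r := Polynomial.X ^ 2 + Polynomial.C (ω ^ 2)) ?_ ?_ ?_
    · rw [Matrix.neg_mul]; exact eq_neg_of_add_eq_zero_left h12
    · have : -Jᵀ = J := by
        ext i j; fin_cases i <;> fin_cases j <;> simp [hJ]
      rw [this, ← rotation_charpoly, hJ, Matrix.aeval_self_charpoly]
    · intro z hz hz2
      have := hM z hz2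
      rw [re_eq_zero_of_sq_add_eq_zero hω2 (by simpa using hz)] at this
      exact lt_irrefl _ this
  -- Here the spectra of M and -Mᵀ lie in opposite open half planes.
  have e22 : H.toBlocks₂₂ = 0 := by
    refine sylvester_eq_zero (M := M) (N := -Mᵀ) (r := M.charpoly.comp (-Polynomial.X)) ?_ ?_ ?_
    · rw [Matrix.neg_mul]; exact eq_neg_of_add_eq_zero_left h22
    · rw [Polynomial.aeval_comp]
      simp only [map_neg, Polynomial.aeval_X, neg_neg]
      rw [← charpoly_transpose, Matrix.aeval_self_charpoly]
    · intro z hz hz2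
      rw [Polynomial.aeval_comp] at hz
      have h1 := hM _ hz
      have h2 := hM _ hz2
      simp at h1
      linarith
  have e21 : H.toBlocks₂₁ = 0 := by rw [← s21, e12, transpose_zero]
  refine ⟨H.toBlocks₁₁ 0 0, ?_⟩
  rw [e12, e22, e21]
  congr 1
  -- What is left is a symmetric 2 × 2 block commuting with J, hence a scalar matrix.
  have a00 := congrFun (congrFun h11 0) 0
  have a01 := congrFun (congrFun h11 0) 1
  have b01 := congrFun (congrFun s11 0) 1
  simp [hJ, Matrix.mul_apply, Fin.sum_univ_two] at a00 a01 b01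
  have c01 : H.toBlocks₁₁ 0 1 = 0 := by
    rw [b01] at a00
    have : ω * H.toBlocks₁₁ 0 1 = 0 := by linarith
    exact (mul_eq_zero.1 this).resolve_left hω
  have c11 : H.toBlocks₁₁ 1 1 = H.toBlocks₁₁ 0 0 := by
    have : ω * (H.toBlocks₁₁ 1 1 - H.toBlocks₁₁ 0 0) = 0 := by linarith
    exact sub_eq_zero.1 ((mul_eq_zero.1 this).resolve_left hω)
  ext i j
  fin_cases i <;> fin_cases j <;> simp [c01, c11, b01]

/-! ### Block diagonal form implies the spectral conditions -/

section adapted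
variable {n : ℕ} {B : Matrix (Fin n) (Fin n) ℝ} {S : SplitSpace n ≃L[ℝ] (Fin n → ℝ)} {ω : ℝ}
  {M : Matrix (Fin (n - 2)) (Fin (n - 2)) ℝ}

/-- The quadratic form which is `y₁² + y₂²` in the coordinates `x = S y`. -/
noncomputable def circleForm (S : SplitSpace n ≃L[ℝ] (Fin n → ℝ)) : MvPolynomial (Fin n) ℝ :=
  ∑ i : Fin 2, (∑ j, MvPolynomial.C (S.symm (Pi.single j 1) (Sum.inl i)) * MvPolynomial.X j) ^ 2

lemma eval_circleForm (S : SplitSpace n ≃L[ℝ] (Fin n → ℝ)) (x : Fin n → ℝ) :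
    MvPolynomial.eval x (circleForm S) = crd1 (S.symm x) ^ 2 + crd2 (S.symm x) ^ 2 := by
  have h : ∀ i, S.symm x i = ∑ j, S.symm (Pi.single j 1) i * x j := by
    intro i
    conv_lhs => rw [pi_eq_sum_univ' x]
    simp only [map_sum, map_smul, Finset.sum_apply, Pi.smul_apply, smul_eq_mul, mul_comm]
  simp [circleForm, crd1, crd2, h]

lemma isHomogeneous_circleForm (S : SplitSpace n ≃L[ℝ] (Fin n → ℝ)) :
    (circleForm S).IsHomogeneous 2 := by
  refine MvPolynomial.IsHomogeneous.sum _ _ _ fun i _ => ?_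
  refine MvPolynomial.IsHomogeneous.pow (m := 1) ?_ 2
  exact MvPolynomial.IsHomogeneous.sum _ _ _ fun j _ => MvPolynomial.isHomogeneous_C_mul_X _ _

lemma eq_circleForm {ψ : MvPolynomial (Fin n) ℝ}
    (hψ : ∀ y, MvPolynomial.eval (S y) ψ = crd1 y ^ 2 + crd2 y ^ 2) : ψ = circleForm S := by
  refine MvPolynomial.funext fun x => ?_
  rw [eval_circleForm, ← hψ, S.apply_symm_apply]

/-- The matrix of `S`. -/
noncomputable def coordMatrix (S : SplitSpace n ≃L[ℝ] (Fin n → ℝ)) :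
    Matrix (Fin n) (Fin 2 ⊕ Fin (n - 2)) ℝ := LinearMap.toMatrix' S.toLinearMap

open Matrix in
lemma coordMatrix_mulVec (y : SplitSpace n) : coordMatrix S *ᵥ y = S y :=
  LinearMap.toMatrix'_mulVec _ _

open Matrix in
lemma conj_iff (N : Matrix (Fin 2 ⊕ Fin (n - 2)) (Fin 2 ⊕ Fin (n - 2)) ℝ) :
    LinearMap.toMatrix' (S.symm.toLinearMap ∘ₗ Matrix.toLin' B ∘ₗ S.toLinearMap) = N ↔
      ∀ y, B *ᵥ S y = S (N *ᵥ y) := by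
  constructor
  · rintro rfl y
    rw [LinearMap.toMatrix'_mulVec]
    change _ = S (S.symm (Matrix.toLin' B (S y)))
    rw [S.apply_symm_apply, Matrix.toLin'_apply]
  · intro h
    rw [← LinearMap.toMatrix'_toLin' N]
    congr 1
    refine LinearMap.ext fun y => ?_
    change S.symm (Matrix.toLin' B (S y)) = _
    rw [Matrix.toLin'_apply, h, S.symm_apply_apply, Matrix.toLin'_apply]

open Matrix in
lemma conj_charpoly {N : Matrix (Fin 2 ⊕ Fin (n - 2)) (Fin 2 ⊕ Fin (n - 2)) ℝ}
    (h : LinearMap.toMatrix' (S.symm.toLinearMap ∘ₗ Matrix.toLin' B ∘ₗ S.toLinearMap) = N) :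
    B.charpoly = N.charpoly := by
  have e : S.symm.toLinearMap ∘ₗ Matrix.toLin' B ∘ₗ S.toLinearMap =
      S.symm.toLinearEquiv.conj (Matrix.toLin' B) := rfl
  rw [← h, ← LinearMap.toMatrix_eq_toMatrix', LinearMap.charpoly_toMatrix, e,
    LinearEquiv.charpoly_conj, ← LinearMap.charpoly_toMatrix (Matrix.toLin' B) (Pi.basisFun ℝ _),
    LinearMap.toMatrix_eq_toMatrix', LinearMap.toMatrix'_toLin']

variable (hω : ω ≠ 0) (hM : IsStablePoly M.charpoly)
  (hB : LinearMap.toMatrix' (S.symm.toLinearMap ∘ₗ Matrix.toLin' B ∘ₗ S.toLinearMap) =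
    Matrix.fromBlocks !![0, -ω; ω, 0] 0 0 M)

include hB in
lemma charpoly_of_adapted :
    B.charpoly = M.charpoly * (Polynomial.X ^ 2 + Polynomial.C (ω ^ 2)) := by
  rw [conj_charpoly hB, Matrix.charpoly_fromBlocks_zero₁₂, rotation_charpoly, mul_comm]

-- A linear form c·x is annihilated exactly when cB = 0, and 0 is not an eigenvalue of B: the
-- eigenvalues are ±iω and those of the stable block.
include hω hM hB in
open Matrix in
lemma lieLinearOn_one_injective_of_adapted : Function.Injective (lieLinearOn B 1) := by
  rw [injective_iff_map_eq_zero]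
  rintro ⟨p, hp⟩ h
  have h0 : lieLinear B p = 0 := h
  have hp' : p.IsHomogeneous 1 := hp
  set c : Fin n → ℝ := fun j => MvPolynomial.coeff 0 (MvPolynomial.pderiv j p) with hc
  have hconst : ∀ x i, MvPolynomial.eval x (MvPolynomial.pderiv i p) = c i := by
    intro x i
    have h0 : (MvPolynomial.pderiv i p).IsHomogeneous 0 := hp'.pderiv
    rw [← MvPolynomial.totalDegree_zero_iff_isHomogeneous,
      MvPolynomial.totalDegree_eq_zero_iff_eq_C] at h0
    rw [h0]; simp [hc]
  have h1 : ∀ x, c ⬝ᵥ B *ᵥ x = 0 := by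
    intro x
    have := eval_lieLinear B p x
    rw [h0, map_zero] at this
    simp only [hconst] at this
    exact this.symm
  have h2 : (Matrix.of fun (_ : Fin 1) j => c j) * B = 0 := by
    ext i j
    have := h1 (Pi.single j 1)
    rw [mulVec_single_one] at this
    simpa [Matrix.mul_apply, dotProduct] using this
  have h3 := sylvester_eq_zero (M := B) (N := 0) (X := Matrix.of fun (_ : Fin 1) j => c j)
    (r := Polynomial.X) (by rw [h2, Matrix.zero_mul]) (by simp) (by
      intro z hz
      rw [Polynomial.aeval_X] at hz
      rw [hz, charpoly_of_adapted hB]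
      simp only [map_mul, map_add, map_pow, Polynomial.aeval_X, Polynomial.aeval_C]
      refine mul_ne_zero (fun h => ?_) (by simpa using hω)
      have := hM _ h
      simp at this)
  have hc0 : c = 0 := by
    ext j; exact congrFun (congrFun h3 0) j
  refine Subtype.ext (MvPolynomial.funext fun x => ?_)
  change MvPolynomial.eval x p = MvPolynomial.eval x 0
  rw [eval_homogeneous_one hp' x, map_zero]
  exact Finset.sum_eq_zero fun j _ => by rw [show MvPolynomial.coeff 0 _ = c j from rfl, hc0]; simp

-- In the coordinates y the Hessian becomes SᵀHS, which is invariant under the block matrix, so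
-- `invariant_form_of_blocks` applies. The factor c/2 appears because the Hessian is twice the
-- matrix of the form.
include hω hM hB in
open Matrix in
lemma eq_smul_circleForm_of_lieLinear_eq_zero {q : MvPolynomial (Fin n) ℝ} (hq : q.IsHomogeneous 2)
    (h : lieLinear B q = 0) : ∃ c : ℝ, q = c • circleForm S := by
  rw [lieLinear_eq_zero_iff B hq] at h
  set H := hessianMatrix q
  set P := coordMatrix S
  have hT : Hᵀ = H := hessianMatrix_transpose q
  have hBP : B * P = P * fromBlocks !![0, -ω; ω, 0] 0 0 M := by
    refine Matrix.ext_of_mulVec_single fun i => ?_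
    rw [← mulVec_mulVec, ← mulVec_mulVec, coordMatrix_mulVec, coordMatrix_mulVec]
    exact (conj_iff _).1 hB _
  obtain ⟨c, hc⟩ := invariant_form_of_blocks hω hM (H := Pᵀ * H * P) (by
    rw [transpose_mul, transpose_mul, transpose_transpose, hT, Matrix.mul_assoc]) (by
    have e1 : Pᵀ * H * P * fromBlocks !![0, -ω; ω, 0] 0 0 M = Pᵀ * (H * B) * P := by
      simp only [Matrix.mul_assoc, hBP]
    have e2 : (fromBlocks !![0, -ω; ω, 0] 0 0 M)ᵀ * (Pᵀ * H * P) = Pᵀ * (Bᵀ * H) * P := by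
      simp only [← Matrix.mul_assoc, ← transpose_mul, hBP]
    rw [e1, e2, ← Matrix.add_mul, ← Matrix.mul_add, h]; simp)
  refine ⟨c / 2, MvPolynomial.funext fun x => ?_⟩
  obtain ⟨y, rfl⟩ := S.surjective x
  rw [MvPolynomial.smul_eval, eval_circleForm, S.symm_apply_apply]
  have h1 := eval_eq_hessianMatrix hq (S y)
  have h2 : S y ⬝ᵥ H *ᵥ S y = y ⬝ᵥ (Pᵀ * H * P) *ᵥ y := by
    rw [← coordMatrix_mulVec, ← mulVec_mulVec, ← mulVec_mulVec, dotProduct_mulVec y,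
      vecMul_transpose]
  rw [show hessianMatrix q = H from rfl, h2, hc, fromBlocks_mulVec] at h1
  have : y ⬝ᵥ Sum.elim ((c • (1 : Matrix (Fin 2) (Fin 2) ℝ)) *ᵥ (y ∘ Sum.inl) +
      (0 : Matrix (Fin 2) (Fin (n - 2)) ℝ) *ᵥ (y ∘ Sum.inr))
      ((0 : Matrix (Fin (n - 2)) (Fin 2) ℝ) *ᵥ (y ∘ Sum.inl) +
      (0 : Matrix (Fin (n - 2)) (Fin (n - 2)) ℝ) *ᵥ (y ∘ Sum.inr)) =
      c * (crd1 y ^ 2 + crd2 y ^ 2) := by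
    simp [dotProduct, Matrix.smul_mulVec, crd1, crd2]; ring
  rw [this] at h1
  linarith

include hB in
open Matrix in
lemma lieLinear_circleForm : lieLinear B (circleForm S) = 0 := by
  have hlin : ∀ i : Fin 2, ∀ x, MvPolynomial.eval x (lieLinear B
      (∑ j, MvPolynomial.C (S.symm (Pi.single j 1) (Sum.inl i)) * MvPolynomial.X j)) =
      S.symm (B *ᵥ x) (Sum.inl i) := by
    intro i x
    have h : ∀ (i : Fin 2) x, S.symm x (Sum.inl i) =
        ∑ j, S.symm (Pi.single j 1) (Sum.inl i) * x j := by
      intro i x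
      conv_lhs => rw [pi_eq_sum_univ' x]
      simp only [map_sum, map_smul, Finset.sum_apply, Pi.smul_apply, smul_eq_mul, mul_comm]
    rw [eval_lieLinear, h]
    refine Finset.sum_congr rfl fun k _ => ?_
    congr 1
    simp [MvPolynomial.pderiv_X, Pi.single_apply]
  have hlin' : ∀ i : Fin 2, ∀ x, MvPolynomial.eval x
      (∑ j, MvPolynomial.C (S.symm (Pi.single j 1) (Sum.inl i)) * MvPolynomial.X j) =
      S.symm x (Sum.inl i) := by
    intro i x
    conv_rhs => rw [pi_eq_sum_univ' x]
    simp [mul_comm]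
  refine MvPolynomial.funext fun x => ?_
  obtain ⟨y, rfl⟩ := S.surjective x
  have hd : ∀ p : MvPolynomial (Fin n) ℝ, lieLinear B (p ^ 2) = 2 * p * lieLinear B p := by
    intro p
    change MvPolynomial.mkDerivation ℝ _ (p ^ 2) = 2 * p * MvPolynomial.mkDerivation ℝ _ p
    rw [Derivation.leibniz_pow]; simp; ring
  rw [circleForm, map_sum, map_sum]
  simp only [hd, map_mul, hlin, hlin', (conj_iff _).1 hB, S.symm_apply_apply]
  rw [fromBlocks_mulVec]
  simp [Fin.sum_univ_two, dotProduct]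
  ring

-- The Hessian is 2 R₁ᵀR₁, where R₁ consists of the first two rows of S⁻¹ and is surjective.
open Matrix in
lemma rank_hessianMatrix_circleForm : (hessianMatrix (circleForm S)).rank = 2 := by
  set R : Matrix (Fin 2 ⊕ Fin (n - 2)) (Fin n) ℝ := LinearMap.toMatrix' S.symm.toLinearMap
  set R1 : Matrix (Fin 2) (Fin n) ℝ := R.submatrix Sum.inl id
  have hR : ∀ x, R *ᵥ x = S.symm x := fun x => LinearMap.toMatrix'_mulVec _ _
  have hR1 : ∀ x, R1 *ᵥ x = fun i => S.symm x (Sum.inl i) := fun x => by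
    ext i
    rw [← hR]; rfl
  have e : hessianMatrix (circleForm S) = (2 : ℝ) • (R1ᵀ * R1) := by
    rw [← sub_eq_zero]
    refine symm_matrix_eq_zero ?_ fun x => ?_
    · rw [transpose_sub, hessianMatrix_transpose, transpose_smul, transpose_mul,
        transpose_transpose]
    · rw [sub_mulVec, dotProduct_sub, ← eval_eq_hessianMatrix (isHomogeneous_circleForm S),
        eval_circleForm, smul_mulVec, dotProduct_smul, ← mulVec_mulVec, dotProduct_mulVec,
        vecMul_transpose, hR1]
      simp [dotProduct, Fin.sum_univ_two, crd1, crd2]; ring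
  have hsurj : Function.Surjective R1.mulVecLin := fun w =>
    ⟨S (Sum.elim w 0), by rw [mulVecLin_apply, hR1]; simp⟩
  rw [e, rank_smul_of_mem_nonZeroDivisors _ (by simp), rank_transpose_mul_self, Matrix.rank,
    LinearMap.range_eq_top.2 hsurj]
  simp

include hω hM hB in
lemma isKernelForm_circleForm : IsKernelForm B (circleForm S) := by
  refine ⟨⟨isHomogeneous_circleForm S, ?_⟩, fun x => ?_, rank_hessianMatrix_circleForm⟩
  · refine le_antisymm ?_ ?_
    · rw [Submodule.span_singleton_le_iff_mem]
      exact lieLinear_circleForm hB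
    · rintro ⟨q, hq⟩ h
      obtain ⟨c, hc⟩ := eq_smul_circleForm_of_lieLinear_eq_zero hω hM hB hq h
      rw [Submodule.mem_span_singleton]
      exact ⟨c, Subtype.ext hc.symm⟩
  · rw [eval_circleForm]; positivity

include hω hM hB in
lemma spectralConditions_of_adapted : SpectralConditions B := by
  refine ⟨lieLinearOn_one_injective_of_adapted hω hM hB, ?_, M.charpoly, ω ^ 2,
    M.charpoly_monic, charpoly_of_adapted hB, by positivity,
    (hurwitzRouth_iff M.charpoly_monic).2 hM⟩
  obtain ⟨⟨h, hspan⟩, -, hr⟩ := isKernelForm_circleForm hω hM hB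
  rw [← hspan]
  refine finrank_span_singleton fun h0 => ?_
  have h1 : circleForm S = 0 := congrArg Subtype.val h0
  rw [h1] at hr
  have : hessianMatrix (0 : MvPolynomial (Fin n) ℝ) = 0 := by
    ext; simp [hessianMatrix]
  rw [this, Matrix.rank_zero] at hr
  omega

end adapted

/-! ### The spectral conditions produce adapted coordinates -/

section construct
variable {n : ℕ} {B : Matrix (Fin n) (Fin n) ℝ}

-- An invariant form vanishes on the stable subspace ker a(B). Indeed H a(B) = a(-Bᵀ) H, and a(-Bᵀ)
-- is invertible because the zeros of a(-τ) lie in the right half plane, away from the spectrum of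
-- B.
open Matrix in
lemma mulVec_eq_zero_of_stable_factor {a : Polynomial ℝ} {b : ℝ} (hb : 0 < b)
    (ha : IsStablePoly a) (hchar : B.charpoly = a * (Polynomial.X ^ 2 + Polynomial.C b))
    {H : Matrix (Fin n) (Fin n) ℝ} (hHB : H * B = -Bᵀ * H) {x : Fin n → ℝ}
    (hx : Polynomial.aeval B a *ᵥ x = 0) : H *ᵥ x = 0 := by
  have hco : IsCoprime (a.comp (-Polynomial.X)) B.charpoly := by
    refine (Polynomial.isCoprime_iff_aeval_ne_zero_of_isAlgClosed ℝ ℂ _ _).2 fun z => ?_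
    rw [← not_and_or]
    rintro ⟨h1, h2⟩
    rw [Polynomial.aeval_comp] at h1
    have h3 := ha _ h1
    simp at h3
    rw [hchar, map_mul, mul_eq_zero] at h2
    rcases h2 with h2 | h2
    · linarith [ha _ h2]
    · have := re_eq_zero_of_sq_add_eq_zero (z := z) hb (by simpa using h2)
      linarith
  obtain ⟨u, v, huv⟩ := hco
  have h1 := congrArg (Polynomial.aeval Bᵀ) huv
  rw [← Matrix.charpoly_transpose, map_add, map_mul, map_mul, Matrix.aeval_self_charpoly, mul_zero,
    add_zero, map_one, Polynomial.aeval_comp, map_neg, Polynomial.aeval_X] at h1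
  have h2 := sylvester_aeval hHB a
  calc H *ᵥ x = (Polynomial.aeval Bᵀ u * (Polynomial.aeval (-Bᵀ) a)) *ᵥ (H *ᵥ x) := by
        rw [h1, one_mulVec]
    _ = 0 := by rw [mulVec_mulVec, Matrix.mul_assoc, ← h2, ← mulVec_mulVec, ← mulVec_mulVec, hx]; simp

-- Split a vector on which the form is positive along ker a(B) ⊕ ker(B² + b). Its component in ker
-- a(B) lies in the kernel of H, so the other component has the same value and can be rescaled. The
-- value 2 means ψ(e) = 1, as H is twice the matrix of ψ.
open Matrix in
lemma exists_unit_vector_in_center {a : Polynomial ℝ} {b : ℝ} (hb : 0 < b)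
    (ha : IsStablePoly a) (hchar : B.charpoly = a * (Polynomial.X ^ 2 + Polynomial.C b))
    {H : Matrix (Fin n) (Fin n) ℝ} (hT : Hᵀ = H) (hHB : H * B = -Bᵀ * H)
    (hpos : ∀ x, 0 ≤ x ⬝ᵥ H *ᵥ x) (hH : H ≠ 0) :
    ∃ e, B *ᵥ B *ᵥ e = -b • e ∧ e ⬝ᵥ H *ᵥ e = 2 := by
  have hex : ∃ x, 0 < x ⬝ᵥ H *ᵥ x := by
    by_contra! h
    exact hH (symm_matrix_eq_zero hT fun x => le_antisymm (h x) (hpos x))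
  obtain ⟨x, hx⟩ := hex
  have hco : IsCoprime a (Polynomial.X ^ 2 + Polynomial.C b) := by
    refine (Polynomial.isCoprime_iff_aeval_ne_zero_of_isAlgClosed ℝ ℂ _ _).2 fun z => ?_
    rw [← not_and_or]
    rintro ⟨h1, h2⟩
    have := re_eq_zero_of_sq_add_eq_zero (z := z) hb (by simpa using h2)
    linarith [ha _ h1]
  obtain ⟨u, v, huv⟩ := hco
  set x1 := Polynomial.aeval B (u * a) *ᵥ x with hx1
  set x2 := Polynomial.aeval B (v * (Polynomial.X ^ 2 + Polynomial.C b)) *ᵥ x with hx2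
  have hsum : x1 + x2 = x := by
    rw [hx1, hx2, ← add_mulVec, ← map_add, huv, map_one, one_mulVec]
  have hHx2 : H *ᵥ x2 = 0 := by
    refine mulVec_eq_zero_of_stable_factor hb ha hchar hHB ?_
    rw [hx2, mulVec_mulVec, ← map_mul, mul_left_comm, ← hchar, map_mul,
      Matrix.aeval_self_charpoly, mul_zero, zero_mulVec]
  have hBx1 : B *ᵥ B *ᵥ x1 = -b • x1 := by
    have : Polynomial.aeval B (Polynomial.X ^ 2 + Polynomial.C b) *ᵥ x1 = 0 := by
      rw [hx1, mulVec_mulVec, ← map_mul, show (Polynomial.X ^ 2 + Polynomial.C b) * (u * a) =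
        u * B.charpoly by rw [hchar]; ring, map_mul, Matrix.aeval_self_charpoly, mul_zero,
        zero_mulVec]
    rw [map_add, map_pow, Polynomial.aeval_X, Polynomial.aeval_C, add_mulVec, sq, ← mulVec_mulVec,
      Algebra.algebraMap_eq_smul_one, smul_mulVec, one_mulVec] at this
    rw [neg_smul]
    exact eq_neg_of_add_eq_zero_left this
  have hq : x1 ⬝ᵥ H *ᵥ x1 = x ⬝ᵥ H *ᵥ x := by
    rw [← hsum, mulVec_add, hHx2, add_zero, add_dotProduct]
    have : x2 ⬝ᵥ H *ᵥ x1 = 0 := by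
      rw [dotProduct_mulVec, ← mulVec_transpose, hT, hHx2, zero_dotProduct]
    rw [this, add_zero]
  rw [← hq] at hx
  set c := x1 ⬝ᵥ H *ᵥ x1
  refine ⟨Real.sqrt (2 / c) • x1, ?_, ?_⟩
  · rw [mulVec_smul, mulVec_smul, hBx1, smul_comm]
  · rw [mulVec_smul, dotProduct_smul, smul_dotProduct, smul_eq_mul, smul_eq_mul, ← mul_assoc,
      Real.mul_self_sqrt (by positivity)]
    exact div_mul_cancel₀ _ hx.ne'

open Matrix in
/-- Adapted coordinates in which the kernel form is `y₁² + y₂²`. -/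
lemma exists_adapted_coordinates (hn : 2 ≤ n) {ψ : MvPolynomial (Fin n) ℝ}
    (hB : SpectralConditions B) (hψ : IsKernelForm B ψ) :
    ∃ (S : SplitSpace n ≃L[ℝ] (Fin n → ℝ)) (ω : ℝ) (M : Matrix (Fin (n - 2)) (Fin (n - 2)) ℝ),
      ω ≠ 0 ∧ IsStablePoly M.charpoly ∧
      LinearMap.toMatrix' (S.symm.toLinearMap ∘ₗ Matrix.toLin' B ∘ₗ S.toLinearMap) =
        Matrix.fromBlocks !![0, -ω; ω, 0] 0 0 M ∧
      ∀ y, MvPolynomial.eval (S y) ψ = crd1 y ^ 2 + crd2 y ^ 2 := by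
  obtain ⟨-, -, a, b, ha, hchar, hb, hRH⟩ := hB
  obtain ⟨⟨hψ2, hspan⟩, hpos, hrank⟩ := hψ
  rw [hurwitzRouth_iff ha] at hRH
  have hψh : ψ.IsHomogeneous 2 := hψ2
  have hker : lieLinear B ψ = 0 := by
    have : (⟨ψ, hψ2⟩ : MvPolynomial.homogeneousSubmodule (Fin n) ℝ 2) ∈
        LinearMap.ker (lieLinearOn B 2) := hspan ▸ Submodule.mem_span_singleton_self _
    exact this
  rw [lieLinear_eq_zero_iff B hψh] at hker
  set H := hessianMatrix ψ with hHdef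
  have hT : Hᵀ = H := hessianMatrix_transpose ψ
  have hHB : H * B = -Bᵀ * H := by rw [Matrix.neg_mul]; exact eq_neg_of_add_eq_zero_left hker
  have hev : ∀ x, 2 * MvPolynomial.eval x ψ = x ⬝ᵥ H *ᵥ x := eval_eq_hessianMatrix hψh
  have hH0 : H ≠ 0 := by
    intro h
    rw [h, Matrix.rank_zero] at hrank
    omega
  obtain ⟨e, heB, heH⟩ := exists_unit_vector_in_center hb hRH hchar hT hHB
    (fun x => by rw [← hev]; linarith [hpos x]) hH0
  have hsymm : ∀ x y, x ⬝ᵥ H *ᵥ y = y ⬝ᵥ H *ᵥ x := fun x y => by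
    rw [dotProduct_mulVec, ← mulVec_transpose, hT, dotProduct_comm]
  have hskew : ∀ x y, (B *ᵥ x) ⬝ᵥ H *ᵥ y = -(x ⬝ᵥ H *ᵥ (B *ᵥ y)) := fun x y => by
    rw [mulVec_mulVec, hHB, Matrix.neg_mul, neg_mulVec, dotProduct_neg, neg_neg,
      ← mulVec_mulVec, dotProduct_mulVec x, vecMul_transpose]
  set ω := Real.sqrt b with hω
  have hω0 : 0 < ω := Real.sqrt_pos.2 hb
  have hω2 : ω * ω = b := Real.mul_self_sqrt hb.le
  -- B is skew with respect to H, so e and f = ω⁻¹Be are H-orthogonal of equal length, and B rotates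
  -- their plane.
  obtain ⟨f, hf⟩ : ∃ f, f = ω⁻¹ • B *ᵥ e := ⟨_, rfl⟩
  have hBe : B *ᵥ e = ω • f := by rw [hf, smul_inv_smul₀ hω0.ne']
  have hBf : B *ᵥ f = -ω • e := by
    rw [hf, mulVec_smul, heB, smul_smul, ← hω2]; congr 1; field_simp
  have hef : e ⬝ᵥ H *ᵥ f = 0 := by
    have h1 := hskew e e
    rw [hBe, hsymm, mulVec_smul, dotProduct_smul, smul_eq_mul] at h1
    have : ω * (e ⬝ᵥ H *ᵥ f) = 0 := by linarith
    exact (mul_eq_zero.1 this).resolve_left hω0.ne'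
  have hff : f ⬝ᵥ H *ᵥ f = 2 := by
    have h1 := hskew e f
    rw [hBe, hBf, mulVec_smul, dotProduct_smul, heH, smul_dotProduct, smul_eq_mul, smul_eq_mul] at h1
    have : ω * (f ⬝ᵥ H *ᵥ f) = ω * 2 := by linarith
    exact mul_left_cancel₀ hω0.ne' this
  -- The rank condition gives ker H dimension n - 2, and HB = -BᵀH makes it B-invariant. It supplies
  -- the remaining coordinates.
  set K := LinearMap.ker (Matrix.toLin' H) with hK
  have hKd : Module.finrank ℝ K = n - 2 := by
    have h1 := LinearMap.finrank_range_add_finrank_ker (Matrix.toLin' H)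
    rw [Module.finrank_fin_fun] at h1
    have h2 : Module.finrank ℝ (LinearMap.range (Matrix.toLin' H)) = 2 := by
      rw [← hrank]; rfl
    rw [h2, ← hK] at h1
    omega
  have hKB : ∀ x ∈ K, Matrix.toLin' B x ∈ K := by
    intro x hx
    rw [hK, LinearMap.mem_ker, toLin'_apply] at hx ⊢
    rw [toLin'_apply, mulVec_mulVec, hHB, ← mulVec_mulVec, hx, mulVec_zero]
  let W : (Fin (n - 2) → ℝ) ≃ₗ[ℝ] K :=
    LinearEquiv.ofFinrankEq _ _ (by rw [hKd, Module.finrank_fin_fun])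
  let L : SplitSpace n →ₗ[ℝ] (Fin n → ℝ) :=
    (LinearMap.proj (Sum.inl 0)).smulRight e + (LinearMap.proj (Sum.inl 1)).smulRight f +
      K.subtype ∘ₗ W.toLinearMap ∘ₗ LinearMap.funLeft ℝ ℝ Sum.inr
  have hL : ∀ y, L y = crd1 y • e + crd2 y • f + (W (y ∘ Sum.inr) : Fin n → ℝ) := fun y => rfl
  have hHW : ∀ w, H *ᵥ (W w : Fin n → ℝ) = 0 := fun w => (W w).2
  have hHL : ∀ y, H *ᵥ L y = crd1 y • H *ᵥ e + crd2 y • H *ᵥ f := fun y => by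
    rw [hL, mulVec_add, mulVec_add, hHW, add_zero, mulVec_smul, mulVec_smul]
  have hform : ∀ y, L y ⬝ᵥ H *ᵥ L y = 2 * (crd1 y ^ 2 + crd2 y ^ 2) := by
    intro y
    rw [hHL, dotProduct_add, dotProduct_smul, dotProduct_smul, hsymm, hsymm (L y) f, hHL]
    simp only [dotProduct_add, dotProduct_smul, heH, hff, hef, hsymm f e, smul_eq_mul]
    ring
  have hinj : Function.Injective L := by
    rw [injective_iff_map_eq_zero]
    intro y hy
    have h1 := hform y
    rw [hy, zero_dotProduct] at h1
    have h2 : crd1 y = 0 := by nlinarith [sq_nonneg (crd1 y), sq_nonneg (crd2 y)]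
    have h3 : crd2 y = 0 := by nlinarith [sq_nonneg (crd1 y), sq_nonneg (crd2 y)]
    have h4 := hL y
    rw [hy, h2, h3, zero_smul, zero_smul, add_zero, zero_add] at h4
    have h5 : y ∘ Sum.inr = 0 := W.map_eq_zero_iff.1 (Subtype.ext h4.symm)
    funext i
    rcases i with i | i
    · fin_cases i
      · exact h2
      · exact h3
    · exact congrFun h5 i
  let S0 : SplitSpace n ≃ₗ[ℝ] (Fin n → ℝ) := LinearMap.linearEquivOfInjective L hinj (by
    simp; omega)
  have hS0 : ∀ y, S0 y = L y := fun y => LinearMap.linearEquivOfInjective_apply ..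
  let M : Matrix (Fin (n - 2)) (Fin (n - 2)) ℝ :=
    LinearMap.toMatrix' (W.symm.toLinearMap ∘ₗ (Matrix.toLin' B).restrict hKB ∘ₗ W.toLinearMap)
  have hM : ∀ w, (W (M *ᵥ w) : Fin n → ℝ) = B *ᵥ (W w : Fin n → ℝ) := by
    intro w
    rw [LinearMap.toMatrix'_mulVec]
    simp [LinearMap.restrict_apply]
  have hconj : LinearMap.toMatrix' (S0.toContinuousLinearEquiv.symm.toLinearMap ∘ₗ
      Matrix.toLin' B ∘ₗ S0.toContinuousLinearEquiv.toLinearMap) =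
        Matrix.fromBlocks !![0, -ω; ω, 0] 0 0 M := by
    rw [conj_iff]
    intro y
    change B *ᵥ S0 y = S0 _
    rw [hS0, hS0, hL, hL, fromBlocks_mulVec, mulVec_add, mulVec_add, mulVec_smul, mulVec_smul,
      hBe, hBf, ← hM]
    simp only [crd1, crd2, zero_mulVec, add_zero, zero_add, Sum.elim_inl, Sum.elim_comp_inr]
    simp [smul_smul]
    abel_nf
    simp [mul_comm]
    rw [add_comm]
    rfl
  refine ⟨S0.toContinuousLinearEquiv, ω, M, hω0.ne', ?_, hconj, fun y => ?_⟩
  -- Cancelling τ² + b identifies the characteristic polynomial of M with the stable factor a.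
  · have h1 := charpoly_of_adapted hconj
    rw [hchar, show ω ^ 2 = b by rw [sq, hω2]] at h1
    have : (Polynomial.X ^ 2 + Polynomial.C b : Polynomial ℝ) ≠ 0 :=
      (Polynomial.monic_X_pow_add_C b two_ne_zero).ne_zero
    rwa [← mul_right_cancel₀ this h1]
  · have h1 := hform y
    rw [← hev] at h1
    change MvPolynomial.eval (S0 y) ψ = _
    rw [hS0]
    linarith

end construct

/-! ### Smooth germs, local inverses and orders of vanishing -/

section general
variable {E G : Type*} [NormedAddCommGroup E] [NormedSpace ℝ E]
  [NormedAddCommGroup G] [NormedSpace ℝ G]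

lemma SmoothNear.eventually_contDiffAt {f : E → G} {x : E} (hf : SmoothNear f x) :
    ∀ᶠ z in 𝓝 x, ContDiffAt ℝ (⊤ : ℕ∞) f z := by
  obtain ⟨W, hW, hx, hf⟩ := hf
  filter_upwards [hW.mem_nhds hx] with z hz using hf.contDiffAt (hW.mem_nhds hz)

lemma SmoothNear.contDiffAt {f : E → G} {x : E} (hf : SmoothNear f x) :
    ContDiffAt ℝ (⊤ : ℕ∞) f x := hf.eventually_contDiffAt.self_of_nhds

lemma SmoothNear.eventually_differentiableAt {f : E → G} {x : E} (hf : SmoothNear f x) :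
    ∀ᶠ z in 𝓝 x, DifferentiableAt ℝ f z := by
  filter_upwards [hf.eventually_contDiffAt] with z hz using hz.differentiableAt (by simp)

lemma SmoothNear.comp {H : Type*} [NormedAddCommGroup H] [NormedSpace ℝ H] {f : E → G} {g : G → H}
    {x : E} (hg : SmoothNear g (f x)) (hf : SmoothNear f x) : SmoothNear (g ∘ f) x := by
  obtain ⟨W, hW, hx, hf⟩ := hf
  obtain ⟨V, hV, hfx, hg⟩ := hg
  exact ⟨W ∩ f ⁻¹' V, hf.continuousOn.isOpen_inter_preimage hW hV, ⟨hx, hfx⟩,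
    hg.comp (hf.mono Set.inter_subset_left) fun z hz => hz.2⟩

lemma ContDiff.smoothNear {f : E → G} (hf : ContDiff ℝ (⊤ : ℕ∞) f) (x : E) : SmoothNear f x :=
  ⟨Set.univ, isOpen_univ, trivial, hf.contDiffOn⟩

lemma SmoothNear.sub {f g : E → G} {x : E} (hf : SmoothNear f x) (hg : SmoothNear g x) :
    SmoothNear (fun z => f z - g z) x := by
  obtain ⟨W, hW, hx, hf⟩ := hf
  obtain ⟨V, hV, hx', hg⟩ := hg
  exact ⟨W ∩ V, hW.inter hV, ⟨hx, hx'⟩,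
    (hf.mono Set.inter_subset_left).sub (hg.mono Set.inter_subset_right)⟩

/-- The inverse function theorem for maps which are smooth on a neighborhood. -/
lemma SmoothNear.exists_local_inverse [CompleteSpace E] [CompleteSpace G] {T : E → G}
    {L : E ≃L[ℝ] G} (hT : SmoothNear T 0) (h0 : T 0 = 0) (hL : HasFDerivAt T (L : E →L[ℝ] G) 0) :
    ∃ Ψ : G → E, SmoothNear Ψ 0 ∧ Ψ 0 = 0 ∧ HasFDerivAt Ψ (L.symm : G →L[ℝ] E) 0 ∧
      (∀ᶠ w in 𝓝 0, T (Ψ w) = w) ∧ ∀ᶠ z in 𝓝 0, Ψ (T z) = z := by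
  have hstrict : HasStrictFDerivAt T (L : E →L[ℝ] G) 0 :=
    hT.contDiffAt.hasStrictFDerivAt' hL (by simp)
  set e := hstrict.toOpenPartialHomeomorph T with he
  have hes : ∀ z, e z = T z := fun z => rfl
  have h0s : (0 : E) ∈ e.source := hstrict.mem_toOpenPartialHomeomorph_source
  have h0t : (0 : G) ∈ e.target := by
    have := hstrict.image_mem_toOpenPartialHomeomorph_target
    rwa [h0] at this
  have hΨ0 : e.symm 0 = 0 := by
    have := e.left_inv h0s
    rwa [hes, h0] at this
  -- `SmoothNear` asks for smoothness on a whole neighborhood, so the derivative of T has to be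
  -- invertible near 0 and not only at 0.
  have hinv : ∀ᶠ z in 𝓝 0, fderiv ℝ T z ∈ Set.range ((↑) : (E ≃L[ℝ] G) → E →L[ℝ] G) := by
    have hc : ContinuousAt (fderiv ℝ T) 0 :=
      (hT.contDiffAt.fderiv_right (m := 0) (by simp)).continuousAt
    refine hc.eventually_mem ?_
    rw [hL.fderiv]
    exact ContinuousLinearEquiv.nhds L
  obtain ⟨W, hWs, hW, h0W⟩ := mem_nhds_iff.1 (hinv.and hT.eventually_contDiffAt)
  refine ⟨e.symm, ⟨e.target ∩ e.symm ⁻¹' W, e.isOpen_inter_preimage_symm hW, ⟨h0t, ?_⟩, ?_⟩, hΨ0,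
    ?_, ?_, ?_⟩
  · rw [Set.mem_preimage, hΨ0]; exact h0W
  · intro w hw
    obtain ⟨⟨f', hf'⟩, hs⟩ := hWs hw.2
    refine ContDiffAt.contDiffWithinAt ?_
    refine e.contDiffAt_symm (f₀' := f') hw.1 ?_ hs
    rw [hf']
    exact (hs.differentiableAt (by simp)).hasFDerivAt
  · have := hstrict.to_localInverse
    rw [h0] at this
    exact this.hasFDerivAt
  · filter_upwards [e.open_target.mem_nhds h0t] with w hw using e.right_inv hw
  · filter_upwards [e.open_source.mem_nhds h0s] with z hz using e.left_inv hz

/-- A function whose derivative vanishes to order `k` vanishes to order `k + 1`. -/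
lemma isLittleO_pow_succ_of_fderiv {f : E → G} {f' : E → E →L[ℝ] G} {k : ℕ} (h0 : f 0 = 0)
    (hf : ∀ᶠ z in 𝓝 0, HasFDerivAt f (f' z) z) (hf' : f' =o[𝓝 0] fun z => ‖z‖ ^ k) :
    f =o[𝓝 0] fun z => ‖z‖ ^ (k + 1) := by
  rw [isLittleO_iff] at hf' ⊢
  intro c hc
  obtain ⟨r, hr, hball⟩ := Metric.eventually_nhds_iff.1 (hf.and (hf' hc))
  filter_upwards [Metric.ball_mem_nhds 0 hr] with z hz
  rw [mem_ball_zero_iff] at hz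
  have key := (convex_closedBall (0 : E) ‖z‖).norm_image_sub_le_of_norm_hasFDerivWithin_le
    (f := f) (f' := f') (C := c * ‖z‖ ^ k) (x := 0) (y := z)
    (fun x hx => (hball (by rw [dist_zero_right]; exact (mem_closedBall_zero_iff.1 hx).trans_lt hz)).1.hasFDerivWithinAt)
    (fun x hx => by
      rw [mem_closedBall_zero_iff] at hx
      refine (hball (by rw [dist_zero_right]; exact hx.trans_lt hz)).2.trans ?_
      rw [norm_pow, norm_norm]
      gcongr)
    (by simp) (by simp)
  rw [h0, sub_zero, sub_zero] at key
  refine key.trans (le_of_eq ?_)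
  rw [norm_pow, norm_norm, pow_succ]; ring

/-- A positively homogeneous function of degree `k` which is `o(‖z‖^k)` vanishes. -/
lemma eq_zero_of_homogeneous_isLittleO {f : E → G} {k : ℕ}
    (hf : ∀ (t : ℝ) z, 0 < t → f (t • z) = t ^ k • f z) (ho : f =o[𝓝 0] fun z => ‖z‖ ^ k) (z : E) :
    f z = 0 := by
  have hlim : Tendsto (fun t : ℝ => t • z) (𝓝[>] 0) (𝓝 0) := by
    have : Tendsto (fun t : ℝ => t • z) (𝓝 0) (𝓝 ((0 : ℝ) • z)) :=
      (continuous_id.smul continuous_const).tendsto 0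
    rw [zero_smul] at this
    exact this.mono_left nhdsWithin_le_nhds
  have h1 := ho.comp_tendsto hlim
  rw [isLittleO_iff] at h1
  by_contra hne
  have hz : 0 < ‖f z‖ := norm_pos_iff.2 hne
  have hc : 0 < ‖f z‖ / (2 * (‖z‖ ^ k + 1)) := by positivity
  obtain ⟨t, ht, ht0⟩ := ((h1 hc).and self_mem_nhdsWithin).exists
  have ht0 : 0 < t := ht0
  simp only [Function.comp] at ht
  rw [hf t z ht0, norm_smul, norm_smul, norm_pow, norm_pow, norm_mul, norm_norm,
    norm_norm, mul_pow, Real.norm_of_nonneg ht0.le] at ht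
  have htk : 0 < t ^ k := by positivity
  have h2 : ‖f z‖ ≤ ‖f z‖ / (2 * (‖z‖ ^ k + 1)) * ‖z‖ ^ k := by
    refine le_of_mul_le_mul_left ?_ htk
    linarith
  rw [div_mul_eq_mul_div, le_div_iff₀ (by positivity)] at h2
  have : 0 ≤ ‖z‖ ^ k := by positivity
  nlinarith

/-- The second derivative at 0 vanishes: half its quadratic form approximates δ up to o(‖z‖²), hence
is itself o(‖z‖²), and a homogeneous form of degree two of that size is zero. Polarization and
symmetry do the rest. -/
lemma fderiv_isLittleO_of_isLittleO_sq {δ : E → ℝ} (hδ : ContDiffAt ℝ 2 δ 0)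
    (ho : δ =o[𝓝 0] fun z => ‖z‖ ^ 2) : fderiv ℝ δ =o[𝓝 0] fun z => ‖z‖ := by
  have h0 : δ 0 = 0 := by
    simpa using (isLittleO_iff.1 ho one_pos).self_of_nhds
  have hd0 : HasFDerivAt δ (0 : E →L[ℝ] ℝ) 0 := by
    rw [hasFDerivAt_iff_isLittleO_nhds_zero]
    simp only [zero_add, h0, sub_zero, zero_apply]
    refine ho.trans_isBigO ?_
    refine IsBigO.of_bound 1 ?_
    filter_upwards [Metric.ball_mem_nhds (0 : E) one_pos] with z hz
    rw [mem_ball_zero_iff] at hz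
    rw [norm_pow, norm_norm, one_mul]
    nlinarith [norm_nonneg z]
  have hG : DifferentiableAt ℝ (fderiv ℝ δ) 0 :=
    (hδ.fderiv_right (m := 1) (by norm_num)).differentiableAt (by simp)
  set A := fderiv ℝ (fderiv ℝ δ) 0 with hA
  have hGo : (fun z => fderiv ℝ δ z - A z) =o[𝓝 0] fun z => ‖z‖ ^ 1 := by
    have := hasFDerivAt_iff_isLittleO_nhds_zero.1 hG.hasFDerivAt
    simp only [zero_add, hd0.fderiv, sub_zero] at this
    simpa using this.norm_right
  have hsymm : ∀ x y, A x y = A y x := fun x y =>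
    (hδ.isSymmSndFDerivAt (by simp)).eq x y
  have hdiff : ∀ᶠ z in 𝓝 0, DifferentiableAt ℝ δ z := by
    filter_upwards [hδ.eventually (by simp)] with z hz using hz.differentiableAt (by simp)
  have hg := isLittleO_pow_succ_of_fderiv (f := fun z => δ z - (1 / 2 : ℝ) * A z z)
    (f' := fun z => fderiv ℝ δ z - A z) (by simp [h0]) (by
      filter_upwards [hdiff] with z hz
      refine hz.hasFDerivAt.sub ?_
      have h1 : HasFDerivAt (fun z => A z z) ((A z).comp (ContinuousLinearMap.id ℝ E) + A.flip z) z :=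
        A.hasFDerivAt.clm_apply (hasFDerivAt_id z)
      refine (h1.const_mul (1 / 2)).congr_fderiv ?_
      ext w
      simp [hsymm w z]; ring) hGo
  have hAA : ∀ z, A z z = 0 := by
    refine eq_zero_of_homogeneous_isLittleO (k := 2) (fun t z _ => ?_) ?_
    · simp; ring
    · have := (ho.sub hg).const_mul_left 2
      refine this.congr_left fun z => ?_
      ring
  have hA0 : A = 0 := by
    ext x y
    have h1 := hAA (x + y)
    simp only [map_add, add_apply, hAA, hsymm y x] at h1
    simp; linarith
  simpa [hA0] using hGo

end general

lemma norm_pow_succ_isLittleO {E : Type*} [NormedAddCommGroup E] {l : Filter E} (hl : l ≤ 𝓝 0)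
    {j k : ℕ} (h : j < k) :
    (fun z : E => ‖z‖ ^ k) =o[l] fun z => ‖z‖ ^ j :=
  (isLittleO_norm_pow_norm_pow h).mono hl

/-! ### The function y₁² + y₂² along a normal form -/

section circle
variable {n : ℕ}

/-- The function `y₁² + y₂²`. -/
def circleFn (z : ℝ × SplitSpace n) : ℝ := crd1 z.2 ^ 2 + crd2 z.2 ^ 2

/-- A coordinate as a continuous linear map. -/
def coordCLM (i : Fin 2 ⊕ Fin (n - 2)) : ℝ × SplitSpace n →L[ℝ] ℝ :=
  (ContinuousLinearMap.proj i).comp (ContinuousLinearMap.snd ℝ ℝ (SplitSpace n))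

lemma coordCLM_apply (i : Fin 2 ⊕ Fin (n - 2)) (z : ℝ × SplitSpace n) : coordCLM i z = z.2 i := rfl

lemma abs_crd1_le (z : ℝ × SplitSpace n) : ‖crd1 z.2‖ ≤ ‖z‖ :=
  (norm_le_pi_norm z.2 _).trans (norm_snd_le z)

lemma abs_crd2_le (z : ℝ × SplitSpace n) : ‖crd2 z.2‖ ≤ ‖z‖ :=
  (norm_le_pi_norm z.2 _).trans (norm_snd_le z)

lemma hasFDerivAt_circleFn (z : ℝ × SplitSpace n) :
    HasFDerivAt circleFn ((2 * crd1 z.2) • coordCLM (n := n) (Sum.inl 0) +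
      (2 * crd2 z.2) • coordCLM (Sum.inl 1)) z := by
  have h1 : HasFDerivAt (fun z : ℝ × SplitSpace n => crd1 z.2) (coordCLM (Sum.inl 0)) z :=
    (coordCLM (n := n) (Sum.inl 0)).hasFDerivAt
  have h2 : HasFDerivAt (fun z : ℝ × SplitSpace n => crd2 z.2) (coordCLM (Sum.inl 1)) z :=
    (coordCLM (n := n) (Sum.inl 1)).hasFDerivAt
  refine ((h1.pow 2).add (h2.pow 2)).congr_fderiv ?_
  ext w <;> simp

lemma contDiff_circleFn : ContDiff ℝ (⊤ : ℕ∞) (circleFn (n := n)) := by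
  have h1 : ContDiff ℝ (⊤ : ℕ∞) (fun z : ℝ × SplitSpace n => crd1 z.2) :=
    (coordCLM (n := n) (Sum.inl 0)).contDiff
  have h2 : ContDiff ℝ (⊤ : ℕ∞) (fun z : ℝ × SplitSpace n => crd2 z.2) :=
    (coordCLM (n := n) (Sum.inl 1)).contDiff
  exact (h1.pow 2).add (h2.pow 2)

lemma lieDeriv_circleFn (X : ℝ × SplitSpace n → ℝ × SplitSpace n) (z : ℝ × SplitSpace n) :
    lieDeriv X circleFn z = 2 * crd1 z.2 * crd1 (X z).2 + 2 * crd2 z.2 * crd2 (X z).2 := by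
  rw [lieDeriv, (hasFDerivAt_circleFn z).fderiv]
  simp [coordCLM_apply, crd1, crd2]

/-- In y₁ẏ₁ + y₂ẏ₂ the rotational terms cancel and the radial coefficients α, β, ρ remain. The
factors y₁, y₂ raise the order of the error from three to four. -/
lemma IsNFIM.lieDeriv_circleFn {X : ℝ × SplitSpace n → ℝ × SplitSpace n}
    {ω α β μ γ ρ σ : ℝ} (h : IsNFIM X ω α β μ γ ρ σ) :
    (fun z => lieDeriv X circleFn z - (2 * α * z.1 * circleFn z + 2 * β * circleFn z ^ 2 +
      2 * ρ * z.1 ^ 2 * circleFn z)) =o[𝓝 0] fun z => ‖z‖ ^ 4 := by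
  have b1 : (fun z : ℝ × SplitSpace n => 2 * crd1 z.2) =O[𝓝 0] fun z => ‖z‖ :=
    (IsBigO.of_bound 1 (Eventually.of_forall fun z => by
      rw [one_mul, norm_norm]; exact abs_crd1_le z)).const_mul_left 2
  have b2 : (fun z : ℝ × SplitSpace n => 2 * crd2 z.2) =O[𝓝 0] fun z => ‖z‖ :=
    (IsBigO.of_bound 1 (Eventually.of_forall fun z => by
      rw [one_mul, norm_norm]; exact abs_crd2_le z)).const_mul_left 2
  refine ((b1.mul_isLittleO h.comp_one).add (b2.mul_isLittleO h.comp_two)).congr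
    (fun z => ?_) (fun z => by ring)
  rw [_root_.lieDeriv_circleFn, circleFn]
  ring

lemma circleFn_isBigO {G : Type*} [NormedAddCommGroup G] {f : G → ℝ × SplitSpace n} {l : Filter G}
    (hf : f =O[l] fun w => ‖w‖) : (fun w => circleFn (f w)) =O[l] fun w => ‖w‖ ^ 2 := by
  have b1 : (fun w => crd1 (f w).2) =O[l] fun w => ‖w‖ :=
    (IsBigO.of_bound 1 (Eventually.of_forall fun w => by rw [one_mul]; exact abs_crd1_le _)).trans hf
  have b2 : (fun w => crd2 (f w).2) =O[l] fun w => ‖w‖ :=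
    (IsBigO.of_bound 1 (Eventually.of_forall fun w => by rw [one_mul]; exact abs_crd2_le _)).trans hf
  exact (b1.pow 2).add (b2.pow 2)

/-- A difference of squares factors into a sum of order one and a difference of order o(‖w‖). -/
lemma circleFn_sub_isLittleO {G : Type*} [NormedAddCommGroup G] {f g : G → ℝ × SplitSpace n}
    {l : Filter G} (hf : f =O[l] fun w => ‖w‖) (hg : g =O[l] fun w => ‖w‖)
    (hfg : (fun w => f w - g w) =o[l] fun w => ‖w‖) :
    (fun w => circleFn (f w) - circleFn (g w)) =o[l] fun w => ‖w‖ ^ 2 := by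
  have hs := hf.add hg
  have b1 : (fun w => crd1 (f w + g w).2) =O[l] fun w => ‖w‖ :=
    (IsBigO.of_bound 1 (Eventually.of_forall fun w => by rw [one_mul]; exact abs_crd1_le _)).trans hs
  have b2 : (fun w => crd2 (f w + g w).2) =O[l] fun w => ‖w‖ :=
    (IsBigO.of_bound 1 (Eventually.of_forall fun w => by rw [one_mul]; exact abs_crd2_le _)).trans hs
  have c1 : (fun w => crd1 (f w - g w).2) =o[l] fun w => ‖w‖ :=
    (IsBigO.of_bound 1 (Eventually.of_forall fun w => by
      rw [one_mul]; exact abs_crd1_le _)).trans_isLittleO hfg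
  have c2 : (fun w => crd2 (f w - g w).2) =o[l] fun w => ‖w‖ :=
    (IsBigO.of_bound 1 (Eventually.of_forall fun w => by
      rw [one_mul]; exact abs_crd2_le _)).trans_isLittleO hfg
  refine ((b1.mul_isLittleO c1).add (b2.mul_isLittleO c2)).congr (fun w => ?_) (fun w => by ring)
  simp only [circleFn, crd1, crd2, Prod.snd_add, Prod.snd_sub, Pi.add_apply, Pi.sub_apply]
  ring

end circle

/-! ### From the normal form to the Lie derivative conditions -/

/-- `T` is a smooth local diffeomorphism at `0` with derivative `L`, taking the vector field `X` to
the vector field `F`. -/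
structure IsTransform {E G : Type*} [NormedAddCommGroup E] [NormedSpace ℝ E]
    [NormedAddCommGroup G] [NormedSpace ℝ G] (T : E → G) (L : E ≃L[ℝ] G) (X : E → E)
    (F : G → G) : Prop where
  smooth : SmoothNear T 0
  map_zero : T 0 = 0
  hasFDerivAt : HasFDerivAt T (L : E →L[ℝ] G) 0
  intertwine : ∀ᶠ z in 𝓝 0, fderiv ℝ T z (X z) = F (T z)

section transform
variable {E G : Type*} [NormedAddCommGroup E] [NormedSpace ℝ E] [NormedAddCommGroup G]
  [NormedSpace ℝ G] {T : E → G} {L : E ≃L[ℝ] G} {X : E → E} {F : G → G}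

lemma IsTransform.tendsto (h : IsTransform T L X F) : Tendsto T (𝓝 0) (𝓝 0) := by
  simpa [h.map_zero] using h.hasFDerivAt.continuousAt.tendsto

lemma isBigO_of_hasFDerivAt_zero {f : E → G} {f' : E →L[ℝ] G} (h0 : f 0 = 0)
    (hf : HasFDerivAt f f' 0) : f =O[𝓝 0] fun z => ‖z‖ := by
  have := hf.isBigO_sub
  simpa [h0] using this.norm_right

lemma isLittleO_of_hasFDerivAt_zero {f : E → G} {f' : E →L[ℝ] G} (h0 : f 0 = 0)
    (hf : HasFDerivAt f f' 0) : (fun z => f z - f' z) =o[𝓝 0] fun z => ‖z‖ := by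
  have := hasFDerivAt_iff_isLittleO_nhds_zero.1 hf
  simpa [h0] using this.norm_right

lemma IsTransform.lieDeriv_comp (h : IsTransform T L X F) {σ : G → ℝ} (hσ : SmoothNear σ 0) :
    ∀ᶠ z in 𝓝 0, lieDeriv X (σ ∘ T) z = lieDeriv F σ (T z) := by
  filter_upwards [h.intertwine, h.tendsto.eventually hσ.eventually_differentiableAt,
    h.smooth.eventually_differentiableAt] with z h1 h2 h3
  rw [lieDeriv, lieDeriv, fderiv_comp z h2 h3, ContinuousLinearMap.comp_apply, h1]

end transform

section forward
variable {n : ℕ} {T : ℝ × SplitSpace n → ℝ × (Fin n → ℝ)} {S : SplitSpace n ≃L[ℝ] (Fin n → ℝ)}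
  {X : ℝ × SplitSpace n → ℝ × SplitSpace n} {F : ℝ × (Fin n → ℝ) → ℝ × (Fin n → ℝ)}
  {ψ : MvPolynomial (Fin n) ℝ} {ω α β μ γ ρ σ : ℝ}

/-- The coordinate change `S` on the suspended space. -/
def suspEquiv (S : SplitSpace n ≃L[ℝ] (Fin n → ℝ)) :
    (ℝ × SplitSpace n) ≃L[ℝ] (ℝ × (Fin n → ℝ)) :=
  (ContinuousLinearEquiv.refl ℝ ℝ).prodCongr S

lemma circleFn_suspEquiv_symm (hψ : ∀ y, MvPolynomial.eval (S y) ψ = crd1 y ^ 2 + crd2 y ^ 2)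
    (w : ℝ × (Fin n → ℝ)) :
    circleFn ((suspEquiv S).symm w) = MvPolynomial.eval w.2 ψ := by
  have := hψ (S.symm w.2)
  rw [S.apply_symm_apply] at this
  exact this.symm

/-- The pull back of `y₁² + y₂²` and its Lie derivative. -/
lemma IsTransform.exists_lieDeriv (hT : IsTransform T (suspEquiv S) X F)
    (hfst : ∀ z, (T z).1 = z.1) (hX : IsNFIM X ω α β μ γ ρ σ)
    (hψ : ∀ y, MvPolynomial.eval (S y) ψ = crd1 y ^ 2 + crd2 y ^ 2) :
    ∃ θ : ℝ × (Fin n → ℝ) → ℝ, SmoothNear θ 0 ∧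
      (fun w => θ w - MvPolynomial.eval w.2 ψ) =o[𝓝 0] (fun w => ‖w‖ ^ 2) ∧
      θ =O[𝓝 0] (fun w => ‖w‖ ^ 2) ∧
      (fun w => lieDeriv F θ w - (2 * α * w.1 * θ w + 2 * β * θ w ^ 2 + 2 * ρ * w.1 ^ 2 * θ w))
        =o[𝓝 0] fun w => ‖w‖ ^ 4 := by
  obtain ⟨Ψ, hΨs, hΨ0, hΨd, hTΨ, hΨT⟩ := hT.smooth.exists_local_inverse hT.map_zero hT.hasFDerivAt
  have hΨO := isBigO_of_hasFDerivAt_zero hΨ0 hΨd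
  have hΨt : Tendsto Ψ (𝓝 0) (𝓝 0) := by simpa [hΨ0] using hΨd.continuousAt.tendsto
  have hθs : SmoothNear (circleFn ∘ Ψ) 0 := (contDiff_circleFn.smoothNear _).comp hΨs
  -- The first integral to lowest order is y₁² + y₂² composed with the local inverse Ψ of T. The Lie
  -- derivative is natural, so the identity in normal form coordinates carries over.
  refine ⟨circleFn ∘ Ψ, hθs, ?_, circleFn_isBigO hΨO, ?_⟩
  · have hL : (fun w => (suspEquiv S).symm w) =O[𝓝 0] fun w => ‖w‖ :=
      ((suspEquiv S).symm.toContinuousLinearMap.isBigO_id _).norm_right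
    refine (circleFn_sub_isLittleO hΨO hL (isLittleO_of_hasFDerivAt_zero hΨ0 hΨd)).congr_left
      fun w => ?_
    rw [circleFn_suspEquiv_symm hψ]; rfl
  · have h1 := hT.lieDeriv_comp hθs
    have h2 : ∀ᶠ z in 𝓝 0, lieDeriv X ((circleFn ∘ Ψ) ∘ T) z = lieDeriv X circleFn z := by
      filter_upwards [hΨT.eventually_nhds] with z hz
      have : ((circleFn ∘ Ψ) ∘ T) =ᶠ[𝓝 z] circleFn := by
        filter_upwards [hz] with y hy
        simp only [Function.comp, hy]
      rw [lieDeriv, this.fderiv_eq, lieDeriv]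
    have h3 := hX.lieDeriv_circleFn.comp_tendsto hΨt
    have h4 : (fun w => ‖Ψ w‖ ^ 4) =O[𝓝 0] fun w => ‖w‖ ^ 4 := hΨO.norm_left.pow 4
    refine (h3.trans_isBigO h4).congr' ?_ EventuallyEq.rfl
    filter_upwards [hΨt.eventually h1, hΨt.eventually h2, hTΨ] with w e1 e2 e3
    have e4 : (Ψ w).1 = w.1 := by rw [← hfst, e3]
    simp only [Function.comp, ← e2, ← e4]
    have e5 : lieDeriv F (circleFn ∘ Ψ) w = lieDeriv X ((circleFn ∘ Ψ) ∘ T) (Ψ w) := by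
      rw [e1, e3]
    exact congrArg (· - _) e5.symm

lemma fst_isBigO {G : Type*} [NormedAddCommGroup G] (l : Filter (ℝ × G)) :
    (fun w : ℝ × G => w.1) =O[l] fun w => ‖w‖ :=
  IsBigO.of_bound 1 (Eventually.of_forall fun w => by
    rw [one_mul, norm_norm]; exact norm_fst_le w)

/-- The β and ρ terms have order four, so only 2αx₀θ survives at order three, and there θ may be
replaced by ψ. -/
lemma IsTransform.alphaCondition (hT : IsTransform T (suspEquiv S) X F)
    (hfst : ∀ z, (T z).1 = z.1) (hX : IsNFIM X ω α β μ γ ρ σ)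
    (hψ : ∀ y, MvPolynomial.eval (S y) ψ = crd1 y ^ 2 + crd2 y ^ 2) : AlphaCondition F ψ α := by
  obtain ⟨θ, hs, ho, hO, hL⟩ := hT.exists_lieDeriv hfst hX hψ
  refine ⟨θ, hs, ho, ?_⟩
  have h1 := (fst_isBigO (𝓝 (0 : ℝ × (Fin n → ℝ)))).mul_isLittleO ho
  have h2 := (hO.pow 2).const_mul_left (2 * β)
  have h3 := (((fst_isBigO (𝓝 (0 : ℝ × (Fin n → ℝ)))).pow 2).mul hO).const_mul_left (2 * ρ)
  have h43 := norm_pow_succ_isLittleO (le_refl (𝓝 (0 : ℝ × (Fin n → ℝ)))) (show 3 < 4 by omega)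
  have k1 := (h1.const_mul_left (2 * α)).congr_right (g₂ := fun w => ‖w‖ ^ 3) fun w => by ring
  have k2 := (h2.congr_right (g₂ := fun w => ‖w‖ ^ 4) fun w => by ring).trans_isLittleO h43
  have k3 := (h3.congr_right (g₂ := fun w => ‖w‖ ^ 4) fun w => by ring).trans_isLittleO h43
  refine (((k1.add k2).add k3).add (hL.trans h43)).congr_left fun w => ?_
  ring

/-- F is tangent to the slice x₀ = 0, so restricting to the slice commutes with the Lie derivative.
-/
lemma lieDeriv_of_fst_eq_zero {f : (Fin n → ℝ) → (Fin n → ℝ)} {θ : ℝ × (Fin n → ℝ) → ℝ}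
    {x : Fin n → ℝ} (hF : F (0, x) = (0, f x)) (hθ : DifferentiableAt ℝ θ (0, x)) :
    lieDeriv f (fun x => θ (0, x)) x = lieDeriv F θ (0, x) := by
  have h1 : HasFDerivAt (fun x : Fin n → ℝ => ((0 : ℝ), x))
      (ContinuousLinearMap.inr ℝ ℝ (Fin n → ℝ)) x := hasFDerivAt_prodMk_right _ _
  have h2 := hθ.hasFDerivAt.comp x h1
  rw [lieDeriv, lieDeriv, hF]
  change fderiv ℝ (θ ∘ fun x => (0, x)) x (f x) = _
  rw [h2.fderiv]; simp

/-- On the slice x₀ = 0 the α and ρ terms vanish, so the expansion to fourth order reduces to 2βθ².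
-/
lemma IsTransform.betaCondition (hT : IsTransform T (suspEquiv S) X F)
    (hfst : ∀ z, (T z).1 = z.1) (hX : IsNFIM X ω α β μ γ ρ σ)
    (hψ : ∀ y, MvPolynomial.eval (S y) ψ = crd1 y ^ 2 + crd2 y ^ 2)
    {f : (Fin n → ℝ) → (Fin n → ℝ)} (hF : ∀ x, F (0, x) = (0, f x)) :
    BetaCondition f ψ β := by
  obtain ⟨θ, hs, ho, hO, hL⟩ := hT.exists_lieDeriv hfst hX hψ
  have hι : Tendsto (fun x : Fin n → ℝ => ((0 : ℝ), x)) (𝓝 0) (𝓝 0) := by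
    have : ContinuousAt (fun x : Fin n → ℝ => ((0 : ℝ), x)) 0 := by fun_prop
    exact this.tendsto
  have hnorm : ∀ x : Fin n → ℝ, ‖((0 : ℝ), x)‖ = ‖x‖ := fun x => by simp [Prod.norm_def]
  have ho' : (fun x => θ (0, x) - MvPolynomial.eval x ψ) =o[𝓝 0] fun x => ‖x‖ ^ 2 :=
    (ho.comp_tendsto hι).congr_right fun x => by simp [hnorm]
  have hO' : (fun x => θ (0, x)) =O[𝓝 0] fun x => ‖x‖ ^ 2 :=
    (hO.comp_tendsto hι).congr_right fun x => by simp [hnorm]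
  refine ⟨fun x => θ (0, x), hs.comp (f := fun x => ((0 : ℝ), x))
    (ContDiff.smoothNear (by fun_prop) _), ho', ?_⟩
  have h1 : (fun x => θ (0, x) + MvPolynomial.eval x ψ) =O[𝓝 0] fun x => ‖x‖ ^ 2 :=
    ((hO'.const_mul_left 2).sub ho'.isBigO).congr_left fun x => by ring
  have h2 := ((h1.mul_isLittleO ho').const_mul_left (2 * β)).congr_right (g₂ := fun x => ‖x‖ ^ 4)
    fun x => by ring
  have h3 : (fun x => lieDeriv F θ (0, x) - 2 * β * θ (0, x) ^ 2) =o[𝓝 0] fun x => ‖x‖ ^ 4 :=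
    (hL.comp_tendsto hι).congr (fun x => by simp) fun x => by simp [hnorm]
  refine (h3.add h2).congr' ?_ EventuallyEq.rfl
  filter_upwards [hι.eventually hs.eventually_differentiableAt] with x hx
  rw [lieDeriv_of_fst_eq_zero (hF x) hx]
  ring

end forward

/-! ### Rolle's theorem on small circles -/

section rotation
variable {n : ℕ}

/-- The point at angle `t` of the circle of radius `r` in the plane `x₀ = s`, `y₃ = ⋯ = 0`. -/
noncomputable def circlePt (s r t : ℝ) : ℝ × SplitSpace n :=
  (s, Sum.elim ![r * Real.cos t, r * Real.sin t] 0)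

/-- The rotation vector field. -/
def rotField (z : ℝ × SplitSpace n) : ℝ × SplitSpace n :=
  (0, Sum.elim ![-crd2 z.2, crd1 z.2] 0)

lemma hasDerivAt_circlePt (s r t : ℝ) :
    HasDerivAt (circlePt (n := n) s r) (rotField (circlePt (n := n) s r t)) t := by
  refine (hasDerivAt_const t s).prodMk (hasDerivAt_pi.2 fun i => ?_)
  rcases i with i | i
  · fin_cases i
    · simpa [crd2, circlePt] using (Real.hasDerivAt_cos t).const_mul r
    · simpa [crd1, circlePt] using (Real.hasDerivAt_sin t).const_mul r
  · exact hasDerivAt_const t 0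

lemma circleFn_circlePt (s r t : ℝ) : circleFn (circlePt (n := n) s r t) = r ^ 2 := by
  simp only [circleFn, circlePt, crd1, crd2, Sum.elim_inl, Matrix.cons_val_zero,
    Matrix.cons_val_one]
  linear_combination r ^ 2 * Real.sin_sq_add_cos_sq t

lemma norm_circlePt_le {s r t : ℝ} (hr : 0 ≤ r) (hs : |s| ≤ r) :
    ‖circlePt (n := n) s r t‖ ≤ r := by
  refine max_le hs ((pi_norm_le_iff_of_nonneg hr).2 fun i => ?_)
  rcases i with i | i
  · fin_cases i
    · simpa [circlePt, abs_mul, abs_of_nonneg hr] using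
        mul_le_of_le_one_right hr (Real.abs_cos_le_one t)
    · simpa [circlePt, abs_mul, abs_of_nonneg hr] using
        mul_le_of_le_one_right hr (Real.abs_sin_le_one t)
  · simpa [circlePt] using hr

/-- Rolle's theorem for the restriction of δ to the circle, over one full period. -/
lemma exists_fderiv_rotField_eq_zero {δ : ℝ × SplitSpace n → ℝ} {s r : ℝ}
    (hδ : ∀ t, DifferentiableAt ℝ δ (circlePt s r t)) :
    ∃ t, fderiv ℝ δ (circlePt s r t) (rotField (circlePt s r t)) = 0 := by
  have hd : ∀ t, HasDerivAt (fun t => δ (circlePt s r t))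
      (fderiv ℝ δ (circlePt s r t) (rotField (circlePt s r t))) t := fun t =>
    (hδ t).hasFDerivAt.comp_hasDerivAt t (hasDerivAt_circlePt s r t)
  obtain ⟨t, -, ht⟩ := exists_hasDerivAt_eq_zero (f := fun t => δ (circlePt s r t))
    (a := 0) (b := 2 * Real.pi) (by positivity)
    (fun t _ => (hd t).continuousAt.continuousWithinAt) (by simp [circlePt]) (fun t _ => hd t)
  exact ⟨t, ht⟩

/-- Along each family of circles there are points where the angular derivative vanishes. -/
lemma SmoothNear.exists_critical_path {δ : ℝ × SplitSpace n → ℝ} (hδ : SmoothNear δ 0) {s : ℝ}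
    (hs : |s| ≤ 1) : ∃ t : ℝ → ℝ, ∀ᶠ r in 𝓝[>] 0,
      fderiv ℝ δ (circlePt (s * r) r (t r)) (rotField (circlePt (s * r) r (t r))) = 0 := by
  obtain ⟨ε, hε, hball⟩ := Metric.eventually_nhds_iff.1 hδ.eventually_differentiableAt
  have h : ∀ r : ℝ, ∃ t, 0 < r → r < ε →
      fderiv ℝ δ (circlePt (s * r) r t) (rotField (circlePt (s * r) r t)) = 0 := by
    intro r
    by_cases hr : 0 < r ∧ r < ε
    · obtain ⟨t, ht⟩ := exists_fderiv_rotField_eq_zero (δ := δ) (s := s * r) (r := r) fun t => by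
        refine hball ?_
        rw [dist_zero_right]
        refine (norm_circlePt_le hr.1.le ?_).trans_lt hr.2
        rw [abs_mul, abs_of_pos hr.1]
        exact mul_le_of_le_one_left hr.1.le hs
      exact ⟨t, fun _ _ => ht⟩
    · exact ⟨0, fun h1 h2 => absurd ⟨h1, h2⟩ hr⟩
  choose t ht using h
  refine ⟨t, ?_⟩
  filter_upwards [Ioo_mem_nhdsGT hε] with r hr using ht r hr.1 hr.2

variable {s : ℝ} {t : ℝ → ℝ}

lemma circlePath_isBigO (hs : |s| ≤ 1) :
    (fun r => circlePt (n := n) (s * r) r (t r)) =O[𝓝[>] 0] fun r : ℝ => r := by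
  refine IsBigO.of_bound 1 ?_
  filter_upwards [self_mem_nhdsWithin] with r (hr : 0 < r)
  rw [one_mul, Real.norm_of_nonneg hr.le]
  refine norm_circlePt_le hr.le ?_
  rw [abs_mul, abs_of_pos hr]
  exact mul_le_of_le_one_left hr.le hs

lemma circlePath_tendsto (hs : |s| ≤ 1) :
    Tendsto (fun r => circlePt (n := n) (s * r) r (t r)) (𝓝[>] 0) (𝓝 0) :=
  (circlePath_isBigO hs).trans_tendsto (tendsto_id.mono_left nhdsWithin_le_nhds)

lemma circlePath_tendsto_within (hs : |s| ≤ 1) :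
    Tendsto (fun r => circlePt (n := n) (s * r) r (t r)) (𝓝[>] 0)
      (𝓝[{z | ∀ i : Fin (n - 2), z.2 (Sum.inr i) = 0}] 0) :=
  tendsto_nhdsWithin_iff.2 ⟨circlePath_tendsto hs, Eventually.of_forall fun _ _ => rfl⟩

/-- On the circles the stable components of X are o(r³) by approximate invariance, and the cubic
center terms are O(r³). The terms linear in x₀ = s r are only O(r²), hence j ≤ 2 unless s = 0. The
path t is arbitrary and need not be continuous. -/
lemma IsNFIM.sub_rotField_isBigO {X : ℝ × SplitSpace n → ℝ × SplitSpace n}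
    {ω α β μ γ ρ σ : ℝ} (hX : IsNFIM X ω α β μ γ ρ σ) (hs : |s| ≤ 1) {j : ℕ} (hj : j ≤ 3)
    (hsj : s = 0 ∨ j ≤ 2) :
    (fun r => X (circlePt (s * r) r (t r)) - ω • rotField (circlePt (s * r) r (t r)))
      =O[𝓝[>] 0] fun r : ℝ => r ^ j := by
  set P : ℝ → ℝ × SplitSpace n := fun r => circlePt (s * r) r (t r) with hP
  have hpow : ∀ {i k : ℕ}, i ≤ k → (fun r : ℝ => r ^ k) =O[𝓝[>] 0] fun r => r ^ i := by
    intro i k hik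
    refine IsBigO.of_bound 1 ?_
    filter_upwards [Ioo_mem_nhdsGT one_pos] with r hr
    rw [one_mul, norm_pow, norm_pow, Real.norm_of_nonneg hr.1.le]
    exact pow_le_pow_of_le_one hr.1.le hr.2.le hik
  have hPO : P =O[𝓝[>] 0] fun r => r := circlePath_isBigO hs
  have h3 : (fun r => ‖P r‖ ^ 3) =O[𝓝[>] 0] fun r => r ^ j :=
    (hPO.norm_left.pow 3).trans (hpow hj)
  have c1 : (fun r => crd1 (P r).2) =O[𝓝[>] 0] fun r => r :=
    (IsBigO.of_bound 1 (Eventually.of_forall fun r => by rw [one_mul]; exact abs_crd1_le _)).trans hPO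
  have c2 : (fun r => crd2 (P r).2) =O[𝓝[>] 0] fun r => r :=
    (IsBigO.of_bound 1 (Eventually.of_forall fun r => by rw [one_mul]; exact abs_crd2_le _)).trans hPO
  have hid : (fun r : ℝ => r) =O[𝓝[>] 0] fun r : ℝ => r := isBigO_refl _ _
  have hres : ∀ a b c d e f : ℝ, (fun r => s * r * (a * crd1 (P r).2 + b * crd2 (P r).2) +
      r ^ 2 * (c * crd1 (P r).2 + d * crd2 (P r).2) +
      (s * r) ^ 2 * (e * crd1 (P r).2 + f * crd2 (P r).2)) =O[𝓝[>] 0] fun r => r ^ j := by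
    intro a b c d e f
    have hl : ∀ a b : ℝ, (fun r => a * crd1 (P r).2 + b * crd2 (P r).2) =O[𝓝[>] 0] fun r => r :=
      fun a b => (c1.const_mul_left a).add (c2.const_mul_left b)
    have k2 : (fun r => r ^ 2 * (c * crd1 (P r).2 + d * crd2 (P r).2)) =O[𝓝[>] 0] fun r => r ^ j :=
      (((hid.pow 2).mul (hl c d)).congr_right fun r => (pow_succ r 2).symm).trans (hpow hj)
    have k3 : (fun r => (s * r) ^ 2 * (e * crd1 (P r).2 + f * crd2 (P r).2))
        =O[𝓝[>] 0] fun r => r ^ j :=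
      ((((hid.const_mul_left s).pow 2).mul (hl e f)).congr_right fun r =>
        (pow_succ r 2).symm).trans (hpow hj)
    have k1 : (fun r => s * r * (a * crd1 (P r).2 + b * crd2 (P r).2)) =O[𝓝[>] 0] fun r => r ^ j := by
      rcases hsj with rfl | hj2
      · simpa using isBigO_zero _ _
      · exact (((hid.const_mul_left s).mul (hl a b)).congr_right fun r => (sq r).symm).trans
          (hpow hj2)
    exact (k1.add k2).add k3
  have hcirc : ∀ r, crd1 (P r).2 ^ 2 + crd2 (P r).2 ^ 2 = r ^ 2 := fun r => circleFn_circlePt _ _ _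
  refine IsBigO.prod_left ?_ (isBigO_pi.2 fun i => ?_)
  · refine (isBigO_zero _ _).congr' ?_ EventuallyEq.rfl
    filter_upwards [(circlePath_tendsto (t := t) hs).eventually hX.comp_zero] with r hr
    simp [rotField, hr]
  · rcases i with i | i
    · fin_cases i
      · refine (((hX.comp_one.comp_tendsto (circlePath_tendsto hs)).isBigO.trans h3).add
          (hres α (-μ) β (-γ) ρ (-σ))).congr_left fun r => ?_
        simp only [Function.comp]
        change _ = crd1 (X (P r)).2 - ω * -crd2 (P r).2
        rw [hcirc, show (P r).1 = s * r from rfl]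
        ring
      · refine (((hX.comp_two.comp_tendsto (circlePath_tendsto hs)).isBigO.trans h3).add
          (hres μ α γ β σ ρ)).congr_left fun r => ?_
        simp only [Function.comp]
        change _ = crd2 (X (P r)).2 - ω * crd1 (P r).2
        rw [hcirc, show (P r).1 = s * r from rfl]
        ring
    · refine ((((hX.invariant i).comp_tendsto (circlePath_tendsto_within hs)).isBigO.trans
        h3)).congr_left fun r => ?_
      simp [rotField]

/-- If the Lie derivative of a function of order at least three has a leading term `c r^(j+1)` on a
family of circles, then `c = 0`. -/
lemma IsNFIM.eq_zero_of_lieDeriv {X : ℝ × SplitSpace n → ℝ × SplitSpace n}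
    {ω α β μ γ ρ σ : ℝ} (hX : IsNFIM X ω α β μ γ ρ σ) (hs : |s| ≤ 1) {j : ℕ} (hj : j ≤ 3)
    (hsj : s = 0 ∨ j ≤ 2) {δ : ℝ × SplitSpace n → ℝ} (hδ : SmoothNear δ 0)
    (hδo : δ =o[𝓝 0] fun z => ‖z‖ ^ 2) {c : ℝ}
    (hL : ∀ t : ℝ → ℝ, (fun r => lieDeriv X δ (circlePt (s * r) r (t r)) - c * r ^ (j + 1))
      =o[𝓝[>] 0] fun r : ℝ => r ^ (j + 1)) : c = 0 := by
  obtain ⟨t, ht⟩ := hδ.exists_critical_path hs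
  have h1 := hX.sub_rotField_isBigO (t := t) hs hj hsj
  have h2 : (fun r => fderiv ℝ δ (circlePt (s * r) r (t r))) =o[𝓝[>] 0] fun r : ℝ => r :=
    ((fderiv_isLittleO_of_isLittleO_sq (hδ.contDiffAt.of_le (WithTop.coe_le_coe.2 (le_top : (2 : ℕ∞) ≤ ⊤))) hδo).comp_tendsto
      (circlePath_tendsto hs)).trans_isBigO (circlePath_isBigO hs).norm_left
  have h3 : (fun r => lieDeriv X δ (circlePt (s * r) r (t r))) =o[𝓝[>] 0]
      fun r : ℝ => r ^ (j + 1) := by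
    -- At the critical points ω times the rotation field contributes nothing to the derivative of δ.
    -- What remains is Dδ = o(r) applied to a vector of size O(r^j).
    have h4 : (fun r => fderiv ℝ δ (circlePt (s * r) r (t r))
        (X (circlePt (s * r) r (t r)) - ω • rotField (circlePt (s * r) r (t r)))) =o[𝓝[>] 0]
        fun r : ℝ => r * r ^ j := by
      refine IsBigO.trans_isLittleO ?_ (h2.norm_left.mul_isBigO h1.norm_left)
      exact IsBigO.of_bound 1 (Eventually.of_forall fun r => by
        rw [one_mul, norm_mul, norm_norm, norm_norm]
        exact ContinuousLinearMap.le_opNorm _ _)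
    refine h4.congr' ?_ (Eventually.of_forall fun r => by ring)
    filter_upwards [ht] with r hr
    rw [map_sub, map_smul, hr, smul_zero, sub_zero]; rfl
  have h5 := (h3.sub (hL t)).congr_left (f₂ := fun r => c * r ^ (j + 1)) fun r => by ring
  by_contra hc
  have h6 := (isLittleO_const_mul_left_iff hc).1 h5
  refine absurd h6 ?_
  refine isLittleO_irrefl ?_
  refine Eventually.frequently ?_
  filter_upwards [self_mem_nhdsWithin] with r (hr : 0 < r) using by positivity

end rotation

/-! ### The Lie derivative conditions determine α and β -/

section uniqueness
variable {n : ℕ} {T : ℝ × SplitSpace n → ℝ × (Fin n → ℝ)} {S : SplitSpace n ≃L[ℝ] (Fin n → ℝ)}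
  {X : ℝ × SplitSpace n → ℝ × SplitSpace n} {F : ℝ × (Fin n → ℝ) → ℝ × (Fin n → ℝ)}
  {ψ : MvPolynomial (Fin n) ℝ} {ω α β μ γ ρ σ : ℝ}

/-- S⁻¹T is the identity up to o(‖z‖), and ψ is y₁² + y₂² in the coordinates S. -/
lemma IsTransform.eval_sub_isLittleO (hT : IsTransform T (suspEquiv S) X F)
    (hψ : ∀ y, MvPolynomial.eval (S y) ψ = crd1 y ^ 2 + crd2 y ^ 2) :
    (fun z => MvPolynomial.eval (T z).2 ψ - circleFn z) =o[𝓝 0] fun z => ‖z‖ ^ 2 := by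
  have h1 := isLittleO_of_hasFDerivAt_zero hT.map_zero hT.hasFDerivAt
  have h2 : (fun z => (suspEquiv S).symm (T z)) =O[𝓝 0] fun z => ‖z‖ :=
    ((suspEquiv S).symm.toContinuousLinearMap.isBigO_comp _ _).trans
      (isBigO_of_hasFDerivAt_zero hT.map_zero hT.hasFDerivAt)
  have h3 : (fun z => (suspEquiv S).symm (T z) - z) =o[𝓝 0] fun z => ‖z‖ := by
    refine (((suspEquiv S).symm.toContinuousLinearMap.isBigO_comp _ _).trans_isLittleO h1).congr_left
      fun z => ?_
    simp
  refine (circleFn_sub_isLittleO h2 ((isBigO_refl _ _).norm_right) h3).congr_left fun z => ?_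
  rw [circleFn_suspEquiv_symm hψ]

/-- The difference of a first integral up to order two and `y₁² + y₂²`, and its Lie derivative. -/
lemma IsTransform.lieDeriv_sub (hT : IsTransform T (suspEquiv S) X F) {θ : ℝ × (Fin n → ℝ) → ℝ}
    (hθ : SmoothNear θ 0)
    (hψ : ∀ y, MvPolynomial.eval (S y) ψ = crd1 y ^ 2 + crd2 y ^ 2)
    (ho : (fun w => θ w - MvPolynomial.eval w.2 ψ) =o[𝓝 0] (fun w => ‖w‖ ^ 2)) :
    SmoothNear (fun z => θ (T z) - circleFn z) 0 ∧
    (fun z => θ (T z) - circleFn z) =o[𝓝 0] (fun z => ‖z‖ ^ 2) ∧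
    ∀ᶠ z in 𝓝 0, lieDeriv X (fun z => θ (T z) - circleFn z) z =
      lieDeriv F θ (T z) - lieDeriv X circleFn z := by
  have hTO := isBigO_of_hasFDerivAt_zero hT.map_zero hT.hasFDerivAt
  have hs : SmoothNear (θ ∘ T) 0 := SmoothNear.comp (by rwa [hT.map_zero]) hT.smooth
  refine ⟨hs.sub (contDiff_circleFn.smoothNear _), ?_, ?_⟩
  · have h1 := (ho.comp_tendsto hT.tendsto).trans_isBigO (hTO.norm_left.pow 2)
    refine (h1.add (hT.eval_sub_isLittleO hψ)).congr_left fun z => ?_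
    simp
  · filter_upwards [hT.lieDeriv_comp hθ, hs.eventually_differentiableAt] with z h1 h2
    rw [← h1, lieDeriv, lieDeriv, lieDeriv]
    exact DFunLike.congr_fun
      (fderiv_sub h2 (contDiff_circleFn.differentiable (by simp) z)) (X z)

/-- The difference δ of the two approximate integrals has Lie derivative 2(α' - α)x₀(y₁² + y₂²) +
o(‖z‖³). On the circle of radius r at height x₀ = r, i.e. s = 1, the leading term is 2(α' - α)r³. -/
lemma IsTransform.alpha_unique (hT : IsTransform T (suspEquiv S) X F)
    (hfst : ∀ z, (T z).1 = z.1) (hX : IsNFIM X ω α β μ γ ρ σ)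
    (hψ : ∀ y, MvPolynomial.eval (S y) ψ = crd1 y ^ 2 + crd2 y ^ 2) {α' : ℝ}
    (h : AlphaCondition F ψ α') : α' = α := by
  obtain ⟨θ, hθ, ho, hL⟩ := h
  obtain ⟨hδs, hδo, hδL⟩ := hT.lieDeriv_sub hθ hψ ho
  have hTO := isBigO_of_hasFDerivAt_zero hT.map_zero hT.hasFDerivAt
  have h43 := norm_pow_succ_isLittleO (le_refl (𝓝 (0 : ℝ × SplitSpace n))) (show 3 < 4 by omega)
  have hid : (fun z : ℝ × SplitSpace n => z) =O[𝓝 0] fun z => ‖z‖ := (isBigO_refl _ _).norm_right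
  have hc := circleFn_isBigO hid
  have hf := fst_isBigO (𝓝 (0 : ℝ × SplitSpace n))
  have k1 := (hL.comp_tendsto hT.tendsto).trans_isBigO (hTO.norm_left.pow 3)
  have k2 := ((hf.mul_isLittleO (hT.eval_sub_isLittleO hψ)).const_mul_left (2 * α')).congr_right
    (g₂ := fun z => ‖z‖ ^ 3) fun z => by ring
  have k3 := hX.lieDeriv_circleFn.trans h43
  have k4 := (((hc.pow 2).const_mul_left (2 * β)).congr_right (g₂ := fun z => ‖z‖ ^ 4)
    fun z => by ring).trans_isLittleO h43
  have k5 := ((((hf.pow 2).mul hc).const_mul_left (2 * ρ)).congr_right (g₂ := fun z => ‖z‖ ^ 4)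
    fun z => by ring).trans_isLittleO h43
  have key : (fun z => lieDeriv X (fun z => θ (T z) - circleFn z) z -
      2 * (α' - α) * (z.1 * circleFn z)) =o[𝓝 0] fun z => ‖z‖ ^ 3 := by
    refine (((k1.add k2).sub k3).sub (k4.add k5)).congr' ?_ EventuallyEq.rfl
    filter_upwards [hδL] with z hz
    rw [hz]
    simp only [Function.comp, hfst]
    ring
  have hs : |(1 : ℝ)| ≤ 1 := by simp
  have := hX.eq_zero_of_lieDeriv (s := 1) hs (j := 2) (by omega) (Or.inr le_rfl) hδs hδo
    (c := 2 * (α' - α)) fun t => by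
      refine ((key.comp_tendsto (circlePath_tendsto (t := t) hs)).trans_isBigO
        ((circlePath_isBigO hs).norm_left.pow 3)).congr_left fun r => ?_
      simp only [Function.comp, circleFn_circlePt]
      change _ - 2 * (α' - α) * (1 * r * r ^ 2) = _
      ring
  linarith

/-- ψ̂ is extended to be constant in x₀ and tested on circles with x₀ = 0, where the α and ρ terms
are absent and the leading term is 2(β' - β)r⁴. -/
lemma IsTransform.beta_unique (hT : IsTransform T (suspEquiv S) X F)
    (hfst : ∀ z, (T z).1 = z.1) (hX : IsNFIM X ω α β μ γ ρ σ)
    (hψ : ∀ y, MvPolynomial.eval (S y) ψ = crd1 y ^ 2 + crd2 y ^ 2)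
    {f : (Fin n → ℝ) → (Fin n → ℝ)} (hF : ∀ x, F (0, x) = (0, f x)) {β' : ℝ}
    (h : BetaCondition f ψ β') : β' = β := by
  obtain ⟨θ₀, hθ₀, ho₀, hL₀⟩ := h
  set θ : ℝ × (Fin n → ℝ) → ℝ := fun w => θ₀ w.2 with hθdef
  have hsnd : Tendsto (fun w : ℝ × (Fin n → ℝ) => w.2) (𝓝 0) (𝓝 0) := continuous_snd.tendsto 0
  have hsndO : ∀ k : ℕ, (fun w : ℝ × (Fin n → ℝ) => ‖w.2‖ ^ k) =O[𝓝 0] fun w => ‖w‖ ^ k := fun k =>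
    IsBigO.pow (IsBigO.of_bound 1 (Eventually.of_forall fun w => by
      rw [one_mul, norm_norm, norm_norm]; exact norm_snd_le w)) k
  have hθ : SmoothNear θ 0 := SmoothNear.comp (g := θ₀) hθ₀ (contDiff_snd.smoothNear _)
  have ho : (fun w => θ w - MvPolynomial.eval w.2 ψ) =o[𝓝 0] (fun w => ‖w‖ ^ 2) :=
    (ho₀.comp_tendsto hsnd).trans_isBigO (hsndO 2)
  obtain ⟨hδs, hδo, hδL⟩ := hT.lieDeriv_sub hθ hψ ho
  have hTO := isBigO_of_hasFDerivAt_zero hT.map_zero hT.hasFDerivAt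
  have hid : (fun z : ℝ × SplitSpace n => z) =O[𝓝 0] fun z => ‖z‖ := (isBigO_refl _ _).norm_right
  have hc := circleFn_isBigO hid
  have hL : (fun w : ℝ × (Fin n → ℝ) => lieDeriv f θ₀ w.2 - 2 * β' * MvPolynomial.eval w.2 ψ ^ 2)
      =o[𝓝 0] fun w => ‖w‖ ^ 4 := (hL₀.comp_tendsto hsnd).trans_isBigO (hsndO 4)
  have k1 := (hL.comp_tendsto hT.tendsto).trans_isBigO (hTO.norm_left.pow 4)
  have hev := hT.eval_sub_isLittleO hψ
  have hsum : (fun z => MvPolynomial.eval (T z).2 ψ + circleFn z) =O[𝓝 0] fun z => ‖z‖ ^ 2 :=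
    (hev.isBigO.add (hc.const_mul_left 2)).congr_left fun z => by ring
  have k2 := ((hsum.mul_isLittleO hev).const_mul_left (2 * β')).congr_right
    (g₂ := fun z => ‖z‖ ^ 4) fun z => by ring
  have k3 := hX.lieDeriv_circleFn
  have key := (k1.add k2).sub k3
  have hs : |(0 : ℝ)| ≤ 1 := by simp
  have := hX.eq_zero_of_lieDeriv (s := 0) hs (j := 3) le_rfl (Or.inl rfl) hδs hδo
    (c := 2 * (β' - β)) fun t => by
      refine ((key.comp_tendsto (circlePath_tendsto (t := t) hs)).trans_isBigO
        ((circlePath_isBigO hs).norm_left.pow 4)).congr' ?_ EventuallyEq.rfl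
      filter_upwards [(circlePath_tendsto (t := t) hs).eventually hδL,
        (circlePath_tendsto (t := t) hs).eventually
          (hT.tendsto.eventually hθ.eventually_differentiableAt)] with r hr hd
      simp only [Function.comp] at hr ⊢
      have e1 : (circlePt (n := n) (0 * r) r (t r)).1 = 0 := by simp [circlePt]
      -- T preserves x₀, so it maps these circles into the slice x₀ = 0. Only there do the Lie
      -- derivatives along f and F agree, so the two are exchanged after restriction to the circles.
      have e2 : T (circlePt (0 * r) r (t r)) = (0, (T (circlePt (0 * r) r (t r))).2) :=
        Prod.ext (by rw [hfst, e1]) rfl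
      rw [e2] at hd
      have e3 := lieDeriv_of_fst_eq_zero (hF _) hd
      rw [← e2] at e3
      rw [hr, ← e3, circleFn_circlePt, e1]
      simp only [hθdef]
      ring
  linarith

end uniqueness

/-! ### Homogeneous maps and Taylor polynomials -/

section homogeneousMaps
variable {E G : Type*} [NormedAddCommGroup E] [NormedSpace ℝ E] [NormedAddCommGroup G]
  [NormedSpace ℝ G]

/-- A bound on the compact unit ball scales to all z. At z = 0 with k > 0, f(0) = 2ᵏ f(0) forces
f(0) = 0. -/
lemma isBigO_of_homogeneous [ProperSpace E] {f : E → G} {k : ℕ} (hf : Continuous f)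
    (hom : ∀ (t : ℝ) z, 0 < t → f (t • z) = t ^ k • f z) : f =O[𝓝 0] fun z => ‖z‖ ^ k := by
  obtain ⟨C, hC⟩ := (isCompact_closedBall (0 : E) 1).exists_bound_of_continuousOn
    hf.continuousOn
  refine IsBigO.of_bound C (Eventually.of_forall fun z => ?_)
  have h1 := hC (‖z‖⁻¹ • z) (by
    rw [mem_closedBall_zero_iff, norm_smul, norm_inv, norm_norm]
    exact inv_mul_le_one)
  rcases eq_or_ne z 0 with rfl | hz
  · rcases k.eq_zero_or_pos with rfl | hk
    · simpa using h1
    · have h2 := hom 2 0 two_pos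
      have h3 : ((2 : ℝ) ^ k - 1) • f 0 = 0 := by
        rw [sub_smul, one_smul, ← h2, smul_zero, sub_self]
      have h4 : (2 : ℝ) ^ k - 1 ≠ 0 := by
        have := one_lt_pow₀ (one_lt_two (α := ℝ)) hk.ne'
        linarith
      rw [(smul_eq_zero.1 h3).resolve_left h4]
      simp [hk.ne']
  · have hz' : 0 < ‖z‖ := norm_pos_iff.2 hz
    have h2 := hom ‖z‖ (‖z‖⁻¹ • z) hz'
    rw [smul_inv_smul₀ hz'.ne'] at h2
    rw [h2, norm_smul, mul_comm]
    gcongr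

lemma fderiv_homogeneous {f : E → G} {k : ℕ} (hf : Differentiable ℝ f)
    (hom : ∀ (t : ℝ) z, 0 < t → f (t • z) = t ^ (k + 1) • f z) (t : ℝ) (z : E) (ht : 0 < t) :
    fderiv ℝ f (t • z) = t ^ k • fderiv ℝ f z := by
  have h1 : HasFDerivAt (fun z => f (t • z))
      ((fderiv ℝ f (t • z)).comp (t • ContinuousLinearMap.id ℝ E)) z :=
    (hf (t • z)).hasFDerivAt.comp z ((hasFDerivAt_id z).const_smul t)
  have h2 : HasFDerivAt (fun z => f (t • z)) (t ^ (k + 1) • fderiv ℝ f z) z := by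
    simp only [fun z => hom t z ht]
    exact (hf z).hasFDerivAt.const_smul _
  have h3 := h1.unique h2
  ext w
  have h4 := DFunLike.congr_fun h3 w
  simp only [ContinuousLinearMap.comp_apply, smul_apply,
    ContinuousLinearMap.id_apply, map_smul, pow_succ', mul_smul] at h4
  exact smul_right_injective G ht.ne' h4

end homogeneousMaps

section taylor
variable {σ : Type*}

lemma MvPolynomial.IsHomogeneous.eval_smul {R : Type*} [CommSemiring R] {p : MvPolynomial σ R}
    {k : ℕ} (hp : p.IsHomogeneous k) (t : R) (z : σ → R) :
    MvPolynomial.eval (t • z) p = t ^ k * MvPolynomial.eval z p := by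
  rw [MvPolynomial.eval_eq, MvPolynomial.eval_eq, Finset.mul_sum]
  refine Finset.sum_congr rfl fun m hm => ?_
  have hd : m.degree = k := by
    rw [Finsupp.degree_eq_weight_one]
    exact hp (MvPolynomial.mem_support_iff.1 hm)
  simp only [Pi.smul_apply, smul_eq_mul, mul_pow, Finset.prod_mul_distrib]
  rw [Finset.prod_pow_eq_pow_sum, show ∑ i ∈ m.support, m i = k from hd]
  ring

/-- Radial integration of polynomials. -/
lemma MvPolynomial.exists_radial_primitive (p : MvPolynomial σ ℝ) :
    ∃ q : MvPolynomial σ ℝ, ∀ (z : σ → ℝ) (t : ℝ),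
      HasDerivAt (fun t : ℝ => t * MvPolynomial.eval (t • z) q) (MvPolynomial.eval (t • z) p) t := by
  induction p using MvPolynomial.induction_on' with
  | monomial m c =>
    -- Along the ray through z the monomial is a multiple of tᵈ with d its degree, whose primitive
    -- brings in the factor 1/(d + 1).
    refine ⟨MvPolynomial.monomial m (c / (m.degree + 1)), fun z t => ?_⟩
    have hom : ∀ c : ℝ, (MvPolynomial.monomial m c).IsHomogeneous m.degree := fun c =>
      MvPolynomial.isHomogeneous_monomial c rfl
    simp only [(hom _).eval_smul]
    have := ((hasDerivAt_pow (m.degree + 1) t).mul_const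
      (MvPolynomial.eval z (MvPolynomial.monomial m (c / (m.degree + 1)))))
    refine (this.congr_deriv ?_).congr_of_eventuallyEq (Eventually.of_forall fun s => ?_)
    · simp only [MvPolynomial.eval_monomial, Nat.add_sub_cancel]
      push_cast
      field_simp
    · simp only [pow_succ]; ring
  | add p q hp hq =>
    obtain ⟨p', hp'⟩ := hp
    obtain ⟨q', hq'⟩ := hq
    refine ⟨p' + q', fun z t => ?_⟩
    simp only [map_add, mul_add]
    exact (hp' z t).add (hq' z t)

variable [Fintype σ]

lemma MvPolynomial.contDiff_eval (p : MvPolynomial σ ℝ) :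
    ContDiff ℝ (⊤ : ℕ∞) fun z : σ → ℝ => MvPolynomial.eval z p := by
  induction p using MvPolynomial.induction_on with
  | C a => simpa using contDiff_const
  | add p q hp hq => simpa using hp.add hq
  | mul_X p i hp => simpa using hp.mul (contDiff_apply ℝ ℝ i)

lemma MvPolynomial.IsHomogeneous.eval_isBigO {p : MvPolynomial σ ℝ} {k : ℕ}
    (hp : p.IsHomogeneous k) :
    (fun z : σ → ℝ => MvPolynomial.eval z p) =O[𝓝 0] fun z => ‖z‖ ^ k :=
  isBigO_of_homogeneous (MvPolynomial.contDiff_eval p).continuous fun t z _ => hp.eval_smul t z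

/-- Taylor's theorem in several variables, with Peano remainder. -/
theorem exists_taylor_polynomial [DecidableEq σ] (k : ℕ) {r : (σ → ℝ) → ℝ}
    (hr : ContDiffAt ℝ k r 0) :
    ∃ P : MvPolynomial σ ℝ, (fun z => r z - MvPolynomial.eval z P) =o[𝓝 0] fun z => ‖z‖ ^ k := by
  induction k generalizing r with
  | zero =>
    refine ⟨MvPolynomial.C (r 0), ?_⟩
    simp only [MvPolynomial.eval_C, pow_zero]
    rw [isLittleO_one_iff]
    have := hr.continuousAt.tendsto.sub_const (r 0)
    simpa using this
  | succ k ih =>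
    have hd : ContDiffAt ℝ k (fderiv ℝ r) 0 := hr.fderiv_right (by push_cast; exact le_rfl)
    have hdi : ∀ i, ∃ P : MvPolynomial σ ℝ,
        (fun z => fderiv ℝ r z (Pi.single i 1) - MvPolynomial.eval z P) =o[𝓝 0]
          fun z => ‖z‖ ^ k := fun i => ih (hd.clm_apply contDiffAt_const)
    choose p hp using hdi
    choose q hq using fun i => MvPolynomial.exists_radial_primitive (p i)
    -- The fundamental theorem of calculus on the segment from 0 to z, with each partial derivative
    -- replaced by its Taylor polynomial: q i integrates the one of ∂ᵢr radially.
    refine ⟨MvPolynomial.C (r 0) + ∑ i, MvPolynomial.X i * q i, ?_⟩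
    have hdiff : ∀ᶠ z in 𝓝 (0 : σ → ℝ), DifferentiableAt ℝ r z := by
      filter_upwards [hr.eventually (by simp)] with z hz
      exact hz.differentiableAt (by push_cast; simp)
    rw [isLittleO_iff]
    intro c hc
    -- The |σ| coordinate errors add up to at most c. The +1 covers an empty index type.
    have hc' : 0 < c / (Fintype.card σ + 1) := by positivity
    have hev : ∀ᶠ z in 𝓝 (0 : σ → ℝ), DifferentiableAt ℝ r z ∧ ∀ i,
        ‖fderiv ℝ r z (Pi.single i 1) - MvPolynomial.eval z (p i)‖ ≤
          c / (Fintype.card σ + 1) * ‖‖z‖ ^ k‖ :=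
      hdiff.and (eventually_all.2 fun i => isLittleO_iff.1 (hp i) hc')
    obtain ⟨ε, hε, hball⟩ := Metric.eventually_nhds_iff.1 hev
    filter_upwards [Metric.ball_mem_nhds 0 hε] with z hz
    rw [mem_ball_zero_iff] at hz
    have hmem : ∀ t ∈ Set.Icc (0 : ℝ) 1, ‖t • z‖ ≤ ‖z‖ := fun t ht => by
      rw [norm_smul, Real.norm_of_nonneg ht.1]
      exact mul_le_of_le_one_left (norm_nonneg z) ht.2
    have key := norm_image_sub_le_of_norm_deriv_le_segment_01'
      (f := fun t : ℝ => r (t • z) - ∑ i, z i * (t * MvPolynomial.eval (t • z) (q i)))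
      (f' := fun t => fderiv ℝ r (t • z) z - ∑ i, z i * MvPolynomial.eval (t • z) (p i))
      (C := c * ‖z‖ ^ (k + 1)) (fun t ht => ?_) (fun t ht => ?_)
    · simp only [one_smul, zero_smul, zero_mul, mul_zero, Finset.sum_const_zero, sub_zero,
        one_mul] at key
      simp only [map_add, MvPolynomial.eval_C, map_sum, map_mul, MvPolynomial.eval_X]
      rw [norm_pow, norm_norm]
      rwa [add_comm, ← sub_sub]
    · refine HasDerivAt.hasDerivWithinAt ?_
      have h1 : DifferentiableAt ℝ r (t • z) :=
        (hball (by rw [dist_zero_right]; exact (hmem t ht).trans_lt hz)).1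
      have h2 : HasDerivAt (fun t : ℝ => t • z) z t := by
        simpa using (hasDerivAt_id t).smul_const z
      refine (h1.hasFDerivAt.comp_hasDerivAt t h2).sub ?_
      exact HasDerivAt.fun_sum fun i _ => (hq i z t).const_mul (z i)
    · have ht' : t ∈ Set.Icc (0 : ℝ) 1 := ⟨ht.1, ht.2.le⟩
      have hb := (hball (y := t • z) (by rw [dist_zero_right]; exact (hmem t ht').trans_lt hz)).2
      have hzs : fderiv ℝ r (t • z) z = ∑ i, z i * fderiv ℝ r (t • z) (Pi.single i 1) := by
        conv_lhs => enter [2]; rw [pi_eq_sum_univ' z]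
        simp [map_sum]
      rw [hzs, ← Finset.sum_sub_distrib]
      have hle : ∀ i ∈ Finset.univ, ‖z i * fderiv ℝ r (t • z) (Pi.single i 1) -
          z i * MvPolynomial.eval (t • z) (p i)‖ ≤ ‖z‖ * (c / (Fintype.card σ + 1) * ‖z‖ ^ k) := by
        intro i _
        rw [← mul_sub, norm_mul]
        refine mul_le_mul (norm_le_pi_norm z i) ((hb i).trans ?_) (norm_nonneg _) (norm_nonneg _)
        rw [norm_pow, norm_norm]
        have := hmem t ht'
        gcongr
      refine (norm_sum_le_of_le _ hle).trans ?_
      rw [Finset.sum_const, Finset.card_univ, nsmul_eq_mul]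
      have hcard : (Fintype.card σ : ℝ) / (Fintype.card σ + 1) ≤ 1 := by
        rw [div_le_one (by positivity)]; linarith
      have : (Fintype.card σ : ℝ) * (‖z‖ * (c / (Fintype.card σ + 1) * ‖z‖ ^ k)) =
          (Fintype.card σ : ℝ) / (Fintype.card σ + 1) * (c * ‖z‖ ^ (k + 1)) := by
        rw [pow_succ]; field_simp
      rw [this]
      exact mul_le_of_le_one_left (by positivity) hcard

/-- A function vanishing to order `k - 1` is approximated by a homogeneous polynomial of
degree `k`. -/
theorem exists_homogeneous_approx [DecidableEq σ] {k : ℕ} {r : (σ → ℝ) → ℝ}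
    (hr : ContDiffAt ℝ k r 0) (ho : ∀ j < k, r =o[𝓝 0] fun z => ‖z‖ ^ j) :
    ∃ q : MvPolynomial σ ℝ, q.IsHomogeneous k ∧
      (fun z => r z - MvPolynomial.eval z q) =o[𝓝 0] fun z => ‖z‖ ^ k := by
  obtain ⟨P, hP⟩ := exists_taylor_polynomial k hr
  refine ⟨P.homogeneousComponent k, MvPolynomial.homogeneousComponent_isHomogeneous k P, ?_⟩
  have hsum : ∀ z : σ → ℝ, MvPolynomial.eval z P =
      ∑ j ∈ Finset.range (P.totalDegree + 1), MvPolynomial.eval z (P.homogeneousComponent j) :=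
    fun z => by rw [← map_sum, MvPolynomial.sum_homogeneousComponent]
  have hhom := fun j => MvPolynomial.homogeneousComponent_isHomogeneous j P
  -- By strong induction the lower homogeneous components vanish: once those below degree j are
  -- zero, the j-th is homogeneous of degree j and o(‖z‖ʲ).
  have hlow : ∀ j < k, ∀ z : σ → ℝ, MvPolynomial.eval z (P.homogeneousComponent j) = 0 := by
    intro j
    induction j using Nat.strong_induction_on with
    | _ j ih =>
    intro hj
    refine eq_zero_of_homogeneous_isLittleO (k := j) (fun t z _ => (hhom j).eval_smul t z) ?_
    have h1 : (fun z : σ → ℝ => MvPolynomial.eval z P) =o[𝓝 0] fun z => ‖z‖ ^ j :=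
      ((ho j hj).sub (hP.trans (norm_pow_succ_isLittleO le_rfl hj))).congr_left fun z => by ring
    have h2 : (fun z : σ → ℝ => ∑ i ∈ (Finset.range (P.totalDegree + 1)).erase j,
        MvPolynomial.eval z (P.homogeneousComponent i)) =o[𝓝 0] fun z => ‖z‖ ^ j := by
      refine IsLittleO.fun_sum fun i hi => ?_
      rcases lt_trichotomy i j with h | h | h
      · simp only [ih i h (h.trans hj)]
        exact isLittleO_zero _ _
      · exact absurd h (Finset.ne_of_mem_erase hi)
      · exact (hhom i).eval_isBigO.trans_isLittleO (norm_pow_succ_isLittleO le_rfl h)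
    by_cases hjr : j ∈ Finset.range (P.totalDegree + 1)
    · refine (h1.sub h2).congr_left fun z => ?_
      rw [hsum, ← Finset.add_sum_erase _ _ hjr]; ring
    · have : P.homogeneousComponent j = 0 :=
        MvPolynomial.homogeneousComponent_eq_zero _ _ (by simpa using hjr)
      simp only [this, map_zero]
      exact isLittleO_zero _ _
  have h2 : (fun z : σ → ℝ => ∑ i ∈ (Finset.range (P.totalDegree + 1)).erase k,
      MvPolynomial.eval z (P.homogeneousComponent i)) =o[𝓝 0] fun z => ‖z‖ ^ k := by
    refine IsLittleO.fun_sum fun i hi => ?_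
    rcases lt_trichotomy i k with h | h | h
    · simp only [hlow i h]
      exact isLittleO_zero _ _
    · exact absurd h (Finset.ne_of_mem_erase hi)
    · exact (hhom i).eval_isBigO.trans_isLittleO (norm_pow_succ_isLittleO le_rfl h)
  refine (hP.add h2).congr_left fun z => ?_
  by_cases hjr : k ∈ Finset.range (P.totalDegree + 1)
  · rw [hsum, ← Finset.add_sum_erase _ _ hjr]; ring
  · have : P.homogeneousComponent k = 0 :=
      MvPolynomial.homogeneousComponent_eq_zero _ _ (by simpa using hjr)
    rw [Finset.erase_eq_of_notMem hjr, ← hsum, this, map_zero]; ring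

end taylor

/-! ### Generalized eigenvectors of derivations -/

section derivation
variable {K A : Type*} [Field K] [CommRing A] [Algebra K A]

/-- The endomorphism `D - ν` for a derivation `D`. -/
noncomputable def Derivation.shift (D : Derivation K A A) (ν : K) : Module.End K A :=
  (D : A →ₗ[K] A) - ν • (1 : Module.End K A)

lemma Derivation.shift_apply (D : Derivation K A A) (ν : K) (p : A) :
    D.shift ν p = D p - ν • p := rfl

/-- By Leibniz, (D - ν - μ)(pq) = ((D - ν)p)q + p((D - μ)q). Each application lowers one of the
exponents a, b, so a + b applications suffice. -/
lemma Derivation.shift_pow_mul (D : Derivation K A A) {ν μ : K} (n : ℕ) {a b : ℕ} {p q : A}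
    (hab : a + b ≤ n) (hp : (D.shift ν ^ a) p = 0) (hq : (D.shift μ ^ b) q = 0) :
    (D.shift (ν + μ) ^ n) (p * q) = 0 := by
  induction n generalizing a b p q with
  | zero =>
    obtain rfl : a = 0 := by omega
    have : p = 0 := by simpa using hp
    simp [this]
  | succ n ih =>
    rcases a with _ | a
    · have : p = 0 := by simpa using hp
      simp [this]
    rcases b with _ | b
    · have : q = 0 := by simpa using hq
      simp [this]
    have h1 := ih (a := a) (b := b + 1) (p := D.shift ν p) (q := q) (by omega)
      (by rwa [pow_succ, Module.End.mul_apply] at hp) hq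
    have h2 := ih (a := a + 1) (b := b) (p := p) (q := D.shift μ q) (by omega) hp
      (by rwa [pow_succ, Module.End.mul_apply] at hq)
    have h3 : D.shift (ν + μ) (p * q) = D.shift ν p * q + p * D.shift μ q := by
      simp only [Derivation.shift_apply, Derivation.leibniz, smul_eq_mul, add_smul, sub_mul,
        mul_sub, smul_mul_assoc, mul_smul_comm]
      ring
    rw [pow_succ, Module.End.mul_apply, h3, map_add, h1, h2, add_zero]

/-- `p` is a generalized eigenvector of `D` for `ν`, possibly zero. -/
def Derivation.IsGenEigen (D : Derivation K A A) (ν : K) (p : A) : Prop :=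
  ∃ N : ℕ, (D.shift ν ^ N) p = 0

lemma Derivation.IsGenEigen.mul {D : Derivation K A A} {ν μ : K} {p q : A}
    (hp : D.IsGenEigen ν p) (hq : D.IsGenEigen μ q) : D.IsGenEigen (ν + μ) (p * q) := by
  obtain ⟨a, ha⟩ := hp
  obtain ⟨b, hb⟩ := hq
  exact ⟨a + b, D.shift_pow_mul _ le_rfl ha hb⟩

lemma Derivation.isGenEigen_of_eq {D : Derivation K A A} {ν : K} {p : A} (hp : D p = ν • p) :
    D.IsGenEigen ν p :=
  ⟨1, by rw [pow_one, D.shift_apply, hp, sub_self]⟩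

/-- `D - l` is invertible on generalized eigenvectors for `ν ≠ l`. -/
lemma Derivation.IsGenEigen.exists_solution {D : Derivation K A A} {ν l : K} {v : A}
    (hv : D.IsGenEigen ν v) (hne : ν ≠ l) {W : Submodule K A} (hW : ∀ p ∈ W, D p ∈ W)
    (hvW : v ∈ W) : ∃ u ∈ W, D u - l • u = v := by
  obtain ⟨N, hN⟩ := hv
  induction N generalizing v with
  | zero => exact ⟨0, W.zero_mem, by simpa using hN.symm⟩
  | succ N ih =>
    have hmem : D.shift ν v ∈ W := W.sub_mem (hW v hvW) (W.smul_mem _ hvW)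
    obtain ⟨u, huW, hu⟩ := ih hmem (by rwa [pow_succ, Module.End.mul_apply] at hN)
    -- Write (D - l)v = (D - ν)v + (ν - l)v. By induction u solves (D - l)u = (D - ν)v, so (D - l)(v
    -- - u) = (ν - l)v.
    refine ⟨(ν - l)⁻¹ • (v - u), W.smul_mem _ (W.sub_mem hvW huW), ?_⟩
    have hne' : ν - l ≠ 0 := sub_ne_zero.2 hne
    rw [Derivation.map_smul, smul_comm, ← smul_sub, inv_smul_eq_iff₀ hne', map_sub, smul_sub]
    rw [D.shift_apply] at hu
    have : D v - D u - (l • v - l • u) = D v - l • v - (D u - l • u) := by abel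
    rw [this, hu, sub_smul]
    abel

lemma Derivation.pow_eq_smul {D : Derivation K A A} {ν : K} {p : A} (hp : D p = ν • p) (a : ℕ) :
    D (p ^ a) = (a * ν) • p ^ a := by
  induction a with
  | zero => simp
  | succ a ih =>
    rw [pow_succ, D.leibniz, ih, hp, smul_eq_mul, smul_eq_mul, mul_smul_comm, mul_smul_comm,
      mul_comm p, ← add_smul]
    push_cast
    congr 1; ring

lemma Derivation.mul_eq_smul {D : Derivation K A A} {ν μ : K} {p q : A} (hp : D p = ν • p)
    (hq : D q = μ • q) : D (p * q) = (ν + μ) • (p * q) := by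
  rw [D.leibniz, hp, hq, smul_eq_mul, smul_eq_mul, mul_smul_comm, mul_smul_comm, mul_comm q p,
    ← add_smul, add_comm]

end derivation

/-! ### The linear center-stable vector field on complex polynomials -/

section field
open MvPolynomial
variable {ι : Type*} [Fintype ι] (ω : ℂ) (M : Matrix ι ι ℂ)

/-- The linear vector field `(0, J y', M y'')` on `ℂ × (ℂ² × ℂ^ι)`, where `J = (0, -ω; ω, 0)`. -/
noncomputable def centerStableField :
    Option (Fin 2 ⊕ ι) → MvPolynomial (Option (Fin 2 ⊕ ι)) ℂ
  | none => 0
  | some (Sum.inl i) => if i = 0 then C (-ω) * X (some (Sum.inl 1)) else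
      C ω * X (some (Sum.inl 0))
  | some (Sum.inr j) => ∑ l, C (M j l) * X (some (Sum.inr l))

/-- The Lie derivative of the linear vector field `(0, J y', M y'')`. -/
noncomputable def centerStableLie :
    Derivation ℂ (MvPolynomial (Option (Fin 2 ⊕ ι)) ℂ) (MvPolynomial (Option (Fin 2 ⊕ ι)) ℂ) :=
  mkDerivation ℂ (centerStableField ω M)

lemma isHomogeneous_centerStableField (i : Option (Fin 2 ⊕ ι)) :
    (centerStableField ω M i).IsHomogeneous 1 := by
  have h : ∀ (c : ℂ) (i : Option (Fin 2 ⊕ ι)), (C c * X i).IsHomogeneous 1 := fun c i => by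
    simpa using (isHomogeneous_C _ c).mul (isHomogeneous_X ℂ i)
  rcases i with _ | i | j
  · exact isHomogeneous_zero _ _ _
  · simp only [centerStableField]
    split_ifs
    exacts [h _ _, h _ _]
  · exact IsHomogeneous.sum _ _ _ fun l _ => h _ _

lemma centerStableLie_mem {k : ℕ} (p : MvPolynomial (Option (Fin 2 ⊕ ι)) ℂ)
    (hp : p ∈ homogeneousSubmodule (Option (Fin 2 ⊕ ι)) ℂ (k + 1)) :
    centerStableLie ω M p ∈ homogeneousSubmodule (Option (Fin 2 ⊕ ι)) ℂ (k + 1) := by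
  classical
  rw [mem_homogeneousSubmodule] at hp ⊢
  rw [centerStableLie, mkDerivation_eq_sum_pderiv]
  exact IsHomogeneous.sum _ _ _ fun i _ =>
    (hp.pderiv (i := i)).mul (isHomogeneous_centerStableField ω M i)

/-- The parameter. -/
noncomputable def paramVar (ι : Type*) : MvPolynomial (Option (Fin 2 ⊕ ι)) ℂ := X none

/-- The complex coordinate `ζ = y₁ + i y₂`. -/
noncomputable def zetaVar (ι : Type*) : MvPolynomial (Option (Fin 2 ⊕ ι)) ℂ :=
  X (some (Sum.inl 0)) + C Complex.I * X (some (Sum.inl 1))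

/-- The conjugate coordinate `y₁ - i y₂`. -/
noncomputable def zetaBarVar (ι : Type*) : MvPolynomial (Option (Fin 2 ⊕ ι)) ℂ :=
  X (some (Sum.inl 0)) - C Complex.I * X (some (Sum.inl 1))

lemma C_I_mul_C_I {σ : Type*} : (C Complex.I : MvPolynomial σ ℂ) * C Complex.I = -1 := by
  rw [← C_mul, Complex.I_mul_I, C_neg, C_1]

lemma centerStableLie_paramVar : centerStableLie ω M (paramVar ι) = (0 : ℂ) • paramVar ι := by
  simp [centerStableLie, paramVar, centerStableField]

lemma centerStableLie_zetaVar :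
    centerStableLie ω M (zetaVar ι) = (Complex.I * ω) • zetaVar ι := by
  simp only [centerStableLie, zetaVar, map_add, mkDerivation_X, Derivation.leibniz,
    derivation_C, centerStableField, smul_eq_C_mul, smul_eq_mul, C_mul, C_neg]
  simp
  linear_combination (-C ω * X (some (Sum.inl 1))) * (C_I_mul_C_I (σ := Option (Fin 2 ⊕ ι)))

lemma centerStableLie_zetaBarVar :
    centerStableLie ω M (zetaBarVar ι) = (-(Complex.I * ω)) • zetaBarVar ι := by
  simp only [centerStableLie, zetaBarVar, map_sub, mkDerivation_X, Derivation.leibniz,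
    derivation_C, centerStableField, smul_eq_C_mul, smul_eq_mul, C_mul, C_neg]
  simp
  linear_combination (-C ω * X (some (Sum.inl 1))) * (C_I_mul_C_I (σ := Option (Fin 2 ⊕ ι)))

/-- A homogeneous generalized eigenvector, for an eigenvalue with negative real part, vanishing on
the center space. -/
def IsStablePart (k : ℕ) (s : MvPolynomial (Option (Fin 2 ⊕ ι)) ℂ) : Prop :=
  s.IsHomogeneous k ∧ (∀ w : Option (Fin 2 ⊕ ι) → ℂ, (∀ i, w (some (Sum.inr i)) = 0) →
    eval w s = 0) ∧ ∃ ν : ℂ, ν.re < 0 ∧ (centerStableLie ω M).IsGenEigen ν s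

/-- Products of generalized eigenvectors of degree one. -/
def eigenProducts (k : ℕ) : Set (MvPolynomial (Option (Fin 2 ⊕ ι)) ℂ) :=
  {p | ∃ (a b c d : ℕ) (s : MvPolynomial (Option (Fin 2 ⊕ ι)) ℂ),
    p = paramVar ι ^ a * zetaVar ι ^ b * zetaBarVar ι ^ c * s ∧ a + b + c + d = k ∧
    ((d = 0 ∧ s = 1) ∨ IsStablePart ω M d s)}

variable {ω M}

lemma IsStablePart.mul {j k : ℕ} {s t : MvPolynomial (Option (Fin 2 ⊕ ι)) ℂ}
    (hs : IsStablePart ω M j s) (ht : IsStablePart ω M k t) : IsStablePart ω M (j + k) (s * t) := by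
  obtain ⟨h1, h2, ν, h3, h4⟩ := hs
  obtain ⟨h1', -, ν', h3', h4'⟩ := ht
  exact ⟨h1.mul h1', fun w hw => by rw [map_mul, h2 w hw, zero_mul], ν + ν',
    by rw [Complex.add_re]; linarith, h4.mul h4'⟩

/-- A linear form in the stable variables. -/
noncomputable def stableForm (ι : Type*) [Fintype ι] :
    (ι → ℂ) →ₗ[ℂ] MvPolynomial (Option (Fin 2 ⊕ ι)) ℂ :=
  Fintype.linearCombination ℂ fun j => X (some (Sum.inr j))

lemma stableForm_apply (c : ι → ℂ) :
    stableForm ι c = ∑ j, c j • (X (some (Sum.inr j)) : MvPolynomial (Option (Fin 2 ⊕ ι)) ℂ) :=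
  Fintype.linearCombination_apply ..

variable [DecidableEq ι]

lemma centerStableLie_stableForm (c : ι → ℂ) :
    centerStableLie ω M (stableForm ι c) = stableForm ι (Matrix.toLin' M.transpose c) := by
  simp only [stableForm_apply, map_sum, Derivation.map_smul, centerStableLie, mkDerivation_X,
    centerStableField, Matrix.toLin'_apply, Matrix.mulVec, dotProduct, Matrix.transpose_apply,
    Finset.sum_smul, Finset.smul_sum]
  rw [Finset.sum_comm]
  refine Finset.sum_congr rfl fun i _ => Finset.sum_congr rfl fun j _ => ?_
  simp only [smul_eq_C_mul, C_mul]
  ring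

lemma shift_pow_stableForm (ν : ℂ) (N : ℕ) (c : ι → ℂ) :
    ((centerStableLie ω M).shift ν ^ N) (stableForm ι c) =
      stableForm ι (((Matrix.toLin' M.transpose - ν • 1) ^ N) c) := by
  induction N generalizing c with
  | zero => simp
  | succ N ih =>
    rw [pow_succ, Module.End.mul_apply, pow_succ, Module.End.mul_apply, ← ih,
      Derivation.shift_apply, centerStableLie_stableForm]
    congr 1
    simp

/-- On linear forms in the stable variables the derivation acts through Mᵀ, and over ℂ the space is
the sum of its generalized eigenspaces. The eigenvalues are those of M. -/
lemma stableForm_mem_span (hM : ∀ z : ℂ, M.charpoly.IsRoot z → z.re < 0) (c : ι → ℂ) :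
    stableForm ι c ∈ Submodule.span ℂ {s | IsStablePart ω M 1 s} := by
  have key : (⨆ μ : ℂ, Module.End.maxGenEigenspace (Matrix.toLin' M.transpose) μ) ≤
      (Submodule.span ℂ {s | IsStablePart ω M 1 s}).comap (stableForm ι) := by
    refine iSup_le fun μ c hc => ?_
    rw [Submodule.mem_comap]
    rcases eq_or_ne c 0 with rfl | hc0
    · simp
    refine Submodule.subset_span ⟨?_, fun w hw => ?_, μ, ?_, ?_⟩
    · rw [stableForm_apply]
      refine IsHomogeneous.sum _ _ _ fun j _ => ?_
      rw [smul_eq_C_mul]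
      simpa using (isHomogeneous_C _ (c j)).mul (isHomogeneous_X ℂ (some (Sum.inr j)))
    · simp [stableForm_apply, hw]
    · have h1 : Module.End.HasUnifEigenvalue (Matrix.toLin' M.transpose) μ ⊤ := by
        rw [Module.End.HasUnifEigenvalue, Submodule.ne_bot_iff]
        exact ⟨c, hc, hc0⟩
      have h2 := (Module.End.hasEigenvalue_iff_isRoot_charpoly _ _).1 (h1.lt zero_lt_one)
      rw [Matrix.charpoly_toLin', Matrix.charpoly_transpose] at h2
      exact hM μ h2
    · obtain ⟨N, hN⟩ := (Module.End.mem_maxGenEigenspace _ _ _).1 hc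
      exact ⟨N, by rw [shift_pow_stableForm, hN, map_zero]⟩
  rw [Module.End.iSup_maxGenEigenspace_eq_top] at key
  exact key Submodule.mem_top

/-- Homogeneous polynomials are spanned by products of generalized eigenvectors. -/
lemma homogeneousSubmodule_le_span (hM : ∀ z : ℂ, M.charpoly.IsRoot z → z.re < 0) (k : ℕ) :
    homogeneousSubmodule (Option (Fin 2 ⊕ ι)) ℂ k ≤ Submodule.span ℂ (eigenProducts ω M k) := by
  set G : Set (MvPolynomial (Option (Fin 2 ⊕ ι)) ℂ) :=
    {paramVar ι, zetaVar ι, zetaBarVar ι} ∪ {s | IsStablePart ω M 1 s} with hG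
  have h1 : homogeneousSubmodule (Option (Fin 2 ⊕ ι)) ℂ 1 ≤ Submodule.span ℂ G := by
    rw [homogeneousSubmodule_one_eq_span_X, Submodule.span_le]
    have hz : zetaVar ι ∈ Submodule.span ℂ G := Submodule.subset_span (by simp [hG])
    have hzb : zetaBarVar ι ∈ Submodule.span ℂ G := Submodule.subset_span (by simp [hG])
    rintro _ ⟨i, rfl⟩
    rcases i with _ | i | j
    · exact Submodule.subset_span (by simp [hG, paramVar])
    · fin_cases i
      · have : (X (some (Sum.inl 0)) : MvPolynomial (Option (Fin 2 ⊕ ι)) ℂ) =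
            (1 / 2 : ℂ) • (zetaVar ι + zetaBarVar ι) := by
          rw [zetaVar, zetaBarVar, smul_eq_C_mul]
          have h2 : (C (1 / 2) * 2 : MvPolynomial (Option (Fin 2 ⊕ ι)) ℂ) = 1 := by
            rw [← map_ofNat C 2, ← C_mul]; norm_num
          linear_combination -X (some (Sum.inl 0)) * h2
        simp only [Fin.zero_eta, SetLike.mem_coe]
        rw [this]
        exact Submodule.smul_mem _ _ (Submodule.add_mem _ hz hzb)
      · have : (X (some (Sum.inl 1)) : MvPolynomial (Option (Fin 2 ⊕ ι)) ℂ) =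
            (-(Complex.I / 2) : ℂ) • (zetaVar ι - zetaBarVar ι) := by
          rw [zetaVar, zetaBarVar, smul_eq_C_mul]
          have h2 : (C (-(Complex.I / 2)) * (2 * C Complex.I) :
              MvPolynomial (Option (Fin 2 ⊕ ι)) ℂ) = 1 := by
            rw [← map_ofNat C 2, ← C_mul, ← C_mul]
            have : -(Complex.I / 2) * (2 * Complex.I) = 1 := by
              linear_combination -Complex.I_mul_I
            rw [this, C_1]
          linear_combination -X (some (Sum.inl 1)) * h2
        simp only [Fin.mk_one, SetLike.mem_coe]
        rw [this]
        exact Submodule.smul_mem _ _ (Submodule.sub_mem _ hz hzb)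
    · have := stableForm_mem_span (ω := ω) hM (Pi.single j 1)
      rw [stableForm_apply] at this
      simp only [Pi.single_apply, ite_smul, one_smul, zero_smul, Finset.sum_ite_eq',
        Finset.mem_univ, if_true] at this
      exact Submodule.span_mono Set.subset_union_right this
  induction k with
  | zero =>
    rw [homogeneousSubmodule_zero, Submodule.one_eq_span, Submodule.span_le]
    rintro _ rfl
    exact Submodule.subset_span ⟨0, 0, 0, 0, 1, by simp, rfl, Or.inl ⟨rfl, rfl⟩⟩
  | succ k ih =>
    -- Degree k + 1 is degree one times degree k. A new stable form is absorbed into s, and the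
    -- other generators raise an exponent.
    rw [← homogeneousSubmodule_one_pow, pow_succ', homogeneousSubmodule_one_pow]
    refine (mul_le_mul' h1 ih).trans ?_
    rw [Submodule.span_mul_span]
    refine Submodule.span_mono ?_
    rintro _ ⟨g, hg, _, ⟨a, b, c, d, s, rfl, hk, hs⟩, rfl⟩
    rcases hg with (rfl | rfl | rfl) | hg
    · exact ⟨a + 1, b, c, d, s, by ring, by omega, hs⟩
    · exact ⟨a, b + 1, c, d, s, by ring, by omega, hs⟩
    · exact ⟨a, b, c + 1, d, s, by ring, by omega, hs⟩
    · refine ⟨a, b, c, d + 1, s * g, by ring, by omega, Or.inr ?_⟩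
      rcases hs with ⟨rfl, rfl⟩ | hs
      · simpa using hg
      · exact hs.mul hg

end field

/-! ### The homological equation -/

section homological
open MvPolynomial
variable {ι : Type*} [Fintype ι] {ω : ℝ} {M : Matrix ι ι ℂ}

lemma isHomogeneous_zetaVar (ι : Type*) : (zetaVar ι).IsHomogeneous 1 :=
  (isHomogeneous_X ℂ _).add
    (by simpa using (isHomogeneous_C _ Complex.I).mul (isHomogeneous_X ℂ (some (Sum.inl 1))))

lemma isHomogeneous_zetaBarVar (ι : Type*) : (zetaBarVar ι).IsHomogeneous 1 :=
  (isHomogeneous_X ℂ _).sub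
    (by simpa using (isHomogeneous_C _ Complex.I).mul (isHomogeneous_X ℂ (some (Sum.inl 1))))

lemma isHomogeneous_centerMonomial (ι : Type*) (a b c : ℕ) :
    (paramVar ι ^ a * zetaVar ι ^ b * zetaBarVar ι ^ c).IsHomogeneous (a + b + c) := by
  have h1 := (isHomogeneous_X ℂ (none : Option (Fin 2 ⊕ ι))).pow a
  have h2 := (isHomogeneous_zetaVar ι).pow b
  have h3 := (isHomogeneous_zetaBarVar ι).pow c
  rw [one_mul] at h1 h2 h3
  exact (h1.mul h2).mul h3

lemma centerStableLie_centerMonomial (a b c : ℕ) :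
    centerStableLie (ω : ℂ) M (paramVar ι ^ a * zetaVar ι ^ b * zetaBarVar ι ^ c) =
      (((b : ℂ) - c) * (Complex.I * ω)) • (paramVar ι ^ a * zetaVar ι ^ b * zetaBarVar ι ^ c) := by
  have := Derivation.mul_eq_smul (Derivation.mul_eq_smul
    (Derivation.pow_eq_smul (centerStableLie_paramVar (ω : ℂ) M) a)
    (Derivation.pow_eq_smul (centerStableLie_zetaVar (ω : ℂ) M) b))
    (Derivation.pow_eq_smul (centerStableLie_zetaBarVar (ω : ℂ) M) c)
  rw [this]
  congr 1; ring

lemma eigenProducts_isHomogeneous {k : ℕ} {p : MvPolynomial (Option (Fin 2 ⊕ ι)) ℂ}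
    (hp : p ∈ eigenProducts (ω : ℂ) M k) : p.IsHomogeneous k := by
  obtain ⟨a, b, c, d, s, rfl, rfl, hs⟩ := hp
  refine (isHomogeneous_centerMonomial ι a b c).mul ?_
  rcases hs with ⟨rfl, rfl⟩ | hs
  exacts [isHomogeneous_one _ _, hs.1]

/-- Solvability of the homological equation in the stable directions, on the center space. -/
def StableSolvable (ω : ℝ) (M : Matrix ι ι ℂ) (k : ℕ)
    (q : ι → MvPolynomial (Option (Fin 2 ⊕ ι)) ℂ) : Prop :=
  ∃ p : ι → MvPolynomial (Option (Fin 2 ⊕ ι)) ℂ, (∀ j, (p j).IsHomogeneous k) ∧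
    ∀ (j : ι) (w : Option (Fin 2 ⊕ ι) → ℂ), (∀ i, w (some (Sum.inr i)) = 0) →
      eval w (q j + ∑ l, M j l • p l - centerStableLie (ω : ℂ) M (p j)) = 0

variable [DecidableEq ι]

/-- The homological equation in the center directions. -/
theorem exists_center_solution (hω : ω ≠ 0) (hM : ∀ z : ℂ, M.charpoly.IsRoot z → z.re < 0) {k : ℕ}
    {q : MvPolynomial (Option (Fin 2 ⊕ ι)) ℂ} (hq : q.IsHomogeneous (k + 1)) :
    ∃ p : MvPolynomial (Option (Fin 2 ⊕ ι)) ℂ, p.IsHomogeneous (k + 1) ∧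
      q + (Complex.I * ω) • p - centerStableLie (ω : ℂ) M p ∈ Submodule.span ℂ
        {m | ∃ a c : ℕ, a + 2 * c = k ∧
          m = paramVar ι ^ a * zetaVar ι ^ (c + 1) * zetaBarVar ι ^ c} := by
  have hq' := homogeneousSubmodule_le_span (ω := (ω : ℂ)) hM (k + 1)
    ((mem_homogeneousSubmodule _ _).2 hq)
  clear hq
  induction hq' using Submodule.span_induction with
  | mem x hx =>
    have hxh := eigenProducts_isHomogeneous hx
    obtain ⟨a, b, c, d, s, rfl, hk, hs⟩ := hx
    -- The eigenvalue of the product is (b - c)iω plus that of s. It equals iω only for b = c + 1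
    -- without stable factor: a stable factor makes the real part negative.
    have hgen : (∃ ν : ℂ, ν ≠ Complex.I * ω ∧ (centerStableLie (ω : ℂ) M).IsGenEigen ν
        (paramVar ι ^ a * zetaVar ι ^ b * zetaBarVar ι ^ c * s)) ∨
        (b = c + 1 ∧ d = 0 ∧ s = 1) := by
      have h1 := Derivation.isGenEigen_of_eq
        (centerStableLie_centerMonomial (ω := ω) (M := M) a b c)
      rcases hs with ⟨rfl, rfl⟩ | ⟨-, -, ν, hν, hs⟩
      · by_cases hbc : b = c + 1
        · exact Or.inr ⟨hbc, rfl, rfl⟩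
        · refine Or.inl ⟨_, ?_, by rwa [mul_one]⟩
          intro h
          have hω' : Complex.I * (ω : ℂ) ≠ 0 :=
            mul_ne_zero Complex.I_ne_zero (Complex.ofReal_ne_zero.2 hω)
          have h2 : (b : ℂ) - c = 1 := mul_right_cancel₀ hω' (by rw [h, one_mul])
          apply hbc
          have : (b : ℂ) = ((c + 1 : ℕ) : ℂ) := by push_cast; linear_combination h2
          exact_mod_cast this
      · refine Or.inl ⟨_, ?_, h1.mul hs⟩
        intro h
        have h3 := congrArg Complex.re h
        simp at h3
        linarith
    rcases hgen with ⟨ν, hne, hν⟩ | ⟨rfl, rfl, rfl⟩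
    · obtain ⟨u, hu, hu'⟩ := hν.exists_solution hne (centerStableLie_mem (ω : ℂ) M)
        ((mem_homogeneousSubmodule _ _).2 hxh)
      refine ⟨u, (mem_homogeneousSubmodule _ _).1 hu, ?_⟩
      rw [← hu']
      convert Submodule.zero_mem _ using 1
      abel
    · refine ⟨0, isHomogeneous_zero _ _ _, ?_⟩
      rw [smul_zero, map_zero, add_zero, sub_zero, mul_one]
      exact Submodule.subset_span ⟨a, c, by omega, rfl⟩
  | zero => exact ⟨0, isHomogeneous_zero _ _ _, by simp⟩
  | add x y _ _ hx hy =>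
    obtain ⟨p, hp, hp'⟩ := hx
    obtain ⟨p', hp₁, hp₁'⟩ := hy
    refine ⟨p + p', hp.add hp₁, ?_⟩
    convert Submodule.add_mem _ hp' hp₁' using 1
    rw [smul_add, map_add]
    abel
  | smul t x _ hx =>
    obtain ⟨p, hp, hp'⟩ := hx
    refine ⟨t • p, (homogeneousSubmodule _ ℂ _).smul_mem t hp, ?_⟩
    convert Submodule.smul_mem _ t hp' using 1
    rw [Derivation.map_smul, smul_comm, smul_sub, smul_add]

/-- The homological equation in the stable directions, on the center space. -/
theorem exists_stable_solution (hM : ∀ z : ℂ, M.charpoly.IsRoot z → z.re < 0) {k : ℕ}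
    {q : ι → MvPolynomial (Option (Fin 2 ⊕ ι)) ℂ} (hq : ∀ j, (q j).IsHomogeneous k) :
    StableSolvable ω M k q := by
  have hadd : ∀ x y : ι → MvPolynomial (Option (Fin 2 ⊕ ι)) ℂ,
      StableSolvable ω M k x → StableSolvable ω M k y → StableSolvable ω M k (x + y) := by
    rintro x y ⟨p, hp, hp'⟩ ⟨p', hp₁, hp₁'⟩
    refine ⟨p + p', fun j => (hp j).add (hp₁ j), fun j w hw => ?_⟩
    have h1 := hp' j w hw
    have h2 := hp₁' j w hw
    simp only [map_add, map_sub, Pi.add_apply, smul_add, Finset.sum_add_distrib] at h1 h2 ⊢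
    linear_combination h1 + h2
  have hzero : StableSolvable ω M k (0 : ι → MvPolynomial (Option (Fin 2 ⊕ ι)) ℂ) :=
    ⟨0, fun j => isHomogeneous_zero _ _ _, by simp⟩
  rw [← Finset.univ_sum_single q]
  refine Finset.sum_induction _ _ hadd hzero fun j₀ _ => ?_
  have hq' := homogeneousSubmodule_le_span (ω := (ω : ℂ)) hM k
    ((mem_homogeneousSubmodule _ _).2 (hq j₀))
  generalize q j₀ = x at hq'
  induction hq' using Submodule.span_induction with
  | zero => simpa using hzero
  | add x y _ _ hx hy => rw [Pi.single_add]; exact hadd _ _ hx hy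
  | smul t x _ hx =>
    obtain ⟨p, hp, hp'⟩ := hx
    refine ⟨t • p, fun j => (homogeneousSubmodule _ ℂ _).smul_mem t (hp j), fun j w hw => ?_⟩
    have h1 := hp' j w hw
    have h2 : (Pi.single j₀ (t • x) : ι → MvPolynomial (Option (Fin 2 ⊕ ι)) ℂ) j +
        ∑ l, M j l • (t • p) l - centerStableLie (ω : ℂ) M ((t • p) j) =
        t • ((Pi.single j₀ x : ι → MvPolynomial (Option (Fin 2 ⊕ ι)) ℂ) j +
        ∑ l, M j l • p l - centerStableLie (ω : ℂ) M (p j)) := by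
      simp only [Pi.smul_apply, Derivation.map_smul, smul_sub, smul_add, Finset.smul_sum,
        smul_comm t, Pi.single_smul]
    rw [h2, smul_eval, h1, mul_zero]
  | mem x hx =>
    have hxh := eigenProducts_isHomogeneous hx
    obtain ⟨a, b, c, d, s, rfl, hk, hs⟩ := hx
    rcases hs with ⟨rfl, rfl⟩ | hs
    · rw [mul_one] at hxh ⊢
      set m := paramVar ι ^ a * zetaVar ι ^ b * zetaBarVar ι ^ c with hm
      have hD := centerStableLie_centerMonomial (ω := ω) (M := M) a b c
      rw [← hm] at hD
      set l : ℂ := ((b : ℂ) - c) * (Complex.I * ω) with hl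
      have hre : l.re = 0 := by simp [hl]
      -- For a pure center monomial the eigenvalue l is imaginary and hence no eigenvalue of M. The
      -- equation then reduces to (l - M)w₀ = e, with e the basis vector of index j₀.
      have hdet : IsUnit (Matrix.scalar ι l - M).det := by
        rw [← Matrix.eval_charpoly, isUnit_iff_ne_zero]
        intro h0
        have := hM l h0
        linarith
      obtain ⟨w₀, hw₀⟩ : ∃ w₀ : ι → ℂ, (Matrix.scalar ι l - M).mulVec w₀ = Pi.single j₀ 1 :=
        ⟨(Matrix.scalar ι l - M)⁻¹.mulVec (Pi.single j₀ 1), by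
          rw [Matrix.mulVec_mulVec, Matrix.mul_nonsing_inv _ hdet, Matrix.one_mulVec]⟩
      refine ⟨fun j => w₀ j • m, fun j => (homogeneousSubmodule _ ℂ _).smul_mem _ hxh,
        fun j w _ => ?_⟩
      have h3 := congrFun hw₀ j
      rw [Matrix.sub_mulVec, Pi.sub_apply] at h3
      rw [Matrix.scalar_apply, Matrix.mulVec_diagonal, Matrix.mulVec, dotProduct] at h3
      have h4 : eval w ((Pi.single j₀ m : ι → MvPolynomial (Option (Fin 2 ⊕ ι)) ℂ) j) =
          (Pi.single j₀ 1 : ι → ℂ) j * eval w m := by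
        rcases eq_or_ne j j₀ with rfl | h <;> simp [*]
      simp only [map_add, map_sub, map_sum, h4, Derivation.map_smul, hD, smul_eval]
      rw [← h3, sub_mul, Finset.sum_mul]
      simp only [mul_assoc]
      rw [← sub_eq_zero]
      ring
    -- A product with a stable factor vanishes on the center space, where alone the equation is
    -- required, so nothing needs to be removed.
    · refine ⟨0, fun j => isHomogeneous_zero _ _ _, fun j w hw => ?_⟩
      have h5 : eval w (paramVar ι ^ a * zetaVar ι ^ b * zetaBarVar ι ^ c * s) = 0 := by
        rw [map_mul, hs.2.1 w hw, mul_zero]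
      rcases eq_or_ne j j₀ with rfl | h
      · simpa using h5
      · simp [h]

end homological

/-! ### From complex polynomials to real maps -/

section evaluation
open MvPolynomial
variable {σ : Type*} {E : Type*} [NormedAddCommGroup E] [NormedSpace ℝ E]

lemma hasFDerivAt_eval_comp [Fintype σ] [DecidableEq σ] (L : E →L[ℝ] (σ → ℂ)) (P : MvPolynomial σ ℂ) (z : E) :
    HasFDerivAt (fun z => eval (L z) P)
      (∑ i, eval (L z) (pderiv i P) •
        (ContinuousLinearMap.proj (R := ℝ) (φ := fun _ : σ => ℂ) i).comp L) z := by
  induction P using MvPolynomial.induction_on with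
  | C a =>
    simp only [eval_C]
    exact (hasFDerivAt_const (𝕜 := ℝ) a z).congr_fderiv (by ext w; simp)
  | add p q hp hq =>
    simp only [map_add]
    refine (hp.add hq).congr_fderiv ?_
    ext w
    simp [add_mul, Finset.sum_add_distrib]
  | mul_X p i hp =>
    simp only [map_mul, eval_X]
    have h1 : HasFDerivAt (fun z => L z i) 
        ((ContinuousLinearMap.proj (R := ℝ) (φ := fun _ : σ => ℂ) i).comp L) z :=
      ((ContinuousLinearMap.proj (R := ℝ) (φ := fun _ : σ => ℂ) i).comp L).hasFDerivAt
    refine (hp.mul h1).congr_fderiv ?_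
    ext w
    simp only [Derivation.leibniz, pderiv_X, smul_eq_mul, map_add, map_mul, eval_X]
    simp [Pi.single_apply, Finset.mul_sum, mul_assoc, add_mul, Finset.sum_add_distrib]

lemma contDiff_eval_comp (L : E →L[ℝ] (σ → ℂ)) (P : MvPolynomial σ ℂ) :
    ContDiff ℝ (⊤ : ℕ∞) fun z => eval (L z) P := by
  induction P using MvPolynomial.induction_on with
  | C a => simpa using contDiff_const
  | add p q hp hq => simpa using hp.add hq
  | mul_X p i hp =>
    simpa using hp.mul
      ((ContinuousLinearMap.proj (R := ℝ) (φ := fun _ : σ => ℂ) i).comp L).contDiff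

lemma eval_comp_smul (L : E →L[ℝ] (σ → ℂ)) {P : MvPolynomial σ ℂ} {k : ℕ} (hP : P.IsHomogeneous k)
    (t : ℝ) (z : E) : eval (L (t • z)) P = t ^ k • eval (L z) P := by
  rw [map_smul, ← Complex.coe_smul, hP.eval_smul, ← Complex.coe_smul, smul_eq_mul]
  push_cast
  rfl

lemma eval_ofReal_map (x : σ → ℝ) (q : MvPolynomial σ ℝ) :
    eval (fun i => (x i : ℂ)) (map Complex.ofRealHom q) = (eval x q : ℝ) := by
  induction q using MvPolynomial.induction_on with
  | C a => simp
  | add p q hp hq => simp [hp, hq]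
  | mul_X p i hp => simp [hp]

end evaluation

section coordinates
open MvPolynomial
variable {n : ℕ}

/-- The coordinates on `ℝ × ℝ^n`. -/
def fullCoord : Option (Fin 2 ⊕ Fin (n - 2)) → (ℝ × SplitSpace n →L[ℝ] ℝ)
  | none => ContinuousLinearMap.fst ℝ ℝ (SplitSpace n)
  | some i => coordCLM i

/-- The coordinate vector, as a complex vector. -/
noncomputable def complexCoord : ℝ × SplitSpace n →L[ℝ] (Option (Fin 2 ⊕ Fin (n - 2)) → ℂ) :=
  ContinuousLinearMap.pi fun i => Complex.ofRealCLM.comp (fullCoord i)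

lemma complexCoord_apply (z : ℝ × SplitSpace n) (i : Option (Fin 2 ⊕ Fin (n - 2))) :
    complexCoord z i = (fullCoord i z : ℝ) := rfl

/-- The approximating polynomial has complex coefficients but is real at real points, so two
components can be joined as q₁ + iq₂ and separated again. -/
lemma exists_homogeneous_approx_coord {k : ℕ} {r : ℝ × SplitSpace n → ℝ}
    (hr : ContDiffAt ℝ k r 0) (ho : ∀ j < k, r =o[𝓝 0] fun z => ‖z‖ ^ j) :
    ∃ q : MvPolynomial (Option (Fin 2 ⊕ Fin (n - 2))) ℂ, q.IsHomogeneous k ∧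
      (∀ z, (eval (complexCoord z) q).im = 0) ∧
      (fun z => r z - (eval (complexCoord z) q).re) =o[𝓝 0] fun z => ‖z‖ ^ k := by
  set g : (Option (Fin 2 ⊕ Fin (n - 2)) → ℝ) →L[ℝ] ℝ × SplitSpace n :=
    (ContinuousLinearMap.proj none).prod
      (ContinuousLinearMap.pi fun i => ContinuousLinearMap.proj (some i)) with hg
  set e : ℝ × SplitSpace n →L[ℝ] (Option (Fin 2 ⊕ Fin (n - 2)) → ℝ) :=
    ContinuousLinearMap.pi fullCoord with he
  have hge : ∀ z, g (e z) = z := fun z => rfl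
  have hg0 : Tendsto g (𝓝 0) (𝓝 0) := by simpa using g.continuous.tendsto 0
  have he0 : Tendsto e (𝓝 0) (𝓝 0) := by simpa using e.continuous.tendsto 0
  obtain ⟨q, hq, hq'⟩ := exists_homogeneous_approx (k := k) (r := r ∘ g)
    (ContDiffAt.comp 0 (by rwa [map_zero]) g.contDiff.contDiffAt) (fun j hj =>
      ((ho j hj).comp_tendsto hg0).trans_isBigO (((g.isBigO_id (𝓝 0)).norm_left.norm_right).pow j))
  have hev : ∀ z, eval (complexCoord z) (map Complex.ofRealHom q) = (eval (e z) q : ℝ) := fun z =>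
    eval_ofReal_map (e z) q
  refine ⟨map Complex.ofRealHom q, hq.map _, fun z => ?_, ?_⟩
  · rw [hev, Complex.ofReal_im]
  · simp only [hev, Complex.ofReal_re]
    exact (hq'.comp_tendsto he0).trans_isBigO (((e.isBigO_id (𝓝 0)).norm_left.norm_right).pow k)

/-- The block diagonal linear map with blocks `(0, -ω; ω, 0)` and `M`. -/
noncomputable def blockCLM (ω : ℝ) (M : Matrix (Fin (n - 2)) (Fin (n - 2)) ℝ) :
    SplitSpace n →L[ℝ] SplitSpace n :=
  LinearMap.toContinuousLinearMap (Matrix.toLin' (Matrix.fromBlocks !![0, -ω; ω, 0] 0 0 M))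

variable {ω : ℝ} {M : Matrix (Fin (n - 2)) (Fin (n - 2)) ℝ}

lemma blockCLM_inl_zero (y : SplitSpace n) : blockCLM ω M y (Sum.inl 0) = -ω * crd2 y := by
  simp [blockCLM, Matrix.mulVec, dotProduct, Matrix.fromBlocks, crd2]

lemma blockCLM_inl_one (y : SplitSpace n) : blockCLM ω M y (Sum.inl 1) = ω * crd1 y := by
  simp [blockCLM, Matrix.mulVec, dotProduct, Matrix.fromBlocks, crd1]

lemma blockCLM_inr (y : SplitSpace n) (j : Fin (n - 2)) :
    blockCLM ω M y (Sum.inr j) = ∑ l, M j l * y (Sum.inr l) := by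
  simp [blockCLM, Matrix.mulVec, dotProduct, Matrix.fromBlocks]

lemma complexCoord_block (z : ℝ × SplitSpace n) (i : Option (Fin 2 ⊕ Fin (n - 2))) :
    complexCoord ((0 : ℝ), blockCLM ω M z.2) i =
      eval (complexCoord z) (centerStableField (ω : ℂ) (M.map (algebraMap ℝ ℂ)) i) := by
  rw [complexCoord_apply]
  rcases i with _ | i | j
  · simp [fullCoord, centerStableField]
  · fin_cases i
    · simp [fullCoord, centerStableField, coordCLM_apply, blockCLM_inl_zero, complexCoord_apply,
        crd2]
    · simp [fullCoord, centerStableField, coordCLM_apply, blockCLM_inl_one, complexCoord_apply,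
        crd1]
  · simp [fullCoord, centerStableField, coordCLM_apply, blockCLM_inr, complexCoord_apply]

/-- This translates the algebraic derivation into the analytic Lie derivative along z ↦ (0, Ay). -/
lemma fderiv_eval_complexCoord_block (P : MvPolynomial (Option (Fin 2 ⊕ Fin (n - 2))) ℂ)
    (z : ℝ × SplitSpace n) :
    fderiv ℝ (fun z => eval (complexCoord z) P) z (0, blockCLM ω M z.2) =
      eval (complexCoord z) (centerStableLie (ω : ℂ) (M.map (algebraMap ℝ ℂ)) P) := by
  rw [(hasFDerivAt_eval_comp complexCoord P z).fderiv, centerStableLie, mkDerivation_eq_sum_pderiv]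
  simp [complexCoord_block]

/-- The homological equation for real maps. -/
theorem exists_homological_solution (hω : ω ≠ 0) (hM : IsStablePoly M.charpoly) {k : ℕ}
    {r : ℝ × SplitSpace n → SplitSpace n} (hr : ContDiffAt ℝ ((k + 1 : ℕ) : WithTop ℕ∞) r 0)
    (ho : ∀ j < k + 1, r =o[𝓝 0] fun z => ‖z‖ ^ j) :
    ∃ (p N : ℝ × SplitSpace n → SplitSpace n)
      (R : MvPolynomial (Option (Fin 2 ⊕ Fin (n - 2))) ℂ),
      ContDiff ℝ (⊤ : ℕ∞) p ∧ ContDiff ℝ (⊤ : ℕ∞) N ∧ p =O[𝓝 0] (fun z => ‖z‖ ^ (k + 1)) ∧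
      fderiv ℝ p =O[𝓝 0] (fun z => ‖z‖ ^ k) ∧
      R ∈ Submodule.span ℂ {m | ∃ a c : ℕ, a + 2 * c = k ∧
        m = paramVar _ ^ a * zetaVar _ ^ (c + 1) * zetaBarVar _ ^ c} ∧
      (∀ z, N z (Sum.inl 0) = (eval (complexCoord z) R).re) ∧
      (∀ z, N z (Sum.inl 1) = (eval (complexCoord z) R).im) ∧
      (∀ z : ℝ × SplitSpace n, (∀ i : Fin (n - 2), z.2 (Sum.inr i) = 0) →
        ∀ j : Fin (n - 2), N z (Sum.inr j) = 0) ∧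
      (fun z => r z + blockCLM ω M (p z) - fderiv ℝ p z (0, blockCLM ω M z.2) - N z)
          =o[𝓝 0] (fun z => ‖z‖ ^ (k + 1)) := by
  have hMc : ∀ z : ℂ, (M.map (algebraMap ℝ ℂ)).charpoly.IsRoot z → z.re < 0 := by
    intro z hz
    refine hM z ?_
    rw [Matrix.charpoly_map] at hz
    rw [Polynomial.aeval_def, ← Polynomial.eval_map]
    exact hz
  have hcoord : ∀ i, ∃ q : MvPolynomial (Option (Fin 2 ⊕ Fin (n - 2))) ℂ, q.IsHomogeneous (k + 1) ∧
      (∀ z, (eval (complexCoord z) q).im = 0) ∧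
      (fun z => r z i - (eval (complexCoord z) q).re) =o[𝓝 0] fun z => ‖z‖ ^ (k + 1) := fun i =>
    exists_homogeneous_approx_coord ((contDiffAt_pi.1 hr) i) fun j hj =>
      (isLittleO_pi.1 (ho j hj)) i
  choose q hq hqim hqr using hcoord
  -- The two center components are merged into ẏ₁ + iẏ₂, on which the rotation block acts as
  -- multiplication by iω.
  obtain ⟨P, hP, hPR⟩ := exists_center_solution hω hMc
    (q := q (Sum.inl 0) + Complex.I • q (Sum.inl 1))
    ((hq _).add ((homogeneousSubmodule _ ℂ _).smul_mem _ (hq _)))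
  obtain ⟨Q, hQ, hQR⟩ := exists_stable_solution (ω := ω) hMc (fun j => hq (Sum.inr j))
  set p : ℝ × SplitSpace n → SplitSpace n := fun z => Sum.elim
    ![(eval (complexCoord z) P).re, (eval (complexCoord z) P).im]
    (fun j => (eval (complexCoord z) (Q j)).re) with hp
  have hpre : ∀ P : MvPolynomial (Option (Fin 2 ⊕ Fin (n - 2))) ℂ,
      ContDiff ℝ (⊤ : ℕ∞) fun z : ℝ × SplitSpace n => (eval (complexCoord z) P).re := fun P =>
    Complex.reCLM.contDiff.comp (contDiff_eval_comp complexCoord P)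
  have hpim : ∀ P : MvPolynomial (Option (Fin 2 ⊕ Fin (n - 2))) ℂ,
      ContDiff ℝ (⊤ : ℕ∞) fun z : ℝ × SplitSpace n => (eval (complexCoord z) P).im := fun P =>
    Complex.imCLM.contDiff.comp (contDiff_eval_comp complexCoord P)
  have hps : ContDiff ℝ (⊤ : ℕ∞) p := by
    rw [contDiff_pi]
    rintro (i | j)
    · fin_cases i
      exacts [hpre P, hpim P]
    · exact hpre (Q j)
  have hpd : Differentiable ℝ p := hps.differentiable (by simp)
  have hphom : ∀ (t : ℝ) z, 0 < t → p (t • z) = t ^ (k + 1) • p z := by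
    intro t z _
    ext i
    rcases i with i | j
    · fin_cases i
      · change (eval (complexCoord (t • z)) P).re = t ^ (k + 1) • (eval (complexCoord z) P).re
        rw [eval_comp_smul _ hP, Complex.smul_re]
      · change (eval (complexCoord (t • z)) P).im = t ^ (k + 1) • (eval (complexCoord z) P).im
        rw [eval_comp_smul _ hP, Complex.smul_im]
    · change (eval (complexCoord (t • z)) (Q j)).re = t ^ (k + 1) • (eval (complexCoord z) (Q j)).re
      rw [eval_comp_smul _ (hQ j), Complex.smul_re]
  have hcomp : ∀ z w i, fderiv ℝ p z w i = fderiv ℝ (fun z => p z i) z w := fun z w i => by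
    rw [((hasFDerivAt_pi'.1 (hpd z).hasFDerivAt) i).fderiv]; rfl
  have hdre : ∀ (P : MvPolynomial (Option (Fin 2 ⊕ Fin (n - 2))) ℂ) (z w : ℝ × SplitSpace n),
      fderiv ℝ (fun z => (eval (complexCoord z) P).re) z w =
        (fderiv ℝ (fun z => eval (complexCoord z) P) z w).re := fun P z w => by
    have h1 : DifferentiableAt ℝ (fun z => eval (complexCoord z) P) z :=
      (hasFDerivAt_eval_comp complexCoord P z).differentiableAt
    exact DFunLike.congr_fun (HasFDerivAt.fderiv (f := fun z => (eval (complexCoord z) P).re)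
      (Complex.reCLM.hasFDerivAt.comp z h1.hasFDerivAt)) w
  have hdim : ∀ (P : MvPolynomial (Option (Fin 2 ⊕ Fin (n - 2))) ℂ) (z w : ℝ × SplitSpace n),
      fderiv ℝ (fun z => (eval (complexCoord z) P).im) z w =
        (fderiv ℝ (fun z => eval (complexCoord z) P) z w).im := fun P z w => by
    have h1 : DifferentiableAt ℝ (fun z => eval (complexCoord z) P) z :=
      (hasFDerivAt_eval_comp complexCoord P z).differentiableAt
    exact DFunLike.congr_fun (HasFDerivAt.fderiv (f := fun z => (eval (complexCoord z) P).im)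
      (Complex.imCLM.hasFDerivAt.comp z h1.hasFDerivAt)) w
  -- N is what remains of the homological equation after r is replaced by its leading homogeneous
  -- part. Its center components are the resonant polynomial R.
  set N : ℝ × SplitSpace n → SplitSpace n := fun z => (fun i => (eval (complexCoord z) (q i)).re) +
    blockCLM ω M (p z) - fderiv ℝ p z (0, blockCLM ω M z.2) with hN
  have hNi : ∀ z i, N z i = (eval (complexCoord z) (q i)).re + blockCLM ω M (p z) i -
      fderiv ℝ p z (0, blockCLM ω M z.2) i := fun z i => rfl
  have hNs : ContDiff ℝ (⊤ : ℕ∞) N := by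
    refine ((contDiff_pi.2 fun i => hpre (q i)).add ((blockCLM ω M).contDiff.comp hps)).sub ?_
    refine (hps.fderiv_right (m := (⊤ : ℕ∞)) (by simp)).clm_apply ?_
    exact contDiff_const.prodMk ((blockCLM ω M).contDiff.comp contDiff_snd)
  refine ⟨p, N, _, hps, hNs, isBigO_of_homogeneous hps.continuous hphom,
    isBigO_of_homogeneous (hps.continuous_fderiv (by simp)) (fderiv_homogeneous hpd hphom), hPR,
    fun z => ?_, fun z => ?_, fun z hz j => ?_, ?_⟩
  · have h1 := hqim (Sum.inl 1) z
    rw [hNi, hcomp, blockCLM_inl_zero]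
    have h2 : fderiv ℝ (fun z => p z (Sum.inl 0)) z (0, blockCLM ω M z.2) =
      (eval (complexCoord z) (centerStableLie (ω : ℂ) (M.map (algebraMap ℝ ℂ)) P)).re := by
      rw [← fderiv_eval_complexCoord_block, ← hdre]; rfl
    rw [h2]
    simp [smul_eval, h1, crd2, hp]
  · have h1 := hqim (Sum.inl 0) z
    rw [hNi, hcomp, blockCLM_inl_one]
    have h2 : fderiv ℝ (fun z => p z (Sum.inl 1)) z (0, blockCLM ω M z.2) =
      (eval (complexCoord z) (centerStableLie (ω : ℂ) (M.map (algebraMap ℝ ℂ)) P)).im := by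
      rw [← fderiv_eval_complexCoord_block, ← hdim]; rfl
    rw [h2]
    simp [smul_eval, h1, crd1, hp]
  · have h1 := congrArg Complex.re (hQR j (complexCoord z) fun i => by
      rw [complexCoord_apply]
      exact_mod_cast hz i)
    rw [hNi, hcomp, blockCLM_inr]
    have h2 : fderiv ℝ (fun z => p z (Sum.inr j)) z (0, blockCLM ω M z.2) =
      (eval (complexCoord z) (centerStableLie (ω : ℂ) (M.map (algebraMap ℝ ℂ)) (Q j))).re := by
      rw [← fderiv_eval_complexCoord_block, ← hdre]; rfl
    rw [h2]
    have hMj : ∀ l, (M.map (algebraMap ℝ ℂ)) j l = (M j l : ℂ) := fun l => rfl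
    simp only [map_add, map_sub, map_sum, smul_eval, hMj, Complex.add_re, Complex.sub_re,
      Complex.re_sum, Complex.re_ofReal_mul, Complex.zero_re] at h1
    simp only [hp, Sum.elim_inr]
    linarith
  · rw [isLittleO_pi]
    refine fun i => (hqr i).congr_left fun z => ?_
    simp only [hN, Pi.sub_apply, Pi.add_apply]
    ring

end coordinates

/-! ### Pullbacks under near-identity transformations -/

section nearIdentity
variable {V : Type*} [NormedAddCommGroup V] [NormedSpace ℝ V] {Φ Ψ : ℝ × V → ℝ × V}

lemma IsNearIdentity.map_zero (h : IsNearIdentity Φ) : Φ 0 = 0 := by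
  have := (isLittleO_iff.1 h.near_id one_pos).self_of_nhds
  simpa using this

lemma IsNearIdentity.hasFDerivAt (h : IsNearIdentity Φ) :
    HasFDerivAt Φ (ContinuousLinearMap.id ℝ (ℝ × V)) 0 := by
  rw [hasFDerivAt_iff_isLittleO_nhds_zero]
  simpa [h.map_zero] using h.near_id.of_norm_right

lemma IsNearIdentity.tendsto (h : IsNearIdentity Φ) : Tendsto Φ (𝓝 0) (𝓝 0) := by
  simpa [h.map_zero] using h.hasFDerivAt.continuousAt.tendsto

lemma IsNearIdentity.contDiffAt_fderiv (h : IsNearIdentity Φ) (m : ℕ) :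
    ContDiffAt ℝ m (fderiv ℝ Φ) 0 :=
  h.smooth.contDiffAt.fderiv_right (m := m) (by exact_mod_cast le_top)

lemma IsNearIdentity.eventually_isInvertible [CompleteSpace V] (h : IsNearIdentity Φ) :
    ∀ᶠ z in 𝓝 0, (fderiv ℝ Φ z).IsInvertible := by
  have h1 : Tendsto (fderiv ℝ Φ) (𝓝 0) (𝓝 ((ContinuousLinearEquiv.refl ℝ (ℝ × V) :
      (ℝ × V) ≃L[ℝ] (ℝ × V)) : (ℝ × V) →L[ℝ] (ℝ × V))) := by
    have h2 := (h.contDiffAt_fderiv 0).continuousAt.tendsto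
    rwa [h.hasFDerivAt.fderiv] at h2
  filter_upwards [h1.eventually (ContinuousLinearEquiv.nhds _)] with z hz using hz

lemma IsNearIdentity.eventually_fderiv_pullback [CompleteSpace V] (h : IsNearIdentity Φ)
    (X : ℝ × V → ℝ × V) :
    ∀ᶠ z in 𝓝 0, fderiv ℝ Φ z (VectorField.pullback ℝ Φ X z) = X (Φ z) := by
  filter_upwards [h.eventually_isInvertible] with z hz
  exact VectorField.fderiv_pullback Φ X z hz

lemma IsNearIdentity.eventually_fderiv_fst (h : IsNearIdentity Φ) :
    ∀ᶠ z in 𝓝 0, ∀ w, (fderiv ℝ Φ z w).1 = w.1 := by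
  filter_upwards [h.smooth.eventually_differentiableAt] with z hz w
  have h1 : HasFDerivAt (fun z => (Φ z).1)
      ((ContinuousLinearMap.fst ℝ ℝ V).comp (fderiv ℝ Φ z)) z := hz.hasFDerivAt.fst
  simp only [h.fst_eq] at h1
  exact DFunLike.congr_fun (h1.unique hasFDerivAt_fst) w

lemma IsNearIdentity.eventually_pullback_fst [CompleteSpace V] (h : IsNearIdentity Φ)
    {X : ℝ × V → ℝ × V} (hX : ∀ᶠ z in 𝓝 0, (X z).1 = 0) :
    ∀ᶠ z in 𝓝 0, (VectorField.pullback ℝ Φ X z).1 = 0 := by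
  filter_upwards [h.eventually_fderiv_pullback X, h.eventually_fderiv_fst,
    h.tendsto.eventually hX] with z h1 h2 h3
  rw [← h2, h1, h3]

lemma IsNearIdentity.pullback_zero (h : IsNearIdentity Φ) {X : ℝ × V → ℝ × V} (hX : X 0 = 0) :
    VectorField.pullback ℝ Φ X 0 = 0 := by
  rw [VectorField.pullback, h.map_zero, hX, _root_.map_zero]

lemma IsNearIdentity.contDiffAt_pullback [CompleteSpace V] (h : IsNearIdentity Φ)
    {X : ℝ × V → ℝ × V} {m : ℕ} (hX : ContDiffAt ℝ m X 0) :
    ContDiffAt ℝ m (VectorField.pullback ℝ Φ X) 0 := by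
  have h1 : ContDiffAt ℝ m (fun z => (fderiv ℝ Φ z).inverse) 0 :=
    (h.eventually_isInvertible.self_of_nhds.contDiffAt_map_inverse).comp 0 (h.contDiffAt_fderiv m)
  have h2 : ContDiffAt ℝ m (fun z => X (Φ z)) 0 :=
    ContDiffAt.comp 0 (by rwa [h.map_zero])
      (h.smooth.contDiffAt.of_le (by exact_mod_cast le_top))
  exact h1.clm_apply h2

lemma IsNearIdentity.comp (hΦ : IsNearIdentity Φ) (hΨ : IsNearIdentity Ψ) :
    IsNearIdentity (Φ ∘ Ψ) where
  smooth := SmoothNear.comp (by rw [hΨ.map_zero]; exact hΦ.smooth) hΨ.smooth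
  fst_eq z := by rw [Function.comp_apply, hΦ.fst_eq, hΨ.fst_eq]
  near_id := by
    have h1 : HasFDerivAt (Φ ∘ Ψ) ((ContinuousLinearMap.id ℝ (ℝ × V)).comp
        (ContinuousLinearMap.id ℝ (ℝ × V))) 0 :=
      HasFDerivAt.comp 0 (by rw [hΨ.map_zero]; exact hΦ.hasFDerivAt) hΨ.hasFDerivAt
    exact isLittleO_of_hasFDerivAt_zero (by simp [hΨ.map_zero, hΦ.map_zero]) h1

lemma IsNearIdentity.pullback_comp [CompleteSpace V] (hΦ : IsNearIdentity Φ)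
    (hΨ : IsNearIdentity Ψ) (X : ℝ × V → ℝ × V) :
    VectorField.pullback ℝ (Φ ∘ Ψ) X =ᶠ[𝓝 0]
      VectorField.pullback ℝ Ψ (VectorField.pullback ℝ Φ X) := by
  filter_upwards [hΨ.tendsto.eventually hΦ.eventually_isInvertible,
    hΨ.smooth.eventually_differentiableAt,
    hΨ.tendsto.eventually hΦ.smooth.eventually_differentiableAt] with z h1 h2 h3
  simp only [VectorField.pullback, fderiv_comp z h3 h2, Function.comp_apply]
  rw [h1.inverse_comp_apply_of_left]

variable {p : ℝ × V → V} {k : ℕ}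

/-- The transformation `(x₀, y) ↦ (x₀, y + p(x₀, y))`. -/
def shear (p : ℝ × V → V) (z : ℝ × V) : ℝ × V := (z.1, z.2 + p z)

lemma isNearIdentity_shear (hp : ContDiff ℝ (⊤ : ℕ∞) p)
    (hO : p =O[𝓝 0] fun z => ‖z‖ ^ (k + 2)) : IsNearIdentity (shear p) where
  smooth := (contDiff_fst.prodMk (contDiff_snd.add hp)).smoothNear 0
  fst_eq z := rfl
  near_id := by
    have h1 : p =o[𝓝 0] fun z => ‖z‖ := by
      simpa using hO.trans_isLittleO (norm_pow_succ_isLittleO le_rfl (j := 1) (by omega))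
    refine IsLittleO.congr_left (f₁ := fun z => ((0 : ℝ), p z)) ?_ fun z => ?_
    · exact (isLittleO_zero _ _).prod_left h1
    · simp [shear, Prod.ext_iff]

/-- The effect of the transformation `(x₀, y) ↦ (x₀, y + p(x₀, y))` on a vector field, up to terms
of higher order. -/
theorem pullback_shear_isLittleO [CompleteSpace V] (hp : ContDiff ℝ (⊤ : ℕ∞) p)
    (hO : p =O[𝓝 0] fun z => ‖z‖ ^ (k + 2)) (hO' : fderiv ℝ p =O[𝓝 0] fun z => ‖z‖ ^ (k + 1))
    {X : ℝ × V → ℝ × V} {A : ℝ × V →L[ℝ] ℝ × V} (hX : ContDiffAt ℝ 1 X 0) (hX0 : X 0 = 0)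
    (hA : HasFDerivAt X A 0) :
    HasFDerivAt (VectorField.pullback ℝ (shear p) X) A 0 ∧
    (fun z => VectorField.pullback ℝ (shear p) X z -
      (X z + A (0, p z) - (0, fderiv ℝ p z (A z)))) =o[𝓝 0] fun z => ‖z‖ ^ (k + 2) := by
  have hΦ := isNearIdentity_shear hp hO
  set Y := VectorField.pullback ℝ (shear p) X with hY
  -- The defining relation DΦ·Y = X∘Φ, solved for Y in implicit form. It is used twice: first to get
  -- Y = Az + o(‖z‖), then to replace Y by Az inside Dp.
  have hYz : ∀ᶠ z in 𝓝 0, Y z = X (shear p z) - (0, fderiv ℝ p z (Y z)) := by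
    filter_upwards [hΦ.eventually_fderiv_pullback X] with z hz
    have h1 : HasFDerivAt (shear p) ((ContinuousLinearMap.fst ℝ ℝ V).prod
        (ContinuousLinearMap.snd ℝ ℝ V + fderiv ℝ p z)) z :=
      hasFDerivAt_fst.prodMk
        (hasFDerivAt_snd.add (hp.differentiable (by simp) z).hasFDerivAt)
    rw [h1.fderiv, ← hY] at hz
    rw [← hz]
    ext <;> simp
  have hYO : Y =O[𝓝 0] fun z => ‖z‖ :=
    isBigO_of_hasFDerivAt_zero (hΦ.pullback_zero hX0)
      ((hΦ.contDiffAt_pullback (m := 1) hX).differentiableAt (by simp)).hasFDerivAt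
  have hDY : (fun z => ((0 : ℝ), fderiv ℝ p z (Y z))) =O[𝓝 0] fun z => ‖z‖ ^ (k + 2) := by
    refine (isBigO_zero _ _).prod_left ?_
    refine (IsBigO.of_bound 1 (Eventually.of_forall fun z => ?_)).trans
      ((hO'.norm_left.mul hYO.norm_left).congr_right fun z => (pow_succ _ _).symm)
    rw [one_mul, Real.norm_of_nonneg (by positivity)]
    exact (fderiv ℝ p z).le_opNorm _
  have hstrict : HasStrictFDerivAt X A 0 := hX.hasStrictFDerivAt' hA (by simp)
  -- Strict differentiability compares X at two nearby points with error o(‖p‖), which the ordinary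
  -- derivative at 0 would not give.
  have hdiff : (fun z => X (shear p z) - X z - A (0, p z)) =o[𝓝 0] fun z => ‖z‖ ^ (k + 2) := by
    have h1 := hstrict.isLittleO.comp_tendsto
      ((hΦ.tendsto.prodMk_nhds tendsto_id) : Tendsto (fun z => (shear p z, z)) (𝓝 0) (𝓝 (0, 0)))
    have h2 : ∀ z, shear p z - z = (0, p z) := fun z => by simp [shear, Prod.ext_iff]
    simp only [Function.comp_def, h2] at h1
    exact h1.trans_isBigO ((isBigO_zero _ _).prod_left hO)
  have hYA : (fun z => Y z - A z) =o[𝓝 0] fun z => ‖z‖ := by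
    have h1 := isLittleO_of_hasFDerivAt_zero hX0 hA
    have hlt : (fun z : ℝ × V => ‖z‖ ^ (k + 2)) =o[𝓝 0] fun z => ‖z‖ := by
      simpa using norm_pow_succ_isLittleO (E := ℝ × V) le_rfl (j := 1) (k := k + 2) (by omega)
    have h2 : (fun z => A (0, p z)) =o[𝓝 0] fun z => ‖z‖ :=
      ((A.isBigO_comp _ _).trans ((isBigO_zero _ _).prod_left hO)).trans_isLittleO hlt
    refine (((h1.add (hdiff.trans hlt)).add h2).sub (hDY.trans_isLittleO hlt)).congr' ?_
      EventuallyEq.rfl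
    filter_upwards [hYz] with z hz
    rw [sub_eq_iff_eq_add.1 hz.symm]
    abel
  have hlast : (fun z => ((0 : ℝ), fderiv ℝ p z (Y z - A z))) =o[𝓝 0] fun z => ‖z‖ ^ (k + 2) := by
    refine (isLittleO_zero _ _).prod_left ?_
    refine (IsBigO.of_bound 1 (Eventually.of_forall fun z => ?_)).trans_isLittleO
      ((hO'.norm_left.mul_isLittleO hYA.norm_left).congr_right fun z => (pow_succ _ _).symm)
    rw [one_mul, Real.norm_of_nonneg (by positivity)]
    exact (fderiv ℝ p z).le_opNorm _
  refine ⟨?_, (hdiff.sub hlast).congr' ?_ EventuallyEq.rfl⟩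
  · rw [hasFDerivAt_iff_isLittleO_nhds_zero]
    simpa [hY, hΦ.pullback_zero hX0] using hYA.of_norm_right
  filter_upwards [hYz] with z hz
  have h5 : ((0 : ℝ), fderiv ℝ p z (Y z - A z)) =
      (0, fderiv ℝ p z (Y z)) - (0, fderiv ℝ p z (A z)) := by simp
  rw [h5, sub_eq_iff_eq_add.1 hz.symm]
  abel

end nearIdentity

/-! ### Existence of the normal form up to degree three -/

section normalForm
open MvPolynomial
variable {n : ℕ} {ω : ℝ} {M : Matrix (Fin (n - 2)) (Fin (n - 2)) ℝ}

lemma eval_paramVar (z : ℝ × SplitSpace n) : eval (complexCoord z) (paramVar _) = (z.1 : ℂ) := by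
  simp [paramVar, complexCoord_apply, fullCoord]

lemma eval_zetaVar (z : ℝ × SplitSpace n) :
    eval (complexCoord z) (zetaVar _) = (crd1 z.2 : ℂ) + Complex.I * crd2 z.2 := by
  simp [zetaVar, complexCoord_apply, fullCoord, coordCLM_apply, crd1, crd2]

lemma eval_zetaBarVar (z : ℝ × SplitSpace n) :
    eval (complexCoord z) (zetaBarVar _) = (crd1 z.2 : ℂ) - Complex.I * crd2 z.2 := by
  simp [zetaBarVar, complexCoord_apply, fullCoord, coordCLM_apply, crd1, crd2]

lemma mem_span_resonant_one {ι : Type*} {R : MvPolynomial (Option (Fin 2 ⊕ ι)) ℂ}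
    (hR : R ∈ Submodule.span ℂ {m | ∃ a c : ℕ, a + 2 * c = 1 ∧
        m = paramVar ι ^ a * zetaVar ι ^ (c + 1) * zetaBarVar ι ^ c}) :
    ∃ c : ℂ, R = c • (paramVar ι * zetaVar ι) := by
  have h : {m | ∃ a c : ℕ, a + 2 * c = 1 ∧
      m = paramVar ι ^ a * zetaVar ι ^ (c + 1) * zetaBarVar ι ^ c} ⊆
      {paramVar ι * zetaVar ι} := by
    rintro _ ⟨a, c, hac, rfl⟩
    obtain ⟨rfl, rfl⟩ : a = 1 ∧ c = 0 := by omega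
    simp
  obtain ⟨c, hc⟩ := Submodule.mem_span_singleton.1 (Submodule.span_mono h hR)
  exact ⟨c, hc.symm⟩

lemma mem_span_resonant_two {ι : Type*} {R : MvPolynomial (Option (Fin 2 ⊕ ι)) ℂ}
    (hR : R ∈ Submodule.span ℂ {m | ∃ a c : ℕ, a + 2 * c = 2 ∧
        m = paramVar ι ^ a * zetaVar ι ^ (c + 1) * zetaBarVar ι ^ c}) :
    ∃ c d : ℂ, R = c • (paramVar ι ^ 2 * zetaVar ι) + d • (zetaVar ι ^ 2 * zetaBarVar ι) := by
  have h : {m | ∃ a c : ℕ, a + 2 * c = 2 ∧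
      m = paramVar ι ^ a * zetaVar ι ^ (c + 1) * zetaBarVar ι ^ c} ⊆
      {paramVar ι ^ 2 * zetaVar ι, zetaVar ι ^ 2 * zetaBarVar ι} := by
    rintro _ ⟨a, c, hac, rfl⟩
    obtain ⟨rfl, rfl⟩ | ⟨rfl, rfl⟩ : a = 2 ∧ c = 0 ∨ a = 0 ∧ c = 1 := by omega
    · simp
    · simp
  obtain ⟨c, d, hcd⟩ := Submodule.mem_span_pair.1 (Submodule.span_mono h hR)
  exact ⟨c, d, hcd.symm⟩

/-- The linear vector field `(0, A y)` on the suspended space. -/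
noncomputable def suspLinear (ω : ℝ) (M : Matrix (Fin (n - 2)) (Fin (n - 2)) ℝ) :
    ℝ × SplitSpace n →L[ℝ] ℝ × SplitSpace n :=
  (0 : ℝ × SplitSpace n →L[ℝ] ℝ).prod
    ((blockCLM ω M).comp (ContinuousLinearMap.snd ℝ ℝ (SplitSpace n)))

lemma suspLinear_apply (z : ℝ × SplitSpace n) : suspLinear ω M z = (0, blockCLM ω M z.2) := rfl

/-- One step of the normalization. -/
theorem exists_normalizing_step (hω : ω ≠ 0) (hM : IsStablePoly M.charpoly) {k : ℕ}
    {X : ℝ × SplitSpace n → ℝ × SplitSpace n} (hX : ContDiffAt ℝ ((k + 2 : ℕ) : WithTop ℕ∞) X 0)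
    (hX0 : X 0 = 0) (hA : HasFDerivAt X (suspLinear ω M) 0) {N₀ : ℝ × SplitSpace n → SplitSpace n}
    (hN₀ : ContDiff ℝ (⊤ : ℕ∞) N₀)
    (ho : ∀ j < k + 2, (fun z => (X z).2 - blockCLM ω M z.2 - N₀ z) =o[𝓝 0] fun z => ‖z‖ ^ j) :
    ∃ (Φ : ℝ × SplitSpace n → ℝ × SplitSpace n) (N : ℝ × SplitSpace n → SplitSpace n)
      (R : MvPolynomial (Option (Fin 2 ⊕ Fin (n - 2))) ℂ), IsNearIdentity Φ ∧
      HasFDerivAt (VectorField.pullback ℝ Φ X) (suspLinear ω M) 0 ∧ ContDiff ℝ (⊤ : ℕ∞) N ∧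
      R ∈ Submodule.span ℂ {m | ∃ a c : ℕ, a + 2 * c = k + 1 ∧
        m = paramVar _ ^ a * zetaVar _ ^ (c + 1) * zetaBarVar _ ^ c} ∧
      (∀ z, N z (Sum.inl 0) = (eval (complexCoord z) R).re) ∧
      (∀ z, N z (Sum.inl 1) = (eval (complexCoord z) R).im) ∧
      (∀ z : ℝ × SplitSpace n, (∀ i : Fin (n - 2), z.2 (Sum.inr i) = 0) →
        ∀ j : Fin (n - 2), N z (Sum.inr j) = 0) ∧
      (fun z => (VectorField.pullback ℝ Φ X z).2 - blockCLM ω M z.2 - (N₀ z + N z))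
        =o[𝓝 0] fun z => ‖z‖ ^ (k + 2) := by
  have hr : ContDiffAt ℝ ((k + 1 + 1 : ℕ) : WithTop ℕ∞)
      (fun z => (X z).2 - blockCLM ω M z.2 - N₀ z) 0 := by
    refine (ContDiffAt.sub (contDiff_snd.contDiffAt.comp 0 hX) ?_).sub
      (contDiff_infty.1 hN₀ _).contDiffAt
    exact ((blockCLM ω M).contDiff.comp contDiff_snd).contDiffAt
  obtain ⟨p, N, R, hp, hN, hO, hO', hR, h0, h1, hs, hfin⟩ :=
    exists_homological_solution hω hM hr ho
  obtain ⟨hder, hest⟩ := pullback_shear_isLittleO hp hO hO'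
    (hX.of_le (by exact_mod_cast Nat.le_add_left 1 (k + 1))) hX0 hA
  refine ⟨shear p, N, R, isNearIdentity_shear hp hO, hder, hN, hR, h0, h1, hs, ?_⟩
  have hest2 : (fun z => (VectorField.pullback ℝ (shear p) X z -
      (X z + suspLinear ω M (0, p z) - (0, fderiv ℝ p z (suspLinear ω M z)))).2)
      =o[𝓝 0] fun z => ‖z‖ ^ (k + 2) :=
    (IsBigO.of_bound 1 (Eventually.of_forall fun z => by
      rw [one_mul]; exact norm_snd_le _)).trans_isLittleO hest
  refine (hest2.add hfin).congr_left fun z => ?_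
  simp only [suspLinear_apply, Prod.snd_sub, Prod.snd_add]
  abel

/-- A vector field with the spectral data of a Hopf bifurcation has a normal form on an invariant
manifold. -/
theorem exists_isNFIM_pullback (hω : ω ≠ 0) (hM : IsStablePoly M.charpoly)
    {X : ℝ × SplitSpace n → ℝ × SplitSpace n} (hX : ContDiffAt ℝ 3 X 0)
    (hX0 : X 0 = 0) (hfst : ∀ᶠ z in 𝓝 0, (X z).1 = 0) (hA : HasFDerivAt X (suspLinear ω M) 0) :
    ∃ Φ : ℝ × SplitSpace n → ℝ × SplitSpace n, IsNearIdentity Φ ∧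
      ∃ α β μ γ ρ σ : ℝ, IsNFIM (VectorField.pullback ℝ Φ X) ω α β μ γ ρ σ := by
  have hX3 : ContDiffAt ℝ ((1 + 2 : ℕ) : WithTop ℕ∞) X 0 := hX
  obtain ⟨Φ, N, R, hΦ, hder, hN, hR, hN0, hN1, hNs, ho⟩ := exists_normalizing_step hω hM (k := 0)
    (hX3.of_le (by norm_num)) hX0 hA (N₀ := 0) contDiff_const (fun j hj => by
      have h1 : (fun z => (X z).2 - blockCLM ω M z.2 - (0 : ℝ × SplitSpace n → SplitSpace n) z)
          =o[𝓝 0] fun z => ‖z‖ ^ 1 := by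
        have h2 := isLittleO_of_hasFDerivAt_zero hX0 hA
        refine (((IsBigO.of_bound 1 (Eventually.of_forall fun z => by
          rw [one_mul]; exact norm_snd_le _)).trans_isLittleO h2).congr_left
          (f₁ := fun z => (X z - suspLinear ω M z).2) fun z => ?_).congr_right fun z => by simp
        simp [suspLinear_apply]
      rcases Nat.lt_or_ge j 1 with h | h
      · exact h1.trans (norm_pow_succ_isLittleO le_rfl h)
      · obtain rfl : j = 1 := by omega
        exact h1)
  simp only [Pi.zero_apply, zero_add] at ho
  -- The second step has p of order three, so it keeps the quadratic part N reached by the first one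
  -- and normalizes only cubic terms.
  obtain ⟨Ψ, N', R', hΨ, -, -, hR', hN0', hN1', hNs', ho'⟩ := exists_normalizing_step hω hM (k := 1)
    (hΦ.contDiffAt_pullback hX3) (hΦ.pullback_zero hX0) hder hN (fun j hj => by
      rcases Nat.lt_or_ge j 2 with h | h
      · exact ho.trans (norm_pow_succ_isLittleO le_rfl h)
      · obtain rfl : j = 2 := by omega
        exact ho)
  obtain ⟨c, rfl⟩ := mem_span_resonant_one hR
  obtain ⟨d, e, rfl⟩ := mem_span_resonant_two hR'
  have hYY := hΦ.pullback_comp hΨ X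
  have ho'' := ho'.congr' (f₂ := fun z => (VectorField.pullback ℝ (Φ ∘ Ψ) X z).2 -
    blockCLM ω M z.2 - (N z + N' z)) (by
      filter_upwards [hYY] with z hz
      rw [hz]) EventuallyEq.rfl
  rw [isLittleO_pi] at ho''
  -- The coefficients of x₀ζ, ζ²ζ̄ and x₀²ζ are α + iμ, β + iγ and ρ + iσ.
  refine ⟨Φ ∘ Ψ, hΦ.comp hΨ, c.re, e.re, c.im, e.im, d.re, d.im,
    (hΦ.comp hΨ).eventually_pullback_fst hfst, ?_, ?_, fun j => ?_⟩
  · refine (ho'' (Sum.inl 0)).congr_left fun z => ?_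
    simp only [Pi.sub_apply, Pi.add_apply, hN0, hN0', blockCLM_inl_zero, smul_eval, map_add,
      map_mul, map_pow, eval_paramVar, eval_zetaVar, eval_zetaBarVar, crd1]
    simp [pow_two]
    ring
  · refine (ho'' (Sum.inl 1)).congr_left fun z => ?_
    simp only [Pi.sub_apply, Pi.add_apply, hN1, hN1', blockCLM_inl_one, smul_eval, map_add,
      map_mul, map_pow, eval_paramVar, eval_zetaVar, eval_zetaBarVar, crd2]
    simp [pow_two]
    ring
  · refine ((ho'' (Sum.inr j)).mono nhdsWithin_le_nhds).congr' ?_ EventuallyEq.rfl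
    filter_upwards [self_mem_nhdsWithin] with z hz
    have hz' : ∀ i : Fin (n - 2), z.2 (Sum.inr i) = 0 := hz
    simp [hNs z hz' j, hNs' z hz' j, blockCLM_inr, hz']

end normalForm

/-! ### The given system in adapted coordinates, and the proposition -/

section conjugation
variable {n m : ℕ} {h : (Fin n → ℝ) × (Fin m → ℝ) → (Fin n → ℝ)} {pstar v : Fin m → ℝ}
  {S : SplitSpace n ≃L[ℝ] (Fin n → ℝ)}

/-- The vector field in the linear coordinates `S`. -/
abbrev conjField (S : SplitSpace n ≃L[ℝ] (Fin n → ℝ))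
    (h : (Fin n → ℝ) × (Fin m → ℝ) → (Fin n → ℝ)) :
    SplitSpace n × (Fin m → ℝ) → SplitSpace n :=
  fun q => S.symm (h (S q.1, q.2))

lemma suspEquiv_suspension_conjField (z : ℝ × SplitSpace n) :
    suspEquiv S (suspension (conjField S h) pstar v z) =
      suspension h pstar v (suspEquiv S z) := by
  simp [suspEquiv, suspension, conjField]

lemma IsNearIdentity.isTransform {Φ : ℝ × SplitSpace n → ℝ × SplitSpace n}
    (hΦ : IsNearIdentity Φ) :
    IsTransform (fun z => suspEquiv S (Φ z)) (suspEquiv S)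
      (VectorField.pullback ℝ Φ (suspension (conjField S h) pstar v)) (suspension h pstar v) where
  smooth := SmoothNear.comp ((suspEquiv S).contDiff.smoothNear _) hΦ.smooth
  map_zero := by rw [hΦ.map_zero, _root_.map_zero]
  hasFDerivAt := (suspEquiv S).hasFDerivAt.comp 0 hΦ.hasFDerivAt
  intertwine := by
    filter_upwards [hΦ.eventually_fderiv_pullback (suspension (conjField S h) pstar v),
      hΦ.smooth.eventually_differentiableAt] with z h1 h2
    have h3 : HasFDerivAt (fun z => suspEquiv S (Φ z)) _ z :=
      (suspEquiv S).hasFDerivAt.comp z h2.hasFDerivAt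
    rw [h3.fderiv, ← suspEquiv_suspension_conjField, ← h1]
    rfl

lemma contDiffAt_suspension_conjField (hh : ContDiffAt ℝ 4 h (0, pstar)) :
    ContDiffAt ℝ 4 (suspension (conjField S h) pstar v) 0 := by
  have h1 : ContDiff ℝ 4 fun z : ℝ × SplitSpace n => (S z.2, pstar + z.1 • v) :=
    (S.contDiff.comp contDiff_snd).prodMk (contDiff_const.add (contDiff_fst.smul contDiff_const))
  have h2 : ContDiffAt ℝ 4 (fun z : ℝ × SplitSpace n => h (S z.2, pstar + z.1 • v)) 0 :=
    ContDiffAt.comp 0 (by simpa using hh) h1.contDiffAt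
  exact contDiffAt_const.prodMk (S.symm.contDiff.contDiffAt.comp 0 h2)

/-- Because h(0, p) = 0 for p near p*, the field vanishes along the x₀-axis and the derivative has
no x₀ column. The y columns are S⁻¹BS. -/
lemma hasFDerivAt_suspension_conjField (hh : ContDiffAt ℝ 4 h (0, pstar))
    (h0 : ∀ᶠ p in 𝓝 pstar, h (0, p) = 0) {ω : ℝ} {M : Matrix (Fin (n - 2)) (Fin (n - 2)) ℝ}
    (hB : LinearMap.toMatrix' (S.symm.toLinearMap ∘ₗ Matrix.toLin' (linearization h pstar) ∘ₗ
      S.toLinearMap) = Matrix.fromBlocks !![0, -ω; ω, 0] 0 0 M) :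
    HasFDerivAt (suspension (conjField S h) pstar v) (suspLinear ω M) 0 := by
  have hd : HasFDerivAt (suspension (conjField S h) pstar v)
      (fderiv ℝ (suspension (conjField S h) pstar v) 0) 0 :=
    ((contDiffAt_suspension_conjField hh).differentiableAt (by simp)).hasFDerivAt
  refine hd.congr_fderiv ?_
  set D := fderiv ℝ (suspension (conjField S h) pstar v) 0
  have hD1 : D.comp (ContinuousLinearMap.inl ℝ ℝ (SplitSpace n)) = 0 := by
    have e1 : HasFDerivAt (fun t : ℝ => suspension (conjField S h) pstar v (t, 0))
        (D.comp (ContinuousLinearMap.inl ℝ ℝ (SplitSpace n))) 0 :=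
      HasFDerivAt.comp (g := suspension (conjField S h) pstar v) (0 : ℝ)
        hd (ContinuousLinearMap.inl ℝ ℝ (SplitSpace n)).hasFDerivAt
    refine e1.unique ((hasFDerivAt_const 0 0).congr_of_eventuallyEq ?_)
    have e2 : Tendsto (fun t : ℝ => pstar + t • v) (𝓝 0) (𝓝 pstar) := by
      have : Continuous fun t : ℝ => pstar + t • v := by fun_prop
      simpa using this.tendsto 0
    filter_upwards [e2.eventually h0] with t ht
    simp [suspension, conjField, ht]
  have hD2 : D.comp (ContinuousLinearMap.inr ℝ ℝ (SplitSpace n)) =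
      (ContinuousLinearMap.inr ℝ ℝ (SplitSpace n)).comp (blockCLM ω M) := by
    have e1 : HasFDerivAt (fun y : SplitSpace n => suspension (conjField S h) pstar v (0, y))
        (D.comp (ContinuousLinearMap.inr ℝ ℝ (SplitSpace n))) 0 :=
      HasFDerivAt.comp (g := suspension (conjField S h) pstar v) (0 : SplitSpace n)
        hd (ContinuousLinearMap.inr ℝ ℝ (SplitSpace n)).hasFDerivAt
    refine e1.unique ?_
    have e2 : DifferentiableAt ℝ (fun x : Fin n → ℝ => h (x, pstar)) (S 0) := by
      rw [map_zero]
      exact DifferentiableAt.comp 0 (hh.differentiableAt (by simp)) (by fun_prop)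
    have e3 := (S.symm.hasFDerivAt.comp (0 : SplitSpace n)
      (e2.hasFDerivAt.comp (0 : SplitSpace n) S.hasFDerivAt))
    have e4 := (hasFDerivAt_const (0 : ℝ) (0 : SplitSpace n)).prodMk e3
    refine (e4.congr_of_eventuallyEq (f₁ := fun y : SplitSpace n =>
      suspension (conjField S h) pstar v (0, y)) (Eventually.of_forall fun y => ?_)).congr_fderiv ?_
    · simp [suspension, conjField]
    · refine ContinuousLinearMap.ext fun y => ?_
      have e5 := (conj_iff _).1 hB y
      have e6 : (linearization h pstar).mulVec (S y) =
          fderiv ℝ (fun x : Fin n → ℝ => h (x, pstar)) 0 (S y) := LinearMap.toMatrix'_mulVec _ _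
      rw [e6] at e5
      simp [e5, blockCLM]
  refine ContinuousLinearMap.ext fun z => ?_
  have hz : z = (z.1, 0) + (0, z.2) := by simp
  have f1 := DFunLike.congr_fun hD1 z.1
  have f2 := DFunLike.congr_fun hD2 z.2
  simp only [ContinuousLinearMap.comp_apply, ContinuousLinearMap.inl_apply,
    ContinuousLinearMap.inr_apply, zero_apply] at f1 f2
  conv_lhs => rw [hz, map_add, f1, f2, zero_add]
  rfl

end conjugation

theorem proposition3 {n m : ℕ} (hn : 2 ≤ n)
    (U : Set ((Fin n → ℝ) × (Fin m → ℝ))) (hU : IsOpen U)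
    (h : (Fin n → ℝ) × (Fin m → ℝ) → (Fin n → ℝ)) (hh : ContDiffOn ℝ 4 h U)
    (h_zero : ∀ p : Fin m → ℝ, (0, p) ∈ U → h (0, p) = 0)
    (pstar v : Fin m → ℝ) (hp : (0, pstar) ∈ U) :
    (HopfBifurcation h pstar v ↔
      SpectralConditions (linearization h pstar) ∧
      ∃ ψ : MvPolynomial (Fin n) ℝ, IsKernelForm (linearization h pstar) ψ ∧
        (∃ β : ℝ, β ≠ 0 ∧ BetaCondition (fun x => h (x, pstar)) ψ β) ∧
        (∃ α : ℝ, α ≠ 0 ∧ AlphaCondition (suspension h pstar v) ψ α)) ∧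
    (∀ (ψ : MvPolynomial (Fin n) ℝ) (α β : ℝ),
      (∃ S : SplitSpace n ≃L[ℝ] (Fin n → ℝ),
          (∀ y, MvPolynomial.eval (S y) ψ = crd1 y ^ 2 + crd2 y ^ 2) ∧
          HasHopfNFIM h pstar v S α β) ↔
        SpectralConditions (linearization h pstar) ∧
        IsKernelForm (linearization h pstar) ψ ∧
        BetaCondition (fun x => h (x, pstar)) ψ β ∧
        AlphaCondition (suspension h pstar v) ψ α) := by
  have hhat : ContDiffAt ℝ 4 h (0, pstar) := hh.contDiffAt (hU.mem_nhds hp)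
  have h0 : ∀ᶠ p in 𝓝 pstar, h (0, p) = 0 := by
    have hc : Tendsto (fun p : Fin m → ℝ => ((0 : Fin n → ℝ), p)) (𝓝 pstar) (𝓝 (0, pstar)) :=
      (Continuous.prodMk_right 0).tendsto pstar
    filter_upwards [hc.eventually (hU.mem_nhds hp)] with p hpU using h_zero p hpU
  have hF : ∀ x, suspension h pstar v (0, x) = (0, h (x, pstar)) := fun x => by
    simp [suspension]
  have main : ∀ (ψ : MvPolynomial (Fin n) ℝ) (α β : ℝ),
      (∃ S : SplitSpace n ≃L[ℝ] (Fin n → ℝ),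
          (∀ y, MvPolynomial.eval (S y) ψ = crd1 y ^ 2 + crd2 y ^ 2) ∧
          HasHopfNFIM h pstar v S α β) ↔
        SpectralConditions (linearization h pstar) ∧
        IsKernelForm (linearization h pstar) ψ ∧
        BetaCondition (fun x => h (x, pstar)) ψ β ∧
        AlphaCondition (suspension h pstar v) ψ α := by
    intro ψ α β
    constructor
    · rintro ⟨S, hψ, ω, ⟨hω, M, hM, hB⟩, Φ, hΦ, μ, γ, ρ, σ, hX⟩
      have hM' := (isStablePoly_iff_aroots M.charpoly_monic).2 hM
      have hT := hΦ.isTransform (h := h) (pstar := pstar) (v := v) (S := S)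
      refine ⟨spectralConditions_of_adapted hω hM' hB, ?_,
        hT.betaCondition hΦ.fst_eq hX hψ hF, hT.alphaCondition hΦ.fst_eq hX hψ⟩
      rw [eq_circleForm hψ]
      exact isKernelForm_circleForm hω hM' hB
    · rintro ⟨hB, hψ, hβ, hα⟩
      obtain ⟨S, ω, M, hω, hM, hBS, hψS⟩ := exists_adapted_coordinates hn hB hψ
      -- A normal form exists with some α', β'. The conditions (ii) and (iii) enter only through
      -- uniqueness, which identifies these with α and β.
      obtain ⟨Φ, hΦ, α', β', μ, γ, ρ, σ, hX⟩ := exists_isNFIM_pullback hω hM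
        ((contDiffAt_suspension_conjField (S := S) (v := v) hhat).of_le (by norm_num))
        (by simp [suspension, conjField, h0.self_of_nhds])
        (Eventually.of_forall fun z => rfl)
        (hasFDerivAt_suspension_conjField hhat h0 hBS)
      have hT := hΦ.isTransform (h := h) (pstar := pstar) (v := v) (S := S)
      obtain rfl := hT.alpha_unique hΦ.fst_eq hX hψS hα
      obtain rfl := hT.beta_unique hΦ.fst_eq hX hψS hF hβ
      exact ⟨S, hψS, ω, ⟨hω, M, (isStablePoly_iff_aroots M.charpoly_monic).1 hM, hBS⟩, Φ, hΦ,
        μ, γ, ρ, σ, hX⟩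
  refine ⟨⟨?_, ?_⟩, main⟩
  · rintro ⟨S, α, β, hα, hβ, hS⟩
    -- Without a given ψ, the form that is y₁² + y₂² in the coordinates S serves.
    obtain ⟨h1, h2, h3, h4⟩ := (main (circleForm S) α β).1
      ⟨S, fun y => by rw [eval_circleForm, S.symm_apply_apply], hS⟩
    exact ⟨h1, circleForm S, h2, ⟨β, hβ, h3⟩, ⟨α, hα, h4⟩⟩
  · rintro ⟨h1, ψ, h2, ⟨β, hβ, h3⟩, ⟨α, hα, h4⟩⟩
    obtain ⟨S, -, hS⟩ := (main ψ α β).2 ⟨h1, h2, h3, h4⟩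
    exact ⟨S, α, β, hα, hβ, hS⟩
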